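/- **Setting.** *PROMPT-LTL.* Formulas over a set $V$ of atomic propositions are given by $\varphi ::= a \mid \neg a \mid \varphi\wedge\varphi \mid \varphi\vee\varphi \mid \mathbf{X}\varphi \mid \varphi\,\mathbf{U}\,\varphi \mid \varphi\,\mathbf{R}\,\varphi \mid \mathbf{F_P}\varphi$ with $a \in V$. They are evaluated on infinite words $w \in (2^V)^\omega$ with respect to a bound $k\in\mathbb N$: the LTL operators are interpreted as usual, and $\mathbf{F_P}\varphi$ holds at position $i$ if $\varphi$ holds at some position in $\{i,\dots,i+k\}$. We write $(w,k)\models\varphi$ if $\varphi$ holds at position $0$. An assume-guarantee specification is a pair $\langle\varphi,\psi\rangle$ of PROMPT-LTL formulas. *Architectures.* An architecture $\mathcal A$ consists of a finite set $P$ of processes with a distinguished environment process $p_{env}$ (put $P^-=P\setminus\{p_{env}\}$) and, for every $p\in P$, finite sets $I_p$ of input variables and $O_p$ of output variables, where the sets $O_p$ are pairwise disjoint and $I_p\subseteq\bigcup_{q\in P}O_q$. The asynchronous architecture $\mathcal A^*$ is obtained by adding fresh scheduling variables $\mathrm{sched}_p$, $p \in P^-$: $O^*_{p_{env}}=O_{p_{env}}\cup\{\mathrm{sched}_p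 : p\in P^-\}$, $I^*_p=I_p\cup\{\mathrm{sched}_p\}$ for $p\in P^-$, and all other sets are unchanged. *Implementations.* For $p\in P^-$, a finite-state implementation of size $b$ in $\mathcal A^*$ is a function $f_p\colon(2^{I^*_p})^*\to 2^{O_p}$ for which there is a finite transition system with exactly $b$ states (some of which may be unreachable), with an initial state $s_0$, a transition function $\Delta$ reading letters of $2^{I_p^*}$ and a state labeling $\ell$ with values in $2^{O_p}$, such that $f_p(u)=\ell(\Delta^*(u))$ for every finite word $u$, where $\Delta^*(u)$ is the state reached from $s_0$ on reading $u$, and such that the state does not change when $p$ is not scheduled: $\Delta^*(ux)=\Delta^*(u)$ for every finite word $u$ and every letter $x\in 2^{I_p^*}$ with $\mathrm{sched}_p\notin x$. *Satisfaction.* The words of the composition $\bigotimes_{p\in P^-}f_p$ are the infinite words $w=w_0w_1\cdots$ over $2^{O^*_{p_{env}}\cup\bigcup_{p\in P^-}O_p}$ with $w_i\cap O_p=f_p\big((w_0\cap I^*_p)\cdots(w_{i-1}\cap I^*_p)\big)$ for all $i \in \mathbb N$ and $p\in P^-$. The composition satisfies $\langle\varphi,\psi\rangle$ in $\mathcal A^*$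 if for every $k\in\mathbb N$ there is $l\in\mathbb N$ such that every word $w$ of the composition with $(w,k)\models\varphi$ has $(w,l)\models\psi$. *Constraint systems.* A constraint system is a quantifier-free first-order sentence over countably many function symbols of every arity (constants included), equality, and a binary relation symbol $\le$. It is satisfiable if it holds in some nonempty structure in which $\le$ is a total order and in which the function symbols are interpreted arbitrarily (uninterpreted functions). **Theorem.** 1. Satisfiability of constraint systems is decidable. 2. There is an algorithm that, given an architecture $\mathcal A$, an assume-guarantee specification $\langle\varphi,\psi\rangle$ over the variables of $\mathcal A^*$, and a family of bounds $(b_p)_{p\in P^-}$ in $\mathbb N$, constructs a constraint system $C$ such that $C$ is satisfiable if, and only if, there exist finite-state implementations $f_p$ of size $b_p$ in $\mathcal A^*$, for every $p\in P^-$, such that $\bigotimes_{p\in P^-}f_p$ satisfies $\langle\varphi,\psi\rangle$ in $\mathcal A^*$. -/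

import Mathlib

namespace PromptSynthesis

/-! ### PROMPT-LTL -/

/-- Formulas of PROMPT-LTL over the atomic propositions `V`, in negation normal form. -/
inductive PromptLTL (V : Type) : Type
  | atom (a : V)
  | natom (a : V)
  | and (φ ψ : PromptLTL V)
  | or (φ ψ : PromptLTL V)
  | next (φ : PromptLTL V)
  | untl (φ ψ : PromptLTL V)
  | release (φ ψ : PromptLTL V)
  | prompt (φ : PromptLTL V)

namespace PromptLTL

/-- `φ.SatAt w k i`: the formula `φ` holds at position `i` of the infinite word `w` with respect
to the bound `k` on the prompt-eventually operators. -/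
def SatAt {V : Type} (w : ℕ → Finset V) (k : ℕ) : PromptLTL V → ℕ → Prop
  | atom a, i => a ∈ w i
  | natom a, i => a ∉ w i
  | and φ ψ, i => SatAt w k φ i ∧ SatAt w k ψ i
  | or φ ψ, i => SatAt w k φ i ∨ SatAt w k ψ i
  | next φ, i => SatAt w k φ (i + 1)
  | untl φ ψ, i => ∃ j, SatAt w k ψ (i + j) ∧ ∀ m < j, SatAt w k φ (i + m)
  | release φ ψ, i => ∀ j, SatAt w k ψ (i + j) ∨ ∃ m < j, SatAt w k φ (i + m)
  | prompt φ, i => ∃ j ≤ k, SatAt w k φ (i + j)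

/-- `(w, k) ⊨ φ`. -/
def Sat {V : Type} (w : ℕ → Finset V) (k : ℕ) (φ : PromptLTL V) : Prop :=
  φ.SatAt w k 0

/-- The Gödel number of a formula. -/
def code {V : Type} [Encodable V] : PromptLTL V → ℕ
  | atom a => 8 * Encodable.encode a
  | natom a => 8 * Encodable.encode a + 1
  | and φ ψ => 8 * Nat.pair φ.code ψ.code + 2
  | or φ ψ => 8 * Nat.pair φ.code ψ.code + 3
  | next φ => 8 * φ.code + 4
  | untl φ ψ => 8 * Nat.pair φ.code ψ.code + 5
  | release φ ψ => 8 * Nat.pair φ.code ψ.code + 6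
  | prompt φ => 8 * φ.code + 7

end PromptLTL

/-! ### Architectures -/

/-- An architecture with variables in `V`, whose processes are the environment `none` and the
`n` system processes `some p`. -/
structure Architecture (V : Type) [DecidableEq V] (n : ℕ) where
  inp : Option (Fin n) → Finset V
  out : Option (Fin n) → Finset V
  out_disjoint : ∀ p q, p ≠ q → Disjoint (out p) (out q)
  inp_subset : ∀ p, inp p ⊆ Finset.univ.biUnion out

namespace Architecture

variable {V : Type} [DecidableEq V] {n : ℕ}

/-- All variables that are an output of the environment or of some system process. -/
def vars (A : Architecture V n) : Finset V := Finset.univ.biUnion A.out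

/-- Inputs of the processes of the asynchronous architecture. The variable `Sum.inl v` is the
variable `v` of the given architecture, `Sum.inr p` is the scheduling variable of `p`. -/
def asyncInp (A : Architecture V n) : Option (Fin n) → Finset (V ⊕ Fin n)
  | none => (A.inp none).disjSum ∅
  | some p => (A.inp (some p)).disjSum {p}

/-- Outputs of the processes of the asynchronous architecture. -/
def asyncOut (A : Architecture V n) : Option (Fin n) → Finset (V ⊕ Fin n)
  | none => (A.out none).disjSum Finset.univ
  | some p => (A.out (some p)).disjSum ∅

theorem async_out_disjoint (A : Architecture V n) (p q : Option (Fin n)) (h : p ≠ q) :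
    Disjoint (A.asyncOut p) (A.asyncOut q) := by
  have h' := Finset.disjoint_left.1 (A.out_disjoint p q h)
  rw [Finset.disjoint_left]
  rintro (v | s) hp hq
  · refine h' (a := v) ?_ ?_
    · cases p <;> simpa [asyncOut] using hp
    · cases q <;> simpa [asyncOut] using hq
  · cases p <;> cases q <;> simp_all [asyncOut]

theorem async_inp_subset (A : Architecture V n) (p : Option (Fin n)) :
    A.asyncInp p ⊆ Finset.univ.biUnion A.asyncOut := by
  rintro (v | s) hv
  · have hv' : v ∈ A.inp p := by cases p <;> simpa [asyncInp] using hv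
    obtain ⟨q, -, hq⟩ := Finset.mem_biUnion.1 (A.inp_subset p hv')
    refine Finset.mem_biUnion.2 ⟨q, Finset.mem_univ q, ?_⟩
    cases q <;> simpa [asyncOut] using hq
  · exact Finset.mem_biUnion.2 ⟨none, Finset.mem_univ _, by simp [asyncOut]⟩

/-- The asynchronous architecture `A*`: the environment additionally outputs all scheduling
variables, and every system process additionally reads its own scheduling variable. -/
def async (A : Architecture V n) : Architecture (V ⊕ Fin n) n where
  inp := A.asyncInp
  out := A.asyncOut
  out_disjoint := A.async_out_disjoint
  inp_subset := A.async_inp_subset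

end Architecture

/-! ### Implementations -/

/-- The alphabet `2^X`. -/
abbrev Letter {V : Type} (X : Finset V) : Type := {x : Finset V // x ⊆ X}

/-- The valuation of the variables in `X` given by `x`. -/
def restrict {V : Type} [DecidableEq V] (X x : Finset V) : Letter X :=
  ⟨x ∩ X, Finset.inter_subset_right⟩

/-- A finite `Lab`-labeled `Dir`-transition system. -/
structure TransitionSystem (Dir Lab : Type) where
  State : Type
  finite : Finite State
  init : State
  step : State → Dir → State
  label : State → Lab

namespace TransitionSystem

variable {Dir Lab : Type}

/-- The state that is reached from the initial state by reading a finite word. -/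
def run (T : TransitionSystem Dir Lab) (u : List Dir) : T.State := u.foldl T.step T.init

/-- `T` generates the function `f`. -/
def Generates (T : TransitionSystem Dir Lab) (f : List Dir → Lab) : Prop :=
  ∀ u, f u = T.label (T.run u)

/-- The number of states. -/
noncomputable def size (T : TransitionSystem Dir Lab) : ℕ := Nat.card T.State

end TransitionSystem

namespace Architecture

variable {V : Type} [DecidableEq V] {n : ℕ}

/-- An implementation of the system process `p`: a function from finite input sequences to
valuations of the outputs. -/
abbrev Implementation (A : Architecture V n) (p : Fin n) : Type :=
  List (Letter (A.inp (some p))) → Letter (A.out (some p))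

/-- The (infinite) words of the composition of the implementations `f p`: at every position the
outputs of `p` are those that `f p` gives on the inputs of `p` at the strictly earlier positions,
and the outputs of the environment are arbitrary. -/
def composition (A : Architecture V n) (f : ∀ p, A.Implementation p) : Set (ℕ → Finset V) :=
  {w | ∀ i, w i ⊆ A.vars ∧
    ∀ p, restrict (A.out (some p)) (w i) =
      f p ((List.range i).map fun j => restrict (A.inp (some p)) (w j))}

/-- The composition of the `f p` satisfies the assume-guarantee specification `⟨φ, ψ⟩`. -/
def Satisfies (A : Architecture V n) (f : ∀ p, A.Implementation p) (φ ψ : PromptLTL V) : Prop :=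
  ∀ k : ℕ, ∃ l : ℕ, ∀ w ∈ A.composition f, φ.Sat w k → ψ.Sat w l

/-- A transition system for the process `p` of `A*` does not change its state in a step in which
`p` is not scheduled. -/
def RespectsScheduling (A : Architecture V n) (p : Fin n)
    (T : TransitionSystem (Letter (A.async.inp (some p))) (Letter (A.async.out (some p)))) :
    Prop :=
  ∀ (u : List (Letter (A.async.inp (some p)))) (x : Letter (A.async.inp (some p))),
    Sum.inr p ∉ x.1 → T.run (u ++ [x]) = T.run u

/-- `f` is a finite-state implementation of size `b` for the process `p` of the asynchronous
architecture `A*`. -/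
def IsAsyncImplementationOfSize (A : Architecture V n) (p : Fin n)
    (f : A.async.Implementation p) (b : ℕ) : Prop :=
  ∃ T : TransitionSystem (Letter (A.async.inp (some p))) (Letter (A.async.out (some p))),
    T.size = b ∧ A.RespectsScheduling p T ∧ T.Generates f

end Architecture

/-! ### Instances of the bounded synthesis problem -/

/-- An architecture `A` (with natural numbers as names of its variables), an assume-guarantee
specification for `A*`, and a family of size bounds. -/
structure Instance where
  n : ℕ
  arch : Architecture ℕ n
  assumption : PromptLTL (ℕ ⊕ Fin n)
  guarantee : PromptLTL (ℕ ⊕ Fin n)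
  bound : Fin n → ℕ

namespace Instance

/-- There are finite-state implementations of the prescribed sizes whose composition satisfies
the specification in the asynchronous architecture. -/
def Realizable (J : Instance) : Prop :=
  ∃ f : ∀ p, J.arch.async.Implementation p,
    (∀ p, J.arch.IsAsyncImplementationOfSize p (f p) (J.bound p)) ∧
    J.arch.async.Satisfies f J.assumption J.guarantee

/-- The finite data that is handed to an algorithm: the Gödel numbers of the two formulas, the
inputs and outputs of the environment, and the list of the bounds, inputs and outputs of the
system processes; finite sets are given by their increasing enumerations. -/
def data (J : Instance) :
    (ℕ × ℕ) × (List ℕ × List ℕ) × List (ℕ × List ℕ × List ℕ) :=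
  ((J.assumption.code, J.guarantee.code),
    ((J.arch.inp none).sort, (J.arch.out none).sort),
    List.ofFn fun p =>
      (J.bound p, (J.arch.inp (some p)).sort, (J.arch.out (some p)).sort))

end Instance

/-! ### Constraint systems -/

open FirstOrder FirstOrder.Language

/-- The first-order language with countably many uninterpreted function symbols of every arity
(the constants are those of arity `0`) and one binary relation symbol `≤`. -/
def lang : Language where
  Functions := fun _ => ℕ
  Relations := Language.order.Relations

instance : lang.IsOrdered := ⟨(leSymb : Language.order.Relations 2)⟩

/-- The Gödel number of a term whose variables are numbered. -/
def termCode {m : ℕ} : lang.Term (Empty ⊕ Fin m) → ℕ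
  | .var (.inr i) => 2 * i.val
  | .func (l := l) g ts =>
      2 * Nat.pair l (Nat.pair (show ℕ from g) (Encodable.encode
        (List.ofFn fun i => termCode (ts i)))) + 1

/-- The Gödel number of a formula. The only relation symbol is `≤`. -/
def formulaCode : {m : ℕ} → lang.BoundedFormula Empty m → ℕ
  | _, .falsum => 0
  | _, .equal t u => 4 * Nat.pair (termCode t) (termCode u) + 1
  | _, .rel _ ts => 4 * Encodable.encode (List.ofFn fun i => termCode (ts i)) + 2
  | _, .imp θ χ => 4 * Nat.pair (formulaCode θ) (formulaCode χ) + 3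
  | _, .all θ => 4 * formulaCode θ + 4

/-- A constraint system: a quantifier-free sentence (a Boolean combination of equations and
inequalities between ground terms). -/
def ConstraintSystem : Type := {σ : lang.Sentence // σ.IsQF}

namespace ConstraintSystem

def code (C : ConstraintSystem) : ℕ := formulaCode C.1

/-- Satisfiability modulo the theory in which the function symbols are uninterpreted and `≤` is a
total order. -/
def Satisfiable (C : ConstraintSystem) : Prop :=
  (lang.linearOrderTheory ∪ {C.1} : lang.Theory).IsSatisfiable

end ConstraintSystem

end PromptSynthesis

/-! Decidability. A quantifier-free sentence compares finitely many ground terms, so only the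
relative order of their values matters. For a sentence with code `c`, `satCode` searches for ranks
below `c + 1` and truth values for all numbers up to `c`, read as codes of terms and of formulas,
and checks congruence of the ranks and the recursion for truth. In a model, the number of smaller
values is such a rank (`satCode_of_satisfiable`). Conversely, congruence lets the ranks define the
function symbols on `ℕ` (`satisfiable_of_satCode`). The search is primitive recursive.

Construction. Since the sizes are fixed, implementations amount to a finite table `T` of initial
states, transitions and labels (`Instance.realizable_iff`). A violation by `T` is a `k` such that
for every `l` some word satisfies the assumption with bound `k` but not the guarantee with bound
`l`. Numerical bounds are replaced by marks on positions: `F_P φ` then asks for `φ` before the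
second mark. Marks with bounded gaps turn this into a prompt bound, and widely spaced marks make it
weaker than a given prompt bound (`PromptLTL.satAt_of_satMarked`, `PromptLTL.satMarked_of_satAt`).
The assumption and the guarantee get separate marks. For fixed marks, truth is characterised by a
locally checked tableau with fairness conditions (`codeSat_of_tableau`), so counterexamples become
paths in a finite product graph.

The remaining requirement is that guarantee marks can be pushed arbitrarily far apart while the gaps
of assumption marks stay bounded. By the pigeonhole principle, a counterexample with sufficiently
sparse guarantee marks repeats a vertex with an assumption mark between any two consecutive
guarantee marks (`exists_pump_path`). Conversely, repeating such a cycle separates the guarantee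
marks at will without widening the assumption gaps beyond a fixed bound (`exists_count_path`).
Guessing these cycles inside the graph makes "`T` violates the specification" equivalent to the
existence of one fair path (`Instance.not_tableSatisfies_of_hasFairPath`,
`Instance.hasFairPath_of_not_tableSatisfies`).

Absence of fair paths has a certificate that a quantifier-free sentence can express: a set of
vertices closed under reachability, a rank that never increases along edges, and for each reachable
vertex a fairness condition that is missed for as long as the rank stays constant. Such a
certificate refutes fairness (`not_fair_of_ranking`). If no fair path exists, the number of
reachable vertices is a suitable rank, and every reachable strongly connected component misses some
condition (`missed_step`, `exists_fair_path`). The constraint system asserts the existence of `T`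
together with this certificate (`Data.satisfiable_sequents_iff`); its clauses are listed by a
primitive recursive function of the input data. -/

namespace PromptSynthesis

/-! ### Closure properties of primitive recursive functions -/

attribute [fun_prop] Primrec

namespace PR

variable {α β γ σ : Type} [Primcodable α] [Primcodable β] [Primcodable γ] [Primcodable σ]

-- With these closure rules `fun_prop` proves primitive recursiveness from the shape of a
-- definition. This is why the algorithms below are written with `bif`, `decide` and list
-- operations.
@[fun_prop] theorem id_fun : Primrec (fun a : α => a) := Primrec.id

@[fun_prop] theorem const_fun (b : β) : Primrec (fun _ : α => b) := Primrec.const b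

@[fun_prop] theorem comp_fun {f : β → γ} {g : α → β} (hf : Primrec f) (hg : Primrec g) :
    Primrec (fun a => f (g a)) := hf.comp hg

@[fun_prop] theorem fst {f : α → β × γ} (hf : Primrec f) : Primrec (fun a => (f a).1) :=
  Primrec.fst.comp hf

@[fun_prop] theorem snd {f : α → β × γ} (hf : Primrec f) : Primrec (fun a => (f a).2) :=
  Primrec.snd.comp hf

@[fun_prop] theorem prodMk {f : α → β} {g : α → γ} (hf : Primrec f) (hg : Primrec g) :
    Primrec (fun a => (f a, g a)) := hf.pair hg

@[fun_prop] theorem add {f g : α → ℕ} (hf : Primrec f) (hg : Primrec g) :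
    Primrec (fun a => f a + g a) := Primrec.nat_add.comp hf hg

@[fun_prop] theorem mul {f g : α → ℕ} (hf : Primrec f) (hg : Primrec g) :
    Primrec (fun a => f a * g a) := Primrec.nat_mul.comp hf hg

@[fun_prop] theorem div {f g : α → ℕ} (hf : Primrec f) (hg : Primrec g) :
    Primrec (fun a => f a / g a) := Primrec.nat_div.comp hf hg

@[fun_prop] theorem mod {f g : α → ℕ} (hf : Primrec f) (hg : Primrec g) :
    Primrec (fun a => f a % g a) := Primrec.nat_mod.comp hf hg

@[fun_prop] theorem natPair {f g : α → ℕ} (hf : Primrec f) (hg : Primrec g) :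
    Primrec (fun a => Nat.pair (f a) (g a)) := Primrec₂.natPair.comp hf hg

@[fun_prop] theorem natUnpair {f : α → ℕ} (hf : Primrec f) :
    Primrec (fun a => Nat.unpair (f a)) := Primrec.unpair.comp hf

@[fun_prop] theorem and {f g : α → Bool} (hf : Primrec f) (hg : Primrec g) :
    Primrec (fun a => f a && g a) := Primrec.and.comp hf hg

@[fun_prop] theorem or {f g : α → Bool} (hf : Primrec f) (hg : Primrec g) :
    Primrec (fun a => f a || g a) := Primrec.or.comp hf hg

@[fun_prop] theorem not {f : α → Bool} (hf : Primrec f) :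
    Primrec (fun a => !f a) := Primrec.not.comp hf

@[fun_prop] theorem decide_eq [DecidableEq β] {f g : α → β} (hf : Primrec f) (hg : Primrec g) :
    Primrec (fun a => decide (f a = g a)) := Primrec.eq.decide.comp hf hg

@[fun_prop] theorem decide_le {f g : α → ℕ} (hf : Primrec f) (hg : Primrec g) :
    Primrec (fun a => decide (f a ≤ g a)) := Primrec.nat_le.decide.comp hf hg

@[fun_prop] theorem bcond {c : α → Bool} {f g : α → β} (hc : Primrec c) (hf : Primrec f)
    (hg : Primrec g) : Primrec (fun a => bif c a then f a else g a) := Primrec.cond hc hf hg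

@[fun_prop] theorem encode {f : α → β} (hf : Primrec f) :
    Primrec (fun a => Encodable.encode (f a)) := Primrec.encode.comp hf

@[fun_prop] theorem cons {f : α → β} {g : α → List β} (hf : Primrec f) (hg : Primrec g) :
    Primrec (fun a => f a :: g a) := Primrec.list_cons.comp hf hg

@[fun_prop] theorem append {f g : α → List β} (hf : Primrec f) (hg : Primrec g) :
    Primrec (fun a => f a ++ g a) := Primrec.list_append.comp hf hg

@[fun_prop] theorem length {f : α → List β} (hf : Primrec f) :
    Primrec (fun a => (f a).length) := Primrec.list_length.comp hf

@[fun_prop] theorem range {f : α → ℕ} (hf : Primrec f) :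
    Primrec (fun a => List.range (f a)) := Primrec.list_range.comp hf

@[fun_prop] theorem getD (d : β) {f : α → List β} {g : α → ℕ} (hf : Primrec f) (hg : Primrec g) :
    Primrec (fun a => (f a).getD (g a) d) := (Primrec.list_getD d).comp hf hg

@[fun_prop] theorem map {f : α → List β} {g : α → β → γ} (hf : Primrec f)
    (hg : Primrec (fun p : α × β => g p.1 p.2)) : Primrec (fun a => (f a).map (g a)) :=
  Primrec.list_map hf hg

@[fun_prop] theorem flatMap {f : α → List β} {g : α → β → List γ} (hf : Primrec f)
    (hg : Primrec (fun p : α × β => g p.1 p.2)) : Primrec (fun a => (f a).flatMap (g a)) :=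
  Primrec.list_flatMap hf hg

@[fun_prop] theorem foldr {f : α → List β} {g : α → γ} {h : α → β → γ → γ} (hf : Primrec f)
    (hg : Primrec g) (hh : Primrec (fun p : α × (β × γ) => h p.1 p.2.1 p.2.2)) :
    Primrec (fun a => (f a).foldr (h a) (g a)) :=
  Primrec.list_foldr (h := fun a p => h a p.1 p.2) hf hg hh

@[fun_prop] theorem all {f : α → List β} {g : α → β → Bool} (hf : Primrec f)
    (hg : Primrec (fun p : α × β => g p.1 p.2)) : Primrec (fun a => (f a).all (g a)) := by
  have : Primrec (fun a => (f a).foldr (fun b r => g a b && r) true) := by fun_prop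
  refine this.of_eq fun a => ?_
  induction f a with
  | nil => rfl
  | cons b l ih => simp only [List.foldr_cons, List.all_cons, ih]

@[fun_prop] theorem any {f : α → List β} {g : α → β → Bool} (hf : Primrec f)
    (hg : Primrec (fun p : α × β => g p.1 p.2)) : Primrec (fun a => (f a).any (g a)) := by
  have : Primrec (fun a => (f a).foldr (fun b r => g a b || r) false) := by fun_prop
  refine this.of_eq fun a => ?_
  induction f a with
  | nil => rfl
  | cons b l ih => simp only [List.foldr_cons, List.any_cons, ih]

@[fun_prop] theorem filter {f : α → List β} {g : α → β → Bool} (hf : Primrec f)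
    (hg : Primrec (fun p : α × β => g p.1 p.2)) : Primrec (fun a => (f a).filter (g a)) := by
  have : Primrec (fun a => (f a).foldr (fun b r => bif g a b then b :: r else r) []) := by fun_prop
  refine this.of_eq fun a => ?_
  induction f a with
  | nil => rfl
  | cons b l ih => simp only [List.foldr_cons, List.filter_cons, ih]; cases g a b <;> rfl

end PR

/-- The list of natural numbers with code `y`. -/
def decodeList (y : ℕ) : List ℕ := (Encodable.decode (α := List ℕ) y).getD []

@[simp] theorem decodeList_encode (l : List ℕ) : decodeList (Encodable.encode l) = l := by
  simp [decodeList]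

/-- The strict bound makes recursion through decoded argument lists terminate, and keeps the
arguments of a term inside the tables that contain the term. -/
theorem lt_encode_of_mem {l : List ℕ} {a : ℕ} (h : a ∈ l) : a < Encodable.encode l := by
  induction l with
  | nil => simp at h
  | cons b l ih =>
    rw [Encodable.encode_list_cons, Nat.lt_succ_iff]
    rcases List.mem_cons.1 h with rfl | h
    · exact Nat.left_le_pair _ _
    · exact (ih h).le.trans (Nat.right_le_pair _ _)

theorem lt_of_mem_decodeList {y a : ℕ} (h : a ∈ decodeList y) : a < y := by
  have : Encodable.encode (decodeList y) = y := by
    have h2 := Denumerable.decode_eq_ofNat (List ℕ) y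
    unfold decodeList
    rw [h2]
    exact Denumerable.encode_ofNat y
  exact (lt_encode_of_mem h).trans_eq this

@[fun_prop] theorem PR.decodeList {α : Type} [Primcodable α] {f : α → ℕ} (hf : Primrec f) :
    Primrec (fun a => decodeList (f a)) :=
  Primrec.option_getD.comp (Primrec.decode.comp hf) (Primrec.const [])

/-- All lists of length `n` with entries in `l`. -/
def tuples {α : Type} (l : List α) : ℕ → List (List α)
  | 0 => [[]]
  | n + 1 => (tuples l n).flatMap fun t => l.map fun a => a :: t

theorem mem_tuples {α : Type} {l : List α} {n : ℕ} {t : List α} :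
    t ∈ tuples l n ↔ t.length = n ∧ ∀ a ∈ t, a ∈ l := by
  induction n generalizing t with
  | zero =>
    simp only [tuples, List.mem_singleton, List.length_eq_zero_iff]
    constructor
    · rintro rfl; simp
    · exact fun h => h.1
  | succ n ih =>
    simp only [tuples, List.mem_flatMap, List.mem_map, ih]
    constructor
    · rintro ⟨t, ⟨rfl, ht⟩, a, ha, rfl⟩
      simp only [List.length_cons, List.mem_cons, forall_eq_or_imp]
      exact ⟨trivial, ha, ht⟩
    · rintro ⟨h, ha⟩
      cases t with
      | nil => simp at h
      | cons a t =>
        simp only [List.mem_cons, forall_eq_or_imp] at ha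
        exact ⟨t, ⟨by simpa using h, ha.2⟩, a, ha.1, rfl⟩

@[fun_prop] theorem PR.tuples {α β : Type} [Primcodable α] [Primcodable β] {f : α → List β}
    {g : α → ℕ} (hf : Primrec f) (hg : Primrec g) : Primrec (fun a => tuples (f a) (g a)) := by
  have h : Primrec₂ (fun (a : α) (p : ℕ × List (List β)) =>
      p.2.flatMap fun t => (f a).map fun b => b :: t) := by
    unfold Primrec₂
    fun_prop
  refine (Primrec.nat_rec' hg (Primrec.const [[]]) h).of_eq fun a => ?_
  induction g a with
  | zero => rfl
  | succ n ih => simp only [PromptSynthesis.tuples, ← ih]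

end PromptSynthesis

namespace PromptSynthesis
open FirstOrder FirstOrder.Language

/-! ### Satisfiability of constraint systems -/

/-- The structure with the given interpretation of the function symbols in which `≤` is the given
order. -/
@[reducible]
def structureOf (M : Type) [LE M] (F : ∀ l : ℕ, ℕ → (Fin l → M) → M) : lang.Structure M where
  funMap {l} g v := F l g v
  RelMap {_} r := match r with
    | orderRel.le => fun v => v 0 ≤ v 1

theorem ConstraintSystem.satisfiable_iff (C : ConstraintSystem) :
    C.Satisfiable ↔ ∃ (M : Type) (_ : lang.Structure M) (_ : LinearOrder M),
      lang.OrderedStructure M ∧ Sentence.Realize M C.1 := by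
  constructor
  · rintro ⟨M⟩
    have h1 : M ⊨ lang.linearOrderTheory := Theory.Model.mono M.is_model Set.subset_union_left
    have h2 : Sentence.Realize M C.1 := Theory.realize_sentence_of_mem
      (T := (lang.linearOrderTheory ∪ {C.1} : lang.Theory)) (Or.inr rfl)
    classical
    exact ⟨M, M.struc, lang.linearOrderOfModels M, inferInstance, h2⟩
  · rintro ⟨M, S, O, hO, h⟩
    -- The language has constants, so every structure is nonempty.
    have : Nonempty M := ⟨Structure.funMap (L := lang) (n := 0) (show ℕ from 0) Fin.elim0⟩
    have hM : M ⊨ (lang.linearOrderTheory ∪ {C.1} : lang.Theory) := by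
      rw [Theory.model_union_iff, Theory.model_singleton_iff]
      exact ⟨inferInstance, h⟩
    exact Theory.Model.isSatisfiable M

/-- The value of the term with code `e` if `F l g` interprets the function symbol `g` of
arity `l`. -/
def evalCode {M : Type} (F : ℕ → ℕ → List M → M) (e : ℕ) : M :=
  if e % 2 = 1 then
    F (e / 2).unpair.1 (e / 2).unpair.2.unpair.1
      ((decodeList (e / 2).unpair.2.unpair.2).attach.map fun a => evalCode F a.1)
  else F 0 0 []
termination_by e
decreasing_by
  have := lt_of_mem_decodeList a.2
  have h3 := Nat.unpair_right_le (e / 2)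
  have h4 := Nat.unpair_right_le (e / 2).unpair.2
  omega

/-- The truth value of the formula with code `f` if `r` gives the ranks of the terms. -/
def truthCode (r : ℕ → ℕ) (f : ℕ) : Bool :=
  if f % 4 = 1 then decide (r (f / 4).unpair.1 = r (f / 4).unpair.2)
  else if f % 4 = 2 then
    decide (r ((decodeList (f / 4)).getD 0 0) ≤ r ((decodeList (f / 4)).getD 1 0))
  else if f % 4 = 3 then !truthCode r (f / 4).unpair.1 || truthCode r (f / 4).unpair.2
  else false
termination_by f
decreasing_by
  · have := Nat.unpair_left_le (f / 4)
    omega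
  · have := Nat.unpair_right_le (f / 4)
    omega

/-- The head symbol, the arity and the ranks of the arguments of the term with code `e`. -/
def termKey (r : List ℕ) (e : ℕ) : ℕ × ℕ × List ℕ :=
  ((e / 2).unpair.1, (e / 2).unpair.2.unpair.1,
    (decodeList (e / 2).unpair.2.unpair.2).map fun a => r.getD a 0)

/-- The truth value of the formula with code `f`, computed from the truth values of its immediate
subformulas. -/
def truthStep (r : List ℕ) (tv : List Bool) (f : ℕ) : Bool :=
  bif decide (f % 4 = 1) then decide (r.getD (f / 4).unpair.1 0 = r.getD (f / 4).unpair.2 0)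
  else bif decide (f % 4 = 2) then
    decide (r.getD ((decodeList (f / 4)).getD 0 0) 0 ≤ r.getD ((decodeList (f / 4)).getD 1 0) 0)
  else bif decide (f % 4 = 3) then
    !tv.getD (f / 4).unpair.1 false || tv.getD (f / 4).unpair.2 false
  else false

/-- `r` and `tv` are consistent tables of ranks and truth values for all codes up to `c`, and the
formula with code `c` is true. -/
def checkTables (c : ℕ) (r : List ℕ) (tv : List Bool) : Bool :=
  ((List.range (c + 1)).all fun e => (List.range (c + 1)).all fun e' =>
    !decide (e % 2 = 1) || !decide (e' % 2 = 1) || !decide (termKey r e = termKey r e') ||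
      decide (r.getD e 0 = r.getD e' 0)) &&
  ((List.range (c + 1)).all fun f => decide (tv.getD f false = truthStep r tv f)) &&
  tv.getD c false

/-- Some consistent tables make the formula with code `c` true. -/
def satCode (c : ℕ) : Bool :=
  (tuples (List.range (c + 1)) (c + 1)).any fun r =>
    (tuples [false, true] (c + 1)).any fun tv => checkTables c r tv

@[fun_prop] theorem PR.termKey {α : Type} [Primcodable α] {r : α → List ℕ} {e : α → ℕ}
    (hr : Primrec r) (he : Primrec e) : Primrec fun a => termKey (r a) (e a) := by
  unfold PromptSynthesis.termKey
  fun_prop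

@[fun_prop] theorem PR.truthStep {α : Type} [Primcodable α] {r : α → List ℕ} {tv : α → List Bool}
    {f : α → ℕ} (hr : Primrec r) (htv : Primrec tv) (hf : Primrec f) :
    Primrec fun a => truthStep (r a) (tv a) (f a) := by
  unfold PromptSynthesis.truthStep
  fun_prop

@[fun_prop] theorem PR.checkTables {α : Type} [Primcodable α] {c : α → ℕ} {r : α → List ℕ}
    {tv : α → List Bool} (hc : Primrec c) (hr : Primrec r) (htv : Primrec tv) :
    Primrec fun a => checkTables (c a) (r a) (tv a) := by
  unfold PromptSynthesis.checkTables
  fun_prop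

theorem primrec_satCode : Primrec satCode := by
  unfold satCode
  fun_prop

theorem termCode_func {m l : ℕ} (g : lang.Functions l) (ts : Fin l → lang.Term (Empty ⊕ Fin m)) :
    termCode (.func g ts) = 2 * Nat.pair l (Nat.pair (show ℕ from g) (Encodable.encode
        (List.ofFn fun i => termCode (ts i)))) + 1 := by
  rw [termCode]

theorem termCode_func_unpair {m l : ℕ} (g : lang.Functions l)
    (ts : Fin l → lang.Term (Empty ⊕ Fin m)) :
    termCode (.func g ts) % 2 = 1 ∧ (termCode (.func g ts) / 2).unpair.1 = l ∧
    (termCode (.func g ts) / 2).unpair.2.unpair.1 = g ∧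
    decodeList (termCode (.func g ts) / 2).unpair.2.unpair.2 =
      List.ofFn fun i => termCode (ts i) := by
  have e : termCode (.func g ts) / 2 = Nat.pair l (Nat.pair (show ℕ from g) (Encodable.encode
        (List.ofFn fun i => termCode (ts i)))) := by
    rw [termCode_func]; omega
  refine ⟨by rw [termCode_func]; omega, ?_⟩
  rw [e, Nat.unpair_pair]
  refine ⟨rfl, ?_⟩
  change (Nat.unpair (Nat.pair (show ℕ from g) (Encodable.encode
        (List.ofFn fun i => termCode (ts i))))).1 = (show ℕ from g) ∧ decodeList
        (Nat.unpair (Nat.pair (show ℕ from g) (Encodable.encode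
        (List.ofFn fun i => termCode (ts i))))).2 = _
  rw [Nat.unpair_pair]
  exact ⟨rfl, decodeList_encode _⟩

theorem termCode_lt_func {m l : ℕ} (g : lang.Functions l) (ts : Fin l → lang.Term (Empty ⊕ Fin m))
    (i : Fin l) : termCode (ts i) < termCode (.func g ts) := by
  rw [termCode_func]
  have h1 : termCode (ts i) < Encodable.encode (List.ofFn fun i => termCode (ts i)) :=
    lt_encode_of_mem (by simp)
  have h2 := Nat.right_le_pair (show ℕ from g) (Encodable.encode
        (List.ofFn fun i => termCode (ts i)))
  have h3 := Nat.right_le_pair l (Nat.pair (show ℕ from g) (Encodable.encode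
        (List.ofFn fun i => termCode (ts i))))
  omega

/-- Agreement of ranks and values is needed only for the order, since equality follows by
antisymmetry. This form serves both directions: an arbitrary model with counted ranks, and the model
on `ℕ` built from the ranks. -/
theorem truth_iff_realize {M : Type} [lang.Structure M] [LinearOrder M] [lang.OrderedStructure M]
    {N : ℕ} {r : List ℕ} {tv : List Bool}
    (htv : ∀ f < N, tv.getD f false = truthStep r tv f)
    (hr : ∀ t u : lang.Term (Empty ⊕ Fin 0), termCode t < N → termCode u < N → ∀ v,
      (r.getD (termCode t) 0 ≤ r.getD (termCode u) 0 ↔ t.realize (M := M) v ≤ u.realize v))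
    {θ : lang.BoundedFormula Empty 0} (hθ : θ.IsQF) (hN : formulaCode θ < N)
    (v : Empty → M) (w : Fin 0 → M) :
    tv.getD (formulaCode θ) false = true ↔ θ.Realize v w := by
  induction hθ with
  | falsum =>
    rw [htv _ hN]
    simp [formulaCode, truthStep, BoundedFormula.Realize]
  | of_isAtomic h =>
    rw [htv _ hN]
    cases h with
    | equal t u =>
      have e : formulaCode (t.bdEqual u) = 4 * Nat.pair (termCode t) (termCode u) + 1 := rfl
      rw [e] at hN ⊢
      have h1 : (4 * Nat.pair (termCode t) (termCode u) + 1) % 4 = 1 := by omega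
      have h2 : (4 * Nat.pair (termCode t) (termCode u) + 1) / 4 =
        Nat.pair (termCode t) (termCode u) := by omega
      have h3 := Nat.left_le_pair (termCode t) (termCode u)
      have h4 := Nat.right_le_pair (termCode t) (termCode u)
      have h5 := hr t u (by omega) (by omega) (Sum.elim v w)
      have h6 := hr u t (by omega) (by omega) (Sum.elim v w)
      simp only [truthStep, h1, h2, decide_true, cond_true, Nat.unpair_pair, decide_eq_true_eq,
        BoundedFormula.realize_bdEqual]
      constructor
      · exact fun h => le_antisymm (h5.1 h.le) (h6.1 h.ge)
      · exact fun h => le_antisymm (h5.2 h.le) (h6.2 h.ge)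
    | rel R ts =>
      rename_i l
      obtain rfl : l = 2 := by cases R; rfl
      have e : formulaCode (R.boundedFormula ts) =
        4 * Encodable.encode (List.ofFn fun i => termCode (ts i)) + 2 := rfl
      rw [e] at hN ⊢
      generalize hy : Encodable.encode (List.ofFn fun i => termCode (ts i)) = y at *
      have h1 : (4 * y + 2) % 4 = 2 := by omega
      have h2 : (4 * y + 2) / 4 = y := by omega
      have h3 : decodeList y = [termCode (ts 0), termCode (ts 1)] := by
        rw [← hy, decodeList_encode]; simp [List.ofFn_succ]
      have h4 : termCode (ts 0) < y := lt_of_mem_decodeList (by simp [h3])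
      have h5 : termCode (ts 1) < y := lt_of_mem_decodeList (by simp [h3])
      have h6 := hr (ts 0) (ts 1) (by omega) (by omega) (Sum.elim v w)
      have h7 : R = leSymb := Subsingleton.elim (α := Language.order.Relations 2) _ _
      subst h7
      have h8 : (leSymb.boundedFormula ts : lang.BoundedFormula Empty 0) = (ts 0).le (ts 1) := by
        unfold Term.le Relations.boundedFormula₂
        congr 1
        funext i
        fin_cases i <;> rfl
      rw [h8, Term.realize_le]
      rw [← h6]
      simp [truthStep, h1, h2, h3]
  | @imp θ χ _ _ ih1 ih2 =>
    rw [htv _ hN]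
    have e : formulaCode (θ.imp χ) = 4 * Nat.pair (formulaCode θ) (formulaCode χ) + 3 := rfl
    rw [e] at hN ⊢
    have h1 : (4 * Nat.pair (formulaCode θ) (formulaCode χ) + 3) % 4 = 3 := by omega
    have h2 : (4 * Nat.pair (formulaCode θ) (formulaCode χ) + 3) / 4 =
      Nat.pair (formulaCode θ) (formulaCode χ) := by omega
    have h3 := Nat.left_le_pair (formulaCode θ) (formulaCode χ)
    have h4 := Nat.right_le_pair (formulaCode θ) (formulaCode χ)
    have ih1 := ih1 (by omega)
    have ih2 := ih2 (by omega)
    rw [BoundedFormula.realize_imp, ← ih1, ← ih2]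
    simp only [truthStep, h1, h2, Nat.unpair_pair]
    cases tv.getD (formulaCode θ) false <;> cases tv.getD (formulaCode χ) false <;> simp

theorem getD_map_range {α : Type} {N : ℕ} {f : ℕ → α} {d : α} {a : ℕ} (h : a < N) :
    ((List.range N).map f).getD a d = f a := by
  simp [List.getD_eq_getElem?_getD, h]

theorem satCode_of_satisfiable {C : ConstraintSystem} (h : C.Satisfiable) :
    satCode C.code = true := by
  classical
  obtain ⟨M, S, O, hO, h⟩ := C.satisfiable_iff.1 h
  have : Nonempty M := ⟨Structure.funMap (L := lang) (n := 0) (show ℕ from 0) Fin.elim0⟩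
  set N := C.code + 1 with hN
  let F : ℕ → ℕ → List M → M := fun l g L =>
    if h : L.length = l then Structure.funMap (L := lang) (n := l) (show ℕ from g)
      (fun i => L.get (i.cast h.symm)) else Classical.arbitrary M
  -- Every number below `N` is evaluated as if it were a term code. Counting smaller values gives an
  -- order-preserving rank below `N`.
  let ρ : ℕ → ℕ := fun e => ((Finset.range N).filter fun e' => evalCode F e' < evalCode F e).card
  let r := (List.range N).map ρ
  let tv := (List.range N).map (truthCode ρ)
  have hρ : ∀ {a b}, b < N → (ρ a ≤ ρ b ↔ evalCode F a ≤ evalCode F b) := by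
    intro a b hb
    constructor
    · intro h
      by_contra! hab
      -- If the value of `b` lies below that of `a`, then `b` is counted for `a` but not for itself;
      -- this is where `b < N` is used.
      refine absurd h (not_le.2 (Finset.card_lt_card ?_))
      refine Finset.ssubset_iff_of_subset (fun x hx => ?_) |>.2 ⟨b, ?_, ?_⟩
      · simp only [Finset.mem_filter] at hx ⊢
        exact ⟨hx.1, hx.2.trans hab⟩
      · simpa using ⟨hb, hab⟩
      · simp
    · intro h
      refine Finset.card_le_card fun x hx => ?_
      simp only [Finset.mem_filter] at hx ⊢
      exact ⟨hx.1, hx.2.trans_le h⟩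
  have hr : ∀ {a}, a < N → r.getD a 0 = ρ a := fun h => getD_map_range h
  have htv' : ∀ {a}, a < N → tv.getD a false = truthCode ρ a := fun h => getD_map_range h
  have heval : ∀ (t : lang.Term (Empty ⊕ Fin 0)) v, t.realize v = evalCode F (termCode t) := by
    intro t v
    induction t with
    | var x => rcases x with x | x; exacts [x.elim, x.elim0]
    | @func l g ts ih =>
      obtain ⟨h1, h2, h3, h4⟩ := termCode_func_unpair g ts
      rw [evalCode, if_pos h1, Term.realize_func, h2, h3, List.attach_map_val (f := evalCode F), h4,
        List.map_ofFn]
      refine Eq.symm ((dif_pos (by simp)).trans ?_)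
      congr 1
      funext i
      simp [ih]
  have htv : ∀ f < N, tv.getD f false = truthStep r tv f := by
    intro f hf
    have h1 := Nat.unpair_left_le (f / 4)
    have h2 := Nat.unpair_right_le (f / 4)
    have h3 : f / 4 ≤ f := Nat.div_le_self _ _
    have h4 : ∀ i, (decodeList (f / 4)).getD i 0 < N := by
      intro i
      rcases lt_or_ge i (decodeList (f / 4)).length with hi | hi
      · rw [List.getD_eq_getElem _ _ hi]
        have := lt_of_mem_decodeList (List.getElem_mem hi)
        omega
      -- The number need not code a formula, so the decoded list may be too short; the default `0`
      -- is still a legal index.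
      · rw [List.getD_eq_default _ _ hi]
        omega
    rw [htv' hf, truthCode, truthStep, hr (h4 0), hr (h4 1),
      hr (a := (f / 4).unpair.1) (by omega), hr (a := (f / 4).unpair.2) (by omega),
      htv' (a := (f / 4).unpair.1) (by omega), htv' (a := (f / 4).unpair.2) (by omega)]
    simp only [Bool.cond_decide]
  refine List.any_eq_true.2 ⟨r, ?_, List.any_eq_true.2 ⟨tv, ?_, ?_⟩⟩
  · refine mem_tuples.2 ⟨by simp [r, N], ?_⟩
    simp only [r, List.mem_map, List.mem_range, forall_exists_index, and_imp]
    rintro _ e he rfl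
    refine (Finset.card_lt_card (Finset.ssubset_iff_of_subset (Finset.filter_subset _ _) |>.2
      ⟨e, Finset.mem_range.2 he, by simp⟩)).trans_eq (Finset.card_range N)
  · refine mem_tuples.2 ⟨by simp [tv, N], fun b _ => ?_⟩
    cases b <;> simp
  · simp only [checkTables, Bool.and_eq_true, List.all_eq_true, List.mem_range, ← hN,
      decide_eq_true_eq]
    refine ⟨⟨fun e he e' he' => ?_, htv⟩, ?_⟩
    · by_cases h1 : e % 2 = 1
      on_goal 2 => simp [h1]
      by_cases h2 : e' % 2 = 1
      on_goal 2 => simp [h2]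
      by_cases h3 : termKey r e = termKey r e'
      on_goal 2 => simp [h3]
      simp only [h1, h2, h3, decide_true, Bool.not_true, Bool.false_or, decide_eq_true_eq]
      rw [hr he, hr he']
      suffices h : evalCode F e = evalCode F e' from
        le_antisymm ((hρ he').2 h.le) ((hρ he).2 h.ge)
      rw [evalCode, if_pos h1, evalCode, if_pos h2, List.attach_map_val (f := evalCode F),
        List.attach_map_val (f := evalCode F)]
      simp only [termKey, Prod.mk.injEq] at h3
      rw [h3.1, h3.2.1]
      congr 1
      have hlt : ∀ {x}, x < N → ∀ a ∈ decodeList (x / 2).unpair.2.unpair.2, a < N := by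
        intro x hx a ha
        have h4 := Nat.unpair_right_le (x / 2)
        have h5 := Nat.unpair_right_le (x / 2).unpair.2
        have := lt_of_mem_decodeList ha
        omega
      refine List.ext_getElem ?_ fun i hi hi' => ?_
      · simpa using congrArg List.length h3.2.2
      · simp only [List.length_map] at hi hi'
        have h4 := hlt he _ (List.getElem_mem hi)
        have h5 := hlt he' _ (List.getElem_mem hi')
        have h6 := List.getElem_of_eq h3.2.2 (i := i) (by simpa using hi)
        rw [List.getElem_map, List.getElem_map, hr h4, hr h5] at h6
        simp only [List.getElem_map]
        exact le_antisymm ((hρ h5).1 h6.le) ((hρ h4).1 h6.ge)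
    · refine (truth_iff_realize (M := M) htv ?_ C.2 (Nat.lt_succ_self _) default default).2 h
      intro t u ht hu v
      rw [hr ht, hr hu, hρ hu, heval, heval]

theorem satisfiable_of_satCode {C : ConstraintSystem} (h : satCode C.code = true) :
    C.Satisfiable := by
  classical
  obtain ⟨r, -, h⟩ := List.any_eq_true.1 h
  obtain ⟨tv, -, h⟩ := List.any_eq_true.1 h
  simp only [checkTables, Bool.and_eq_true, List.all_eq_true, List.mem_range,
    decide_eq_true_eq] at h
  obtain ⟨⟨hr, htv⟩, hC⟩ := h
  let P : ℕ × ℕ × List ℕ → ℕ → Prop := fun k e => e < C.code + 1 ∧ e % 2 = 1 ∧ termKey r e = k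
  -- A function symbol returns the rank of some listed term with this head symbol and these argument
  -- ranks. The congruence check makes the choice irrelevant.
  let S : lang.Structure ℕ := structureOf ℕ fun l g v =>
    if h : ∃ e, P (l, g, List.ofFn v) e then r.getD h.choose 0 else 0
  have hS : lang.OrderedStructure ℕ := ⟨fun v => Iff.rfl⟩
  refine C.satisfiable_iff.2 ⟨ℕ, S, inferInstance, hS, ?_⟩
  have heval : ∀ (t : lang.Term (Empty ⊕ Fin 0)) v, termCode t < C.code + 1 →
      t.realize v = r.getD (termCode t) 0 := by
    intro t v ht
    induction t with
    | var x => rcases x with x | x; exacts [x.elim, x.elim0]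
    | @func l g ts ih =>
      have ih' : ∀ i, (ts i).realize v = r.getD (termCode (ts i)) 0 := fun i =>
        ih i ((termCode_lt_func g ts i).trans ht)
      have hk : P (l, g, List.ofFn fun i => (ts i).realize v) (termCode (.func g ts)) := by
        obtain ⟨h1, h2, h3, h4⟩ := termCode_func_unpair g ts
        refine ⟨ht, h1, ?_⟩
        simp only [termKey]
        rw [h2, h3, h4, List.map_ofFn, funext ih']
        rfl
      have h : ∃ e, P (l, g, List.ofFn fun i => (ts i).realize v) e := ⟨_, hk⟩
      rw [Term.realize_func]
      refine (dif_pos h).trans ?_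
      obtain ⟨h1, h2, h3⟩ := h.choose_spec
      have := hr _ h1 _ hk.1
      simpa [h2, h3, hk.2.1, hk.2.2] using this
  have h1 := truth_iff_realize (M := ℕ) htv (fun t u ht hu v => by
    rw [heval t v ht, heval u v hu]) C.2 (Nat.lt_succ_self _)
  unfold Sentence.Realize Formula.Realize
  exact (h1 _ _).1 hC

theorem decidable_satisfiable : ∃ D : ℕ → Prop, ComputablePred D ∧
    ∀ C : ConstraintSystem, D C.code ↔ C.Satisfiable := by
  refine ⟨fun c => satCode c = true, ?_, fun C => ⟨satisfiable_of_satCode, satCode_of_satisfiable⟩⟩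
  refine ⟨inferInstance, ?_⟩
  simpa using primrec_satCode.to_comp

end PromptSynthesis

namespace PromptSynthesis
open FirstOrder FirstOrder.Language

/-! ### Constraint systems in clausal form -/

/-- A literal `c a ≤ c b` (if the Boolean is true) or `c a = c b` between constants. -/
abbrev Lit : Type := Bool × ℕ × ℕ

/-- A sequent: the conjunction of the first list implies the disjunction of the second one. -/
abbrev Sequent : Type := List Lit × List Lit

/-- The truth of a literal if the constants are interpreted by `c`. -/
def Lit.Holds {M : Type} [LE M] (c : ℕ → M) (a : Lit) : Prop :=
  if a.1 then c a.2.1 ≤ c a.2.2 else c a.2.1 = c a.2.2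

/-- The truth of a sequent if the constants are interpreted by `c`. -/
def Sequent.Holds {M : Type} [LE M] (c : ℕ → M) (s : Sequent) : Prop :=
  (∀ a ∈ s.1, Lit.Holds c a) → ∃ a ∈ s.2, Lit.Holds c a

/-- The constant with number `a`, as a term. -/
def constTerm (a : ℕ) : lang.Term (Empty ⊕ Fin 0) :=
  .func (l := 0) (show lang.Functions 0 from a) Fin.elim0

def Lit.formula (a : Lit) : lang.Sentence :=
  if a.1 then .rel (leSymb : lang.Relations 2) ![constTerm a.2.1, constTerm a.2.2]
  else .equal (constTerm a.2.1) (constTerm a.2.2)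

def disjunction (l : List Lit) : lang.Sentence :=
  l.foldr (fun a F => .imp (.imp a.formula .falsum) F) .falsum

def Sequent.formula (s : Sequent) : lang.Sentence :=
  s.1.foldr (fun a F => .imp a.formula F) (disjunction s.2)

def conjunction (l : List Sequent) : lang.Sentence :=
  l.foldr (fun s F => .imp (.imp s.formula (.imp F .falsum)) .falsum) (.imp .falsum .falsum)

theorem Lit.isQF (a : Lit) : a.formula.IsQF := by
  unfold Lit.formula
  split
  · exact .of_isAtomic (.rel _ _)
  · exact .of_isAtomic (.equal _ _)

theorem isQF_disjunction (l : List Lit) : (disjunction l).IsQF := by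
  induction l with
  | nil => exact .falsum
  | cons a l ih => exact .imp (.imp a.isQF .falsum) ih

theorem Sequent.isQF (s : Sequent) : s.formula.IsQF := by
  obtain ⟨l, d⟩ := s
  induction l with
  | nil => exact isQF_disjunction d
  | cons a l ih => exact .imp a.isQF ih

theorem isQF_conjunction (l : List Sequent) : (conjunction l).IsQF := by
  induction l with
  | nil => exact .imp .falsum .falsum
  | cons s l ih => exact .imp (.imp s.isQF (.imp ih .falsum)) .falsum

/-- The constraint system that consists of the given sequents. -/
def ConstraintSystem.ofSequents (l : List Sequent) : ConstraintSystem :=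
  ⟨conjunction l, isQF_conjunction l⟩

section Realize

variable {M : Type} [lang.Structure M]

theorem realize_disjunction (l : List Lit) :
    M ⊨ disjunction l ↔ ∃ a ∈ l, M ⊨ a.formula := by
  induction l with
  | nil => simp only [List.not_mem_nil, false_and, exists_false]; exact Iff.rfl
  | cons a l ih =>
    have h : M ⊨ disjunction (a :: l) ↔ ((M ⊨ a.formula → False) → M ⊨ disjunction l) := Iff.rfl
    rw [h, ih]
    simp only [List.mem_cons, exists_eq_or_imp]
    tauto

theorem realize_conjunction (l : List Sequent) :
    M ⊨ conjunction l ↔ ∀ s ∈ l, M ⊨ s.formula := by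
  induction l with
  | nil =>
    simp only [List.not_mem_nil, false_imp_iff, implies_true, iff_true]
    exact fun h => h
  | cons s l ih =>
    have h : M ⊨ conjunction (s :: l) ↔
      ((M ⊨ s.formula → M ⊨ conjunction l → False) → False) := Iff.rfl
    rw [h, ih]
    simp only [List.mem_cons, forall_eq_or_imp]
    tauto

variable [LinearOrder M] [lang.OrderedStructure M]

theorem Lit.realize_formula (a : Lit) :
    M ⊨ a.formula ↔ Lit.Holds (fun e => (constTerm e).realize (M := M)
      (Sum.elim default default)) a := by
  unfold Lit.formula Lit.Holds
  split
  · have h : ((.rel (leSymb : lang.Relations 2) ![constTerm a.2.1, constTerm a.2.2] :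
        lang.BoundedFormula Empty 0)) = (constTerm a.2.1).le (constTerm a.2.2) := rfl
    rw [h]
    exact Term.realize_le
  · exact Iff.rfl

theorem Sequent.realize_formula (s : Sequent) :
    M ⊨ s.formula ↔ Sequent.Holds (fun e => (constTerm e).realize (M := M)
      (Sum.elim default default)) s := by
  simp only [Sequent.Holds, ← Lit.realize_formula, ← realize_disjunction]
  obtain ⟨l, d⟩ := s
  induction l with
  | nil =>
    have h : M ⊨ Sequent.formula ([], d) ↔ M ⊨ disjunction d := Iff.rfl
    rw [h]
    simp
  | cons a l ih =>
    have h : M ⊨ Sequent.formula (a :: l, d) ↔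
      (M ⊨ a.formula → M ⊨ Sequent.formula (l, d)) := Iff.rfl
    rw [h, ih]
    simp only [List.mem_cons, forall_eq_or_imp, and_imp]

end Realize

theorem ConstraintSystem.satisfiable_ofSequents (l : List Sequent) :
    (ofSequents l).Satisfiable ↔
      ∃ (M : Type) (_ : LinearOrder M) (c : ℕ → M), ∀ s ∈ l, Sequent.Holds c s := by
  rw [satisfiable_iff]
  constructor
  · rintro ⟨M, S, O, hO, h⟩
    exact ⟨M, O, _, fun s hs => s.realize_formula.1 ((realize_conjunction l).1 h s hs)⟩
  · rintro ⟨M, O, c, h⟩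
    -- Only constants occur in the clauses, so symbols of positive arity may be interpreted in any
    -- way.
    let S : lang.Structure M := structureOf M fun _ g _ => c g
    have hO : lang.OrderedStructure M := ⟨fun v => Iff.rfl⟩
    refine ⟨M, S, O, hO, (realize_conjunction l).2 fun s hs => s.realize_formula.2 ?_⟩
    exact h s hs

/-- The inner `0` is the code of the empty argument list. -/
def constCode (a : ℕ) : ℕ := 2 * Nat.pair 0 (Nat.pair a 0) + 1

def Lit.formCode (a : Lit) : ℕ :=
  bif a.1 then 4 * Encodable.encode [constCode a.2.1, constCode a.2.2] + 2
  else 4 * Nat.pair (constCode a.2.1) (constCode a.2.2) + 1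

def impCode (a b : ℕ) : ℕ := 4 * Nat.pair a b + 3

def Sequent.formCode (s : Sequent) : ℕ :=
  s.1.foldr (fun a F => impCode a.formCode F)
    (s.2.foldr (fun a F => impCode (impCode a.formCode 0) F) 0)

def conjunctionCode (l : List Sequent) : ℕ :=
  l.foldr (fun s F => impCode (impCode s.formCode (impCode F 0)) 0) (impCode 0 0)

theorem primrec_conjunctionCode : Primrec conjunctionCode := by
  unfold conjunctionCode Sequent.formCode impCode Lit.formCode constCode
  fun_prop

theorem formulaCode_lit (a : Lit) : formulaCode a.formula = a.formCode := by
  obtain ⟨b, x, y⟩ := a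
  cases b <;> rfl

theorem formulaCode_sequent (s : Sequent) : formulaCode s.formula = s.formCode := by
  obtain ⟨l, d⟩ := s
  induction l with
  | nil =>
    induction d with
    | nil => rfl
    | cons a d ih =>
      have h : formulaCode (Sequent.formula ([], a :: d)) =
        impCode (impCode (formulaCode a.formula) 0) (formulaCode (Sequent.formula ([], d))) := rfl
      rw [h, ih, formulaCode_lit]
      rfl
  | cons a l ih =>
    have h : formulaCode (Sequent.formula (a :: l, d)) =
      impCode (formulaCode a.formula) (formulaCode (Sequent.formula (l, d))) := rfl
    rw [h, ih, formulaCode_lit]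
    rfl

theorem ConstraintSystem.code_ofSequents (l : List Sequent) :
    (ofSequents l).code = conjunctionCode l := by
  induction l with
  | nil => rfl
  | cons s l ih =>
    have h : (ofSequents (s :: l)).code =
      impCode (impCode (formulaCode s.formula) (impCode (ofSequents l).code 0)) 0 := rfl
    rw [h, ih, formulaCode_sequent]
    rfl

end PromptSynthesis

namespace PromptSynthesis

/-! ### Fair paths in finite graphs -/

open Relation

section Walks

variable {X : Type} {E : X → X → Prop}

/-- There is a walk with `n` edges from `a` to `b`. -/
def HasWalk (E : X → X → Prop) (n : ℕ) (a b : X) : Prop :=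
  ∃ p : ℕ → X, p 0 = a ∧ p n = b ∧ ∀ i < n, E (p i) (p (i + 1))

theorem exists_walk_of_transGen {a b : X} (h : TransGen E a b) : ∃ n, 0 < n ∧ HasWalk E n a b := by
  induction h with
  | @single b h =>
    refine ⟨1, one_pos, fun i => if i = 0 then a else b, by simp, by simp, ?_⟩
    intro i hi
    obtain rfl : i = 0 := by omega
    simpa using h
  | @tail b c _ h ih =>
    obtain ⟨n, hn, p, h0, h1, hp⟩ := ih
    refine ⟨n + 1, n.succ_pos, fun i => if i ≤ n then p i else c, by simpa using h0, by simp, ?_⟩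
    intro i hi
    rcases Nat.lt_succ_iff_lt_or_eq.1 hi with hi | rfl
    · have h3 : i + 1 ≤ n := hi
      simpa [hi.le, h3] using hp i hi
    · simpa [h1] using h

theorem exists_segment {f : ℕ → ℕ} (hf : StrictMono f) (h0 : f 0 = 0) (t : ℕ) :
    ∃ i, f i ≤ t ∧ t < f (i + 1) := by
  induction t with
  | zero => exact ⟨0, h0.le, by have := hf Nat.zero_lt_one; simpa [h0] using this⟩
  | succ t ih =>
    obtain ⟨i, h1, h2⟩ := ih
    rcases lt_or_ge (t + 1) (f (i + 1)) with h | h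
    · exact ⟨i, by omega, h⟩
    · have h3 := hf (show i + 1 < i + 1 + 1 by omega)
      exact ⟨i + 1, h, by omega⟩

theorem segment_unique {f : ℕ → ℕ} (hf : StrictMono f) {t i j : ℕ} (h1 : f i ≤ t)
    (h2 : t < f (i + 1)) (h3 : f j ≤ t) (h4 : t < f (j + 1)) : i = j := by
  have h5 := hf.lt_iff_lt.1 (h1.trans_lt h4)
  have h6 := hf.lt_iff_lt.1 (h3.trans_lt h2)
  omega

/-- The concatenation of infinitely many nonempty walks. -/
theorem exists_path_of_walks {y : ℕ → X} {n : ℕ → ℕ} (hn : ∀ i, 0 < n i)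
    (h : ∀ i, HasWalk E (n i) (y i) (y (i + 1))) :
    ∃ (x : ℕ → X) (f : ℕ → ℕ), (∀ t, E (x t) (x (t + 1))) ∧ f 0 = 0 ∧
      (∀ i, f (i + 1) = f i + n i) ∧ ∀ i, x (f i) = y i := by
  choose p hp0 hp1 hp using h
  let f : ℕ → ℕ := fun i => ∑ j ∈ Finset.range i, n j
  have hf1 : ∀ i, f (i + 1) = f i + n i := fun i => Finset.sum_range_succ _ _
  have hf0 : f 0 = 0 := rfl
  have hf : StrictMono f := strictMono_nat_of_lt_succ fun i => by have := hn i; rw [hf1]; omega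
  choose s hs1 hs2 using exists_segment hf hf0
  have hs : ∀ {t i}, f i ≤ t → t < f (i + 1) → s t = i := fun h1 h2 =>
    segment_unique hf (hs1 _) (hs2 _) h1 h2
  have hsf : ∀ i, s (f i) = i := fun i => hs le_rfl (hf (Nat.lt_succ_self i))
  refine ⟨fun t => p (s t) (t - f (s t)), f, fun t => ?_, hf0, hf1, fun i => ?_⟩
  · change E (p (s t) (t - f (s t))) (p (s (t + 1)) (t + 1 - f (s (t + 1))))
    have h1 := hs1 t
    have h2 := hs2 t
    have h3 := hf1 (s t)
    have h4 := hp (s t) (t - f (s t)) (by omega)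
    rcases lt_or_ge (t + 1) (f (s t + 1)) with h | h
    · rw [hs (t := t + 1) (i := s t) (by omega) h]
      convert h4 using 2
      omega
    · have h5 : t + 1 = f (s t + 1) := by omega
      rw [h5, hsf, Nat.sub_self, hp0, ← hp1]
      convert h4 using 2
      omega
  · simp only [hsf, Nat.sub_self, hp0]

end Walks

section Fairness

variable {X : Type} {E : X → X → Prop} {F : ℕ → X → Prop} {J : ℕ}

/-- The index `j` is missed by the strongly connected component of `x`. -/
def Missed (E : X → X → Prop) (F : ℕ → X → Prop) (x : X) (j : ℕ) : Prop :=
  ∀ y, TransGen E x y → ReflTransGen E y x → ¬ F j y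

/-- The number of vertices that are reachable from `x`. -/
noncomputable def reachCard (E : X → X → Prop) (x : X) : ℕ := {y | ReflTransGen E x y}.ncard

theorem reachCard_le [Finite X] {x y : X} (h : E x y) : reachCard E y ≤ reachCard E x :=
  Set.ncard_le_ncard (fun _ hz => ReflTransGen.head h hz) (Set.toFinite _)

/-- When the number of reachable vertices does not drop along an edge, the two reachable sets
coincide, so `x` and `y` lie on a common cycle. They share a component, and `y` belongs to what the
component of `x` visits. -/
theorem missed_step [Finite X] {x y : X} (h : E x y) (hc : reachCard E x ≤ reachCard E y) {j : ℕ}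
    (hj : Missed E F x j) : Missed E F y j ∧ ¬ F j y := by
  have hsub : {z | ReflTransGen E y z} ⊆ {z | ReflTransGen E x z} :=
    fun _ hz => ReflTransGen.head h hz
  have heq := Set.eq_of_subset_of_ncard_le hsub hc (Set.toFinite _)
  have hyx : ReflTransGen E y x := by
    have : x ∈ {z | ReflTransGen E x z} := ReflTransGen.refl
    rwa [← heq] at this
  refine ⟨fun z h1 h2 => hj z (TransGen.head h h1) (h2.trans hyx), hj y (.single h) hyx⟩

/-- If the strongly connected component of a reachable vertex misses no index, then there is a
path that visits every `F j` in every window of a fixed length. -/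
theorem exists_fair_path [Finite X] (hJ : 0 < J) {a x : X} (hax : ReflTransGen E a x)
    (h : ∀ j < J, ¬ Missed E F x j) :
    ∃ (π : ℕ → X) (D : ℕ), π 0 = a ∧ (∀ t, E (π t) (π (t + 1))) ∧
      ∀ j < J, ∀ t, ∃ u, t ≤ u ∧ u ≤ t + D ∧ F j (π u) := by
  classical
  simp only [Missed, not_forall, not_not] at h
  have : ∀ j, ∃ y, j < J → TransGen E x y ∧ ReflTransGen E y x ∧ F j y := by
    intro j
    by_cases hj : j < J
    · obtain ⟨y, h1, h2, h3⟩ := h j hj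
      exact ⟨y, fun _ => ⟨h1, h2, h3⟩⟩
    · exact ⟨x, fun h => absurd h hj⟩
  choose v hv using this
  -- From `a` the path moves to the component of `x` and then visits the representatives `v 0, …, v
  -- (J - 1)` cyclically.
  let y : ℕ → X := fun i => if i = 0 then a else v ((i - 1) % J)
  have hmod : ∀ i, i % J < J := fun i => Nat.mod_lt _ hJ
  have hy : ∀ i, TransGen E (y i) (y (i + 1)) := by
    intro i
    have h1 : ReflTransGen E (y i) x := by
      rcases i with _ | i
      · exact hax
      · exact (hv _ (hmod _)).2.1
    exact TransGen.trans_right h1 (hv _ (hmod _)).1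
  -- Choosing the length by the pair of endpoints leaves finitely many lengths, hence a uniform
  -- bound.
  have : ∀ p : X × X, ∃ n, TransGen E p.1 p.2 → 0 < n ∧ HasWalk E n p.1 p.2 := by
    intro p
    by_cases hp : TransGen E p.1 p.2
    · obtain ⟨n, hn⟩ := exists_walk_of_transGen hp
      exact ⟨n, fun _ => hn⟩
    · exact ⟨0, fun h => absurd h hp⟩
  choose len hlen using this
  obtain ⟨B, hB⟩ := (Set.finite_range len).bddAbove
  obtain ⟨π, f, h1, h2, h3, h4⟩ := exists_path_of_walks (y := y)
    (n := fun i => len (y i, y (i + 1))) (fun i => (hlen (y i, y (i + 1)) (hy i)).1) (fun i => (hlen (y i, y (i + 1)) (hy i)).2)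
  have hf : StrictMono f := strictMono_nat_of_lt_succ fun i => by
    have := (hlen (y i, y (i + 1)) (hy i)).1
    rw [h3]; omega
  have hfB : ∀ i s, f (i + s) ≤ f i + s * B := by
    intro i s
    induction s with
    | zero => simp
    | succ s ih =>
      have : len (y (i + s), y (i + s + 1)) ≤ B := hB ⟨_, rfl⟩
      rw [← Nat.add_assoc, h3, Nat.succ_mul]
      omega
  refine ⟨π, (J + 1) * B, by rw [← h2, h4]; rfl, h1, fun j hj t => ?_⟩
  obtain ⟨i, hi1, hi2⟩ := exists_segment hf h2 t
  -- The next stop at `v j` after segment `i` is `i + (s + 1)`; the shift by one comes from the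
  -- initial stop `a`.
  obtain ⟨s, hs, hsj⟩ : ∃ s < J, (i + s) % J = j := by
    refine ⟨(j + (J - i % J)) % J, hmod _, ?_⟩
    rw [Nat.add_mod_mod, ← Nat.mod_add_mod, ← Nat.add_assoc, Nat.add_comm (i % J) j,
      Nat.add_assoc, Nat.add_sub_cancel' (hmod i).le, Nat.add_mod_right, Nat.mod_eq_of_lt hj]
  refine ⟨f (i + (s + 1)), ?_, ?_, ?_⟩
  · exact hi2.le.trans (hf.monotone (by omega))
  · have h5 := hfB i (s + 1)
    have h6 : (s + 1) * B ≤ (J + 1) * B := Nat.mul_le_mul_right _ (by omega)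
    omega
  · rw [h4]
    have : y (i + (s + 1)) = v j := by
      simp only [y]
      rw [if_neg (by omega), show i + (s + 1) - 1 = i + s by omega, hsj]
    rw [this]
    exact (hv j hj).2.2

/-- A ranking refutes fairness of a path. -/
theorem not_fair_of_ranking [Finite X] {M : Type} [LinearOrder M] {rank : X → M}
    {missed : X → ℕ → Prop} {π : ℕ → X}
    (h1 : ∀ t, rank (π (t + 1)) ≤ rank (π t))
    (h2 : ∀ t, ∀ j < J, rank (π t) ≤ rank (π (t + 1)) → missed (π t) j →
      missed (π (t + 1)) j ∧ ¬ F j (π (t + 1)))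
    (h3 : ∀ t, ∃ j < J, missed (π t) j) :
    ¬ ∀ j < J, ∀ t, ∃ u, t ≤ u ∧ F j (π u) := by
  intro hfair
  have hfin : (Set.range fun t => rank (π t)).Finite :=
    ((Set.finite_range rank).subset (by rintro _ ⟨t, rfl⟩; exact ⟨_, rfl⟩))
  -- From a time of minimal rank on, the rank is constant, so a condition missed there is missed
  -- forever.
  obtain ⟨m, ⟨t0, rfl⟩, hm⟩ := Set.exists_min_image _ id hfin ⟨_, ⟨0, rfl⟩⟩
  have hmin : ∀ t, rank (π t0) ≤ rank (π t) := fun t => hm _ ⟨t, rfl⟩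
  have hanti : Antitone fun t => rank (π t) := antitone_nat_of_succ_le h1
  obtain ⟨j, hj, hmj⟩ := h3 t0
  have key : ∀ d, missed (π (t0 + d)) j := by
    intro d
    induction d with
    | zero => exact hmj
    | succ d ih =>
      exact (h2 _ j hj ((hanti (Nat.le_add_right t0 d)).trans (hmin _)) ih).1
  obtain ⟨u, hu, hF⟩ := hfair j hj (t0 + 1)
  obtain ⟨d, rfl⟩ : ∃ d, u = t0 + d + 1 := ⟨u - t0 - 1, by omega⟩
  exact (h2 _ j hj ((hanti (Nat.le_add_right t0 d)).trans (hmin _)) (key d)).2 hF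

end Fairness

end PromptSynthesis

namespace PromptSynthesis

/-! ### Pumpable paths -/

open Relation

section Pumping

variable {Q : Type} {E : Q → Q → Prop} {r s : Q → Prop}

/-- The edges of the graph that guesses, between any two consecutive vertices in `s`, a cycle
that starts in `r`. The second component is `0` before the cycle, `1` on the cycle and `2` after it;
the third component is the first vertex of the cycle. -/
def PumpEdge (E : Q → Q → Prop) (r s : Q → Prop) (x y : Q × Fin 3 × Q) : Prop :=
  E x.1 y.1 ∧ ((s y.1 ∧ x.2.1 = 2 ∧ y.2.1 = 0) ∨
    (¬ s y.1 ∧ ((y.2 = x.2) ∨ (x.2.1 = 0 ∧ y.2 = (1, y.1) ∧ r y.1) ∨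
      (x.2.1 = 1 ∧ y.2 = (2, x.2.2) ∧ y.1 = x.2.2))))

/-- The length `l` depends only on `k` and the number of vertices, not on the path. Between two
consecutive multiples of `l` there are more multiples of `k + 1` than vertices, so some vertex in
`r` repeats there, which provides the cycle. -/
theorem exists_pump_path [Finite Q] (k : ℕ) : ∃ l > 0, ∀ q : ℕ → Q,
    (∀ t, E (q t) (q (t + 1))) → (∀ t, r (q (t * (k + 1)))) → (∀ t, s (q t) ↔ l ∣ t) →
    ∃ π : ℕ → Q × Fin 3 × Q, (∀ t, (π t).1 = q t) ∧ (π 0).2.1 = 0 ∧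
      ∀ t, PumpEdge E r s (π t) (π (t + 1)) := by
  classical
  refine ⟨(k + 1) * (Nat.card Q + 2), Nat.mul_pos k.succ_pos (Nat.succ_pos _),
    fun q hE hr hs => ?_⟩
  set c := Nat.card Q with hc
  set l := (k + 1) * (c + 2) with hl
  have hl0 : 0 < l := Nat.mul_pos k.succ_pos (Nat.succ_pos _)
  have key : ∀ m, ∃ a b, m * l < a ∧ a < b ∧ b < (m + 1) * l ∧ r (q a) ∧ q a = q b := by
    intro m
    -- These are exactly the `c + 1` multiples of `k + 1` strictly between `m * l` and `(m + 1) *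
    -- l`.
    let g : Fin (c + 1) → ℕ := fun i => (m * (c + 2) + i.val + 1) * (k + 1)
    have hg : ∀ i j, i < j → g i < g j := fun i j hij =>
      Nat.mul_lt_mul_of_pos_right (by have : i.val < j.val := hij; omega) k.succ_pos
    have hg1 : ∀ i, m * l < g i := fun i => by
      have : m * l = (m * (c + 2)) * (k + 1) := by rw [hl]; ring
      rw [this]
      exact Nat.mul_lt_mul_of_pos_right (by omega) k.succ_pos
    have hg2 : ∀ i, g i < (m + 1) * l := fun i => by
      have : (m + 1) * l = (m * (c + 2) + (c + 1) + 1) * (k + 1) := by rw [hl]; ring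
      rw [this]
      exact Nat.mul_lt_mul_of_pos_right (by have := i.2; omega) k.succ_pos
    have : ∃ i j : Fin (c + 1), i ≠ j ∧ q (g i) = q (g j) := by
      by_contra! hcon
      have hinj : Function.Injective fun i => q (g i) := fun i j h => by
        by_contra hij
        exact hcon i j hij h
      have := Nat.card_le_card_of_injective _ hinj
      rw [Nat.card_eq_fintype_card, Fintype.card_fin] at this
      omega
    obtain ⟨i, j, hij, he⟩ := this
    rcases lt_or_gt_of_ne hij with h | h
    · exact ⟨g i, g j, hg1 i, hg i j h, hg2 j, hr _, he⟩
    · exact ⟨g j, g i, hg1 j, hg j i h, hg2 i, hr _, he.symm⟩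
  choose a b hma hab hbm hra heq using key
  -- The third component holds the future cycle start from the beginning of the segment, which is
  -- allowed because an edge into `s` leaves it free.
  let π : ℕ → Q × Fin 3 × Q := fun t =>
    (q t, if t < a (t / l) then 0 else if t < b (t / l) then 1 else 2, q (a (t / l)))
  have hseg : ∀ t, t / l * l ≤ t ∧ t < (t / l + 1) * l := fun t =>
    ⟨Nat.div_mul_le_self _ _, by rw [Nat.succ_mul]; exact Nat.lt_div_mul_add hl0⟩
  refine ⟨π, fun _ => rfl, ?_, fun t => ⟨hE t, ?_⟩⟩
  · have : 0 < a (0 / l) := (Nat.zero_le _).trans_lt (hma _)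
    simp only [π, this, if_true]
  · by_cases hst : l ∣ t + 1
    · left
      have h1 : (t + 1) / l = t / l + 1 := Nat.succ_div_of_dvd hst
      have h2 : t + 1 = (t / l + 1) * l := by rw [← h1, Nat.div_mul_cancel hst]
      have h3 := hbm (t / l)
      have h4 := hab (t / l)
      have h5 := hma (t / l + 1)
      refine ⟨(hs _).2 hst, ?_, ?_⟩
      · simp only [π]
        rw [if_neg (by omega), if_neg (by omega)]
      · simp only [π]
        rw [h1, if_pos (by omega)]
    · right
      have h1 : (t + 1) / l = t / l := Nat.succ_div_of_not_dvd hst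
      refine ⟨fun h => hst ((hs _).1 h), ?_⟩
      have h4 := hab (t / l)
      simp only [π]
      rw [h1]
      rcases lt_trichotomy (t + 1) (a (t / l)) with h | h | h
      · left
        rw [if_pos (by omega), if_pos (by omega)]
      · right; left
        rw [if_pos (show t < a (t / l) by omega), if_neg (show ¬ t + 1 < a (t / l) by omega),
          if_pos (by omega), h]
        exact ⟨rfl, rfl, hra _⟩
      · rcases lt_trichotomy (t + 1) (b (t / l)) with h' | h' | h'
        · left
          rw [if_neg (show ¬ t < a (t / l) by omega), if_neg (show ¬ t + 1 < a (t / l) by omega),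
            if_pos (by omega), if_pos (by omega)]
        · right; right
          rw [if_neg (show ¬ t < a (t / l) by omega), if_neg (show ¬ t + 1 < a (t / l) by omega),
            if_pos (by omega), if_neg (by omega), h']
          exact ⟨rfl, rfl, (heq _).symm⟩
        · left
          rw [if_neg (show ¬ t < a (t / l) by omega), if_neg (show ¬ t + 1 < a (t / l) by omega),
            if_neg (by omega), if_neg (by omega)]

/-- The edges of the graph with two counters for the distances to the last vertices in `r` and `s`;
the first one is at most `D`, and the second one is at least `l` when the next vertex in `s` is
reached. -/
def CountEdge (E : Q → Q → Prop) (r s : Q → Prop) (D l : ℕ) (x y : Q × ℕ × ℕ) : Prop :=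
  E x.1 y.1 ∧ (r y.1 → y.2.1 = 0) ∧ (¬ r y.1 → y.2.1 = x.2.1 + 1) ∧ y.2.1 ≤ D ∧
    (s y.1 → l ≤ x.2.2 + 1 ∧ y.2.2 = 0) ∧ (¬ s y.1 → y.2.2 = x.2.2 + 1)

theorem count_path_bounded {D l : ℕ} {y : ℕ → Q × ℕ × ℕ}
    (h : ∀ t, CountEdge E r s D l (y t) (y (t + 1))) (t : ℕ) :
    ∃ u, t ≤ u ∧ u ≤ t + (D + 2) ∧ r (y u).1 := by
  by_contra! hcon
  have key : ∀ d ≤ D + 1, d ≤ (y (t + d)).2.1 := by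
    intro d hd
    induction d with
    | zero => simp
    | succ d ih =>
      have h1 := (h (t + d)).2.2.1 (hcon _ (by omega) (by omega))
      have h2 := ih (by omega)
      rw [← Nat.add_assoc, h1]
      omega
  have h1 := key (D + 1) le_rfl
  have h2 := (h (t + D)).2.2.2.1
  rw [← Nat.add_assoc] at h1
  omega

/-- Since the second counter is reset at `t`, it is at most the time elapsed since then, while
entering `s` requires it to have reached `l - 1`. Position `0` is excluded because no edge enters it
and its counter is arbitrary. -/
theorem count_path_spaced {D l : ℕ} {y : ℕ → Q × ℕ × ℕ}
    (h : ∀ t, CountEdge E r s D l (y t) (y (t + 1))) {t u : ℕ} (htu : t < u)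
    (ht : 0 < t) (hst : s (y t).1) (hsu : s (y u).1) : t + l ≤ u := by
  have key : ∀ d, (y (t + d)).2.2 ≤ d := by
    intro d
    induction d with
    | zero =>
      obtain ⟨t, rfl⟩ : ∃ t', t = t' + 1 := ⟨t - 1, by omega⟩
      exact ((h t).2.2.2.2.1 hst).2.le
    | succ d ih =>
      rw [← Nat.add_assoc]
      by_cases hs : s (y (t + d + 1)).1
      · rw [((h (t + d)).2.2.2.2.1 hs).2]
        omega
      · rw [(h (t + d)).2.2.2.2.2 hs]
        omega
  obtain ⟨d, rfl⟩ : ∃ d, u = t + d + 1 := ⟨u - t - 1, by omega⟩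
  have := key d
  have := ((h (t + d)).2.2.2.2.1 hsu).1
  omega

open Classical in
/-- The distances to the last vertices in `r` on a path. -/
noncomputable def lastDist (r : Q → Prop) (q : ℕ → Q) : ℕ → ℕ
  | 0 => 0
  | t + 1 => if r (q (t + 1)) then 0 else lastDist r q t + 1

theorem lastDist_le {q : ℕ → Q} {D : ℕ} (h : ∀ t, ∃ u, t ≤ u ∧ u ≤ t + D ∧ r (q u)) (t : ℕ) :
    lastDist r q t ≤ D := by
  -- A distance of at least `d` means that the last `d` positions up to `t` avoid `r`.
  have key : ∀ t d, d ≤ lastDist r q t → d ≤ t ∧ ∀ u, t < u + d → u ≤ t → ¬ r (q u) := by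
    intro t
    induction t with
    | zero =>
      intro d hd
      simp only [lastDist, Nat.le_zero] at hd
      subst hd
      exact ⟨le_rfl, fun u h1 h2 => by omega⟩
    | succ t ih =>
      intro d hd
      rw [lastDist] at hd
      split at hd
      · exact ⟨by omega, fun u h1 h2 => by omega⟩
      · rename_i hr
        rcases d with _ | d
        · exact ⟨by omega, fun u h1 h2 => by omega⟩
        · obtain ⟨h1, h2⟩ := ih d (by omega)
          refine ⟨by omega, fun u h3 h4 => ?_⟩
          rcases Nat.lt_or_ge u (t + 1) with h5 | h5
          · exact h2 u (by omega) (by omega)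
          · obtain rfl : u = t + 1 := by omega
            exact hr
  by_contra! hcon
  obtain ⟨h1, h2⟩ := key t (D + 1) hcon
  obtain ⟨u, h3, h4, h5⟩ := h (t - D)
  exact h2 u (by omega) (by omega) h5

/-- A cycle on which the second counter increases can be repeated. -/
theorem iterate_cycle {D l : ℕ} {z : Q}
    (h : ∀ e, ∃ e' > e, ReflTransGen (CountEdge E r s D l) (z, 0, e) (z, 0, e')) (n e : ℕ) :
    ∃ e' ≥ n, ReflTransGen (CountEdge E r s D l) (z, 0, e) (z, 0, e') := by
  induction n with
  | zero => exact ⟨e, Nat.zero_le _, .refl⟩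
  | succ n ih =>
    obtain ⟨e1, h1, h2⟩ := ih
    obtain ⟨e2, h3, h4⟩ := h e1
    exact ⟨e2, by omega, h2.trans h4⟩

/-- A path of the pumping graph that visits `r` in every window of length `D` can be pumped such
that the vertices in `s` have distance at least `l`. -/
theorem exists_count_path {π : ℕ → Q × Fin 3 × Q} {D : ℕ} (l : ℕ) (h0 : (π 0).2.1 = 0)
    (hπ : ∀ t, PumpEdge E r s (π t) (π (t + 1)))
    (hr : ∀ t, ∃ u, t ≤ u ∧ u ≤ t + D ∧ r (π u).1) :
    ∃ (y : ℕ → Q × ℕ × ℕ) (f : ℕ → ℕ), (∀ t, CountEdge E r s D l (y t) (y (t + 1))) ∧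
      f 0 = 0 ∧ StrictMono f ∧ ∀ t, (y (f t)).1 = (π t).1 := by
  classical
  set C := CountEdge E r s D l with hC
  let ρ : ℕ → ℕ := lastDist r fun t => (π t).1
  have hρ : ∀ t, ρ t ≤ D := lastDist_le hr
  have hρ0 : ∀ t, r (π (t + 1)).1 → ρ (t + 1) = 0 := fun t h => if_pos h
  have hρ1 : ∀ t, ¬ r (π (t + 1)).1 → ρ (t + 1) = ρ t + 1 := fun t h => if_neg h
  have hstep : ∀ t e, ¬ s (π (t + 1)).1 →
      C ((π t).1, ρ t, e) ((π (t + 1)).1, ρ (t + 1), e + 1) := fun t e hs =>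
    ⟨(hπ t).1, hρ0 t, hρ1 t, hρ _, fun h => absurd h hs, fun _ => rfl⟩
  -- Invariant of the simulation. On the cycle, the portion since its start can be replayed from any
  -- value of the second counter without decreasing it; after the cycle, that counter has already
  -- reached `l`.
  let I : ℕ → ℕ → Prop := fun t e =>
    ((π t).2.1 = 1 → r (π t).2.2 ∧ ∀ e, ∃ e' ≥ e,
      ReflTransGen C ((π t).2.2, 0, e) ((π t).1, ρ t, e')) ∧
    ((π t).2.1 = 2 → l ≤ e)
  have main : ∀ t e, I t e → ∃ e', I (t + 1) e' ∧
      TransGen C ((π t).1, ρ t, e) ((π (t + 1)).1, ρ (t + 1), e') := by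
    intro t e hI
    obtain ⟨hE, ⟨hs, h2, h3⟩ | ⟨hs, h⟩⟩ := hπ t
    -- A vertex in `s` is entered only from the phase after the cycle, where the invariant supplies
    -- the required distance.
    · refine ⟨0, ⟨fun h => ?_, fun h => ?_⟩, .single ⟨hE, hρ0 t, hρ1 t, hρ _, fun _ => ⟨?_, rfl⟩,
        fun h => absurd hs h⟩⟩
      · rw [h3] at h; exact absurd h (by decide)
      · rw [h3] at h; exact absurd h (by decide)
      · exact (hI.2 h2).trans (Nat.le_succ _)
    · have hst := fun e => hstep t e hs
      rcases h with h | ⟨h1, h2, h3⟩ | ⟨h1, h2, h3⟩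
      · refine ⟨e + 1, ⟨fun h4 => ?_, fun h4 => ?_⟩, .single (hst e)⟩
        · rw [h] at h4 ⊢
          refine ⟨(hI.1 h4).1, fun e0 => ?_⟩
          obtain ⟨e', he, hw⟩ := (hI.1 h4).2 e0
          exact ⟨e' + 1, by omega, hw.tail (hst e')⟩
        · rw [h] at h4
          exact (hI.2 h4).trans (Nat.le_succ _)
      · refine ⟨e + 1, ⟨fun _ => ?_, fun h4 => ?_⟩, .single (hst e)⟩
        · rw [h2, hρ0 t h3]
          exact ⟨h3, fun e0 => ⟨e0, le_rfl, .refl⟩⟩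
        · rw [h2] at h4; exact absurd h4 (by simp)
      -- The edge closes the cycle. Its start lies in `r`, so the first counter returns to `0` and
      -- repetition never strains the bound `D`; the cycle is repeated until the second counter
      -- reaches `l`.
      · obtain ⟨hz, hw⟩ := hI.1 h1
        have hr0 : ρ (t + 1) = 0 := hρ0 t (h3 ▸ hz)
        have hcyc : ∀ e, ∃ e' > e, ReflTransGen C ((π t).2.2, 0, e) ((π t).2.2, 0, e') := by
          intro e0
          obtain ⟨e', he, hw'⟩ := hw e0
          have := hst e'
          rw [h3, hr0] at this
          exact ⟨e' + 1, by omega, hw'.tail this⟩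
        obtain ⟨e', he, hw'⟩ := iterate_cycle hcyc l (e + 1)
        refine ⟨e', ⟨fun h4 => ?_, fun _ => he⟩, ?_⟩
        · rw [h2] at h4; exact absurd h4 (by simp)
        · have h5 := hst e
          rw [h3, hr0] at h5 ⊢
          exact TransGen.trans_left (.single h5) hw'
  let c : ∀ t, {e // I t e} := fun t => Nat.rec ⟨0, by simp [I, h0]⟩
    (fun t e => ⟨(main t e.1 e.2).choose, (main t e.1 e.2).choose_spec.1⟩) t
  have hc : ∀ t, TransGen C ((π t).1, ρ t, (c t).1) ((π (t + 1)).1, ρ (t + 1), (c (t + 1)).1) :=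
    fun t => (main t (c t).1 (c t).2).choose_spec.2
  choose n hn hw using fun t => exists_walk_of_transGen (hc t)
  obtain ⟨y, f, h1, h2, h3, h4⟩ :=
    exists_path_of_walks (y := fun t => ((π t).1, ρ t, (c t).1)) hn hw
  refine ⟨y, f, h1, h2, strictMono_nat_of_lt_succ fun t => ?_, fun t => by rw [h4]⟩
  have := hn t
  rw [h3]; omega

end Pumping

end PromptSynthesis

namespace PromptSynthesis

/-! ### Marked words: the alternating colour technique -/

/-- There is at most one mark at the positions after `i` up to `e`. -/
def AtMostOne (m : ℕ → Prop) (i e : ℕ) : Prop :=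
  ∀ a b, i < a → a < b → b ≤ e → m a → ¬ m b

namespace PromptLTL

/-- The semantics in which `F_P φ` requires `φ` before the second mark. -/
def SatMarked {V : Type} (w : ℕ → Finset V) (m : ℕ → Prop) : PromptLTL V → ℕ → Prop
  | atom a, i => a ∈ w i
  | natom a, i => a ∉ w i
  | and φ ψ, i => SatMarked w m φ i ∧ SatMarked w m ψ i
  | or φ ψ, i => SatMarked w m φ i ∨ SatMarked w m ψ i
  | next φ, i => SatMarked w m φ (i + 1)
  | untl φ ψ, i => ∃ j, SatMarked w m ψ (i + j) ∧ ∀ n < j, SatMarked w m φ (i + n)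
  | release φ ψ, i => ∀ j, SatMarked w m ψ (i + j) ∨ ∃ n < j, SatMarked w m φ (i + n)
  | prompt φ, i => ∃ j, SatMarked w m φ (i + j) ∧ AtMostOne m i (i + j)

variable {V : Type} {w : ℕ → Finset V} {m : ℕ → Prop} {k : ℕ}

/-- There is a mark among `i + 1, …, i + 1 + k` and another among `i + k + 2, …, i + 2 * k + 2`. A
position reached with at most one mark is therefore at distance at most `2 * k + 1`. -/
theorem satAt_of_satMarked (hm : ∀ t, ∃ u, t ≤ u ∧ u ≤ t + k ∧ m u) {φ : PromptLTL V} {i : ℕ}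
    (h : φ.SatMarked w m i) : φ.SatAt w (2 * k + 1) i := by
  induction φ generalizing i with
  | atom a => exact h
  | natom a => exact h
  | and φ ψ h1 h2 => exact ⟨h1 h.1, h2 h.2⟩
  | or φ ψ h1 h2 => exact h.imp h1 h2
  | next φ h1 => exact h1 h
  | untl φ ψ h1 h2 =>
    obtain ⟨j, hj, hn⟩ := h
    exact ⟨j, h2 hj, fun n hnj => h1 (hn n hnj)⟩
  | release φ ψ h1 h2 => exact fun j => (h j).imp h2 fun ⟨n, hn, h'⟩ => ⟨n, hn, h1 h'⟩
  | prompt φ h1 =>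
    obtain ⟨j, hj, ha⟩ := h
    refine ⟨j, ?_, h1 hj⟩
    by_contra! hcon
    obtain ⟨u, hu1, hu2, hu⟩ := hm (i + 1)
    obtain ⟨v, hv1, hv2, hv⟩ := hm (i + k + 2)
    exact ha u v (by omega) (by omega) (by omega) hu hv

/-- Two marks among the `k` positions after `i` would be closer than `k`. Only positions after `i`
count, so a mark at position `0` needs no spacing. -/
theorem satMarked_of_satAt (hm : ∀ t u, 0 < t → t < u → m t → m u → t + k ≤ u)
    {φ : PromptLTL V} {i : ℕ} (h : φ.SatAt w k i) : φ.SatMarked w m i := by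
  induction φ generalizing i with
  | atom a => exact h
  | natom a => exact h
  | and φ ψ h1 h2 => exact ⟨h1 h.1, h2 h.2⟩
  | or φ ψ h1 h2 => exact h.imp h1 h2
  | next φ h1 => exact h1 h
  | untl φ ψ h1 h2 =>
    obtain ⟨j, hj, hn⟩ := h
    exact ⟨j, h2 hj, fun n hnj => h1 (hn n hnj)⟩
  | release φ ψ h1 h2 => exact fun j => (h j).imp h2 fun ⟨n, hn, h'⟩ => ⟨n, hn, h1 h'⟩
  | prompt φ h1 =>
    obtain ⟨j, hj, hs⟩ := h
    refine ⟨j, h1 hs, fun a b h1 h2 h3 ha hb => ?_⟩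
    have := hm a b (by omega) h2 ha hb
    omega

end PromptLTL

/-- `SatMarked` on codes of formulas; `x i` is the set of the codes of the atomic propositions that
hold at position `i`. -/
def CodeSat (x : ℕ → ℕ → Prop) (m : ℕ → Prop) (d i : ℕ) : Prop :=
  if d % 8 = 0 then x i (d / 8)
  else if d % 8 = 1 then ¬ x i (d / 8)
  else if d % 8 = 2 then CodeSat x m (d / 8).unpair.1 i ∧ CodeSat x m (d / 8).unpair.2 i
  else if d % 8 = 3 then CodeSat x m (d / 8).unpair.1 i ∨ CodeSat x m (d / 8).unpair.2 i
  else if d % 8 = 4 then CodeSat x m (d / 8) (i + 1)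
  else if d % 8 = 5 then
    ∃ j, CodeSat x m (d / 8).unpair.2 (i + j) ∧ ∀ n < j, CodeSat x m (d / 8).unpair.1 (i + n)
  else if d % 8 = 6 then
    ∀ j, CodeSat x m (d / 8).unpair.2 (i + j) ∨ ∃ n < j, CodeSat x m (d / 8).unpair.1 (i + n)
  else ∃ j, CodeSat x m (d / 8) (i + j) ∧ AtMostOne m i (i + j)
termination_by d
decreasing_by
  all_goals
    have h1 := Nat.unpair_left_le (d / 8)
    have h2 := Nat.unpair_right_le (d / 8)
    omega

theorem codeSat_code {V : Type} [Encodable V] {w : ℕ → Finset V} {x : ℕ → ℕ → Prop}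
    {m : ℕ → Prop} (hx : ∀ i a, x i (Encodable.encode a) ↔ a ∈ w i) (φ : PromptLTL V) (i : ℕ) :
    CodeSat x m φ.code i ↔ φ.SatMarked w m i := by
  induction φ generalizing i with
  | atom a =>
    simp only [PromptLTL.code, PromptLTL.SatMarked]
    rw [CodeSat, if_pos (by omega), Nat.mul_div_cancel_left _ (by norm_num), hx]
  | natom a =>
    have h : (8 * Encodable.encode a + 1) / 8 = Encodable.encode a := by omega
    simp only [PromptLTL.code, PromptLTL.SatMarked]
    rw [CodeSat, if_neg (by omega), if_pos (by omega), h, hx]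
  | and φ ψ h1 h2 =>
    have h : (8 * Nat.pair φ.code ψ.code + 2) / 8 = Nat.pair φ.code ψ.code := by omega
    simp only [PromptLTL.code, PromptLTL.SatMarked]
    rw [CodeSat, if_neg (by omega), if_neg (by omega), if_pos (by omega), h, Nat.unpair_pair,
      h1, h2]
  | or φ ψ h1 h2 =>
    have h : (8 * Nat.pair φ.code ψ.code + 3) / 8 = Nat.pair φ.code ψ.code := by omega
    simp only [PromptLTL.code, PromptLTL.SatMarked]
    rw [CodeSat, if_neg (by omega), if_neg (by omega), if_neg (by omega), if_pos (by omega), h,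
      Nat.unpair_pair, h1, h2]
  | next φ h1 =>
    have h : (8 * φ.code + 4) / 8 = φ.code := by omega
    simp only [PromptLTL.code, PromptLTL.SatMarked]
    rw [CodeSat, if_neg (by omega), if_neg (by omega), if_neg (by omega), if_neg (by omega),
      if_pos (by omega), h, h1]
  | untl φ ψ h1 h2 =>
    have h : (8 * Nat.pair φ.code ψ.code + 5) / 8 = Nat.pair φ.code ψ.code := by omega
    simp only [PromptLTL.code, PromptLTL.SatMarked]
    rw [CodeSat, if_neg (by omega), if_neg (by omega), if_neg (by omega), if_neg (by omega),
      if_neg (by omega), if_pos (by omega), h, Nat.unpair_pair]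
    simp only [h1, h2]
  | release φ ψ h1 h2 =>
    have h : (8 * Nat.pair φ.code ψ.code + 6) / 8 = Nat.pair φ.code ψ.code := by omega
    simp only [PromptLTL.code, PromptLTL.SatMarked]
    rw [CodeSat, if_neg (by omega), if_neg (by omega), if_neg (by omega), if_neg (by omega),
      if_neg (by omega), if_neg (by omega), if_pos (by omega), h, Nat.unpair_pair]
    simp only [h1, h2]
  | prompt φ h1 =>
    have h : (8 * φ.code + 7) / 8 = φ.code := by omega
    simp only [PromptLTL.code, PromptLTL.SatMarked]
    rw [CodeSat, if_neg (by omega), if_neg (by omega), if_neg (by omega), if_neg (by omega),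
      if_neg (by omega), if_neg (by omega), if_neg (by omega), h]
    simp only [h1]

/-! ### Tableaux -/

/-- The value of the formula with code `d` is required to hold before the next mark. -/
def BeforeMark (B m : ℕ → Prop) (i : ℕ) : Prop :=
  ∃ j, B (i + j) ∧ ∀ n < j, ¬ m (i + n + 1)

/-- The truth value of the formula with code `d` at a position, computed from the tables `h` and `h'`
at this and the next position, the letter `x` at this position and the mark `b` at the next one. The
entry `2 * d` of a table is the truth value of the formula with code `d`, and the entry `2 * d + 1`
tells whether this formula holds before the next mark. -/
def tableauValue (x h h' : List Bool) (b : Bool) (d : ℕ) : Bool :=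
  bif decide (d % 8 = 0) then x.getD (d / 8) false
  else bif decide (d % 8 = 1) then !x.getD (d / 8) false
  else bif decide (d % 8 = 2) then
    h.getD (2 * (d / 8).unpair.1) false && h.getD (2 * (d / 8).unpair.2) false
  else bif decide (d % 8 = 3) then
    h.getD (2 * (d / 8).unpair.1) false || h.getD (2 * (d / 8).unpair.2) false
  else bif decide (d % 8 = 4) then h'.getD (2 * (d / 8)) false
  else bif decide (d % 8 = 5) then
    h.getD (2 * (d / 8).unpair.2) false ||
      (h.getD (2 * (d / 8).unpair.1) false && h'.getD (2 * d) false)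
  else bif decide (d % 8 = 6) then
    h.getD (2 * (d / 8).unpair.2) false &&
      (h.getD (2 * (d / 8).unpair.1) false || h'.getD (2 * d) false)
  else h.getD (2 * (d / 8)) false ||
    bif b then h'.getD (2 * (d / 8) + 1) false else h'.getD (2 * d) false

/-- The tables `h` and `h'` at consecutive positions are consistent. -/
def tableauStep (c : ℕ) (x h h' : List Bool) (b : Bool) : Bool :=
  (List.range c).all fun d =>
    decide (h.getD (2 * d) false = tableauValue x h h' b d) &&
    decide (h.getD (2 * d + 1) false =
      (h.getD (2 * d) false || (!b && h'.getD (2 * d + 1) false)))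

/-- The table `h` is fair for the formula with code `d`. -/
def tableauFair (h : List Bool) (d : ℕ) : Bool :=
  bif decide (d % 8 = 5) then !h.getD (2 * d) false || h.getD (2 * (d / 8).unpair.2) false
  else bif decide (d % 8 = 6) then h.getD (2 * d) false || !h.getD (2 * (d / 8).unpair.2) false
  else true

/-- The expansion law leaves one other possibility: `u` stays true forever while `B` never holds.
The recurring condition `u v → B v` excludes it. -/
theorem until_unique {u A B : ℕ → Prop} (h : ∀ i, u i ↔ B i ∨ (A i ∧ u (i + 1)))
    (hf : ∀ t, ∃ v, t ≤ v ∧ (u v → B v)) (i : ℕ) :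
    u i ↔ ∃ j, B (i + j) ∧ ∀ n < j, A (i + n) := by
  constructor
  · intro hu
    by_contra! hcon
    have key : ∀ d, u (i + d) ∧ ∀ n < d, A (i + n) := by
      intro d
      induction d with
      | zero => exact ⟨hu, fun n hn => absurd hn (Nat.not_lt_zero _)⟩
      | succ d ih =>
        rcases (h _).1 ih.1 with hB | ⟨hA, hu'⟩
        · obtain ⟨n, hn, hA⟩ := hcon d hB
          exact absurd (ih.2 n hn) hA
        · refine ⟨hu', fun n hn => ?_⟩
          rcases Nat.lt_succ_iff_lt_or_eq.1 hn with hn | rfl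
          · exact ih.2 n hn
          · exact hA
    obtain ⟨v, hv, hB⟩ := hf i
    obtain ⟨d, rfl⟩ : ∃ d, v = i + d := ⟨v - i, by omega⟩
    obtain ⟨n, hn, hA⟩ := hcon d (hB (key d).1)
    exact hA ((key d).2 n hn)
  · rintro ⟨j, hB, hA⟩
    induction j generalizing i with
    | zero => exact (h i).2 (Or.inl hB)
    | succ j ih =>
      refine (h i).2 (Or.inr ⟨hA 0 j.succ_pos, ih (i + 1) ?_ fun n hn => ?_⟩)
      · convert hB using 1; omega
      · convert hA (n + 1) (by omega) using 1; omega

theorem until_iff {A B : ℕ → Prop} (i : ℕ) : (∃ j, B (i + j) ∧ ∀ n < j, A (i + n)) ↔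
    B i ∨ (A i ∧ ∃ j, B (i + 1 + j) ∧ ∀ n < j, A (i + 1 + n)) := by
  constructor
  · rintro ⟨_ | j, hB, hA⟩
    · exact Or.inl hB
    · refine Or.inr ⟨hA 0 j.succ_pos, j, ?_, fun n hn => ?_⟩
      · convert hB using 1; omega
      · convert hA (n + 1) (by omega) using 1; omega
  · rintro (hB | ⟨hA, j, hB, hj⟩)
    · exact ⟨0, hB, fun n hn => absurd hn (Nat.not_lt_zero _)⟩
    · refine ⟨j + 1, ?_, fun n hn => ?_⟩
      · convert hB using 1; omega
      · rcases n with _ | n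
        · exact hA
        · convert hj n (by omega) using 1; omega

theorem release_iff {A B : ℕ → Prop} (i : ℕ) : (∀ j, B (i + j) ∨ ∃ n < j, A (i + n)) ↔
    B i ∧ (A i ∨ ∀ j, B (i + 1 + j) ∨ ∃ n < j, A (i + 1 + n)) := by
  have := until_iff (A := fun i => ¬ A i) (B := fun i => ¬ B i) i
  rw [← not_iff_not, not_and_or]
  push Not
  exact this

/-- Dual to `until_unique` by negating all three predicates. -/
theorem release_unique {u A B : ℕ → Prop} (h : ∀ i, u i ↔ B i ∧ (A i ∨ u (i + 1)))
    (hf : ∀ t, ∃ v, t ≤ v ∧ (B v → u v)) (i : ℕ) :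
    u i ↔ ∀ j, B (i + j) ∨ ∃ n < j, A (i + n) := by
  have := until_unique (u := fun i => ¬ u i) (A := fun i => ¬ A i) (B := fun i => ¬ B i)
    (fun i => by rw [h]; tauto) (fun t => by
      obtain ⟨v, hv, hB⟩ := hf t
      exact ⟨v, hv, by tauto⟩) i
  rw [← not_iff_not, this]
  push Not
  rfl

theorem beforeMark_iff {B m : ℕ → Prop} (i : ℕ) :
    BeforeMark B m i ↔ B i ∨ (¬ m (i + 1) ∧ BeforeMark B m (i + 1)) :=
  until_iff (A := fun i => ¬ m (i + 1)) i

/-- No separate fairness condition is needed: just before a mark the expansion law itself forces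
`B`, and marks recur. -/
theorem beforeMark_unique {u B m : ℕ → Prop} (h : ∀ i, u i ↔ B i ∨ (¬ m (i + 1) ∧ u (i + 1)))
    (hm : ∀ t, ∃ v, t ≤ v ∧ m v) (i : ℕ) : u i ↔ BeforeMark B m i := by
  refine until_unique (A := fun i => ¬ m (i + 1)) h (fun t => ?_) i
  obtain ⟨v, hv, hmv⟩ := hm (t + 1)
  obtain ⟨v, rfl⟩ : ∃ v', v = v' + 1 := ⟨v - 1, by omega⟩
  refine ⟨v, by omega, fun hu => ?_⟩
  rcases (h v).1 hu with hB | ⟨hn, -⟩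
  · exact hB
  · exact absurd hmv hn

/-- Splitting at the first mark after `i`: either `B` holds before it, or from it on `B` holds
before the following mark. This turns a condition on two marks into nested conditions on one. -/
theorem atMostOne_iff {B m : ℕ → Prop} (i : ℕ) :
    (∃ j, B (i + j) ∧ AtMostOne m i (i + j)) ↔
      BeforeMark (fun i => B i ∨ (m (i + 1) ∧ BeforeMark B m (i + 1))) m i := by
  constructor
  · rintro ⟨j, hB, hj⟩
    by_cases h : ∃ n < j, m (i + n + 1)
    · classical
      have h1 := Nat.find_spec h
      have h2 := fun n => Nat.find_min (H := h) (m := n)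
      refine ⟨Nat.find h, Or.inr ⟨h1.2, j - Nat.find h - 1, ?_, fun n hn hm => ?_⟩, fun n hn hm =>
        h2 n hn ⟨by omega, hm⟩⟩
      · convert hB using 1; omega
      · exact hj _ _ (by omega) (by omega) (by omega) h1.2 hm
    · push Not at h
      exact ⟨j, Or.inl hB, h⟩
  · rintro ⟨j, hB | ⟨hm, j', hB, hj'⟩, hj⟩
    · refine ⟨j, hB, fun a b h1 h2 h3 ha _ => hj (a - i - 1) (by omega) ?_⟩
      convert ha using 1; omega
    · refine ⟨j + 1 + j', by convert hB using 1; omega, fun a b h1 h2 h3 ha hb => ?_⟩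
      by_cases h4 : a < i + j + 1
      · refine hj (a - i - 1) (by omega) ?_
        convert ha using 1; omega
      · refine hj' (b - (i + j + 1) - 1) (by omega) ?_
        convert hb using 1; omega

theorem prompt_iff {B m : ℕ → Prop} (i : ℕ) :
    (∃ j, B (i + j) ∧ AtMostOne m i (i + j)) ↔
      B i ∨ (m (i + 1) ∧ BeforeMark B m (i + 1)) ∨
        (¬ m (i + 1) ∧ ∃ j, B (i + 1 + j) ∧ AtMostOne m (i + 1) (i + 1 + j)) := by
  rw [atMostOne_iff, atMostOne_iff, beforeMark_iff, or_assoc]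

theorem prompt_unique {u B m : ℕ → Prop}
    (h : ∀ i, u i ↔ B i ∨ (m (i + 1) ∧ BeforeMark B m (i + 1)) ∨ (¬ m (i + 1) ∧ u (i + 1)))
    (hm : ∀ t, ∃ v, t ≤ v ∧ m v) (i : ℕ) :
    u i ↔ ∃ j, B (i + j) ∧ AtMostOne m i (i + j) := by
  rw [atMostOne_iff]
  exact beforeMark_unique (fun i => by rw [h, or_assoc]) hm i

end PromptSynthesis

namespace PromptSynthesis

/-- Strong induction on the code: subformulas have smaller codes, and each temporal operator is the
unique fair solution of its expansion law. Until and release use `tableauFair`; prompt operators use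
only that marks recur. -/
theorem codeSat_of_tableau {c : ℕ} {x h : ℕ → List Bool} {m : ℕ → Bool}
    (hstep : ∀ i, tableauStep c (x i) (h i) (h (i + 1)) (m (i + 1)) = true)
    (hm : ∀ t, ∃ u, t ≤ u ∧ m u = true)
    (hfair : ∀ d < c, ∀ t, ∃ u, t ≤ u ∧ tableauFair (h u) d = true) {d : ℕ} (hd : d < c) (i : ℕ) :
    (h i).getD (2 * d) false = true ↔
      CodeSat (fun i e => (x i).getD e false = true) (fun i => m i = true) d i := by
  have hs : ∀ d < c, ∀ i, (h i).getD (2 * d) false =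
      tableauValue (x i) (h i) (h (i + 1)) (m (i + 1)) d ∧ (h i).getD (2 * d + 1) false =
      ((h i).getD (2 * d) false || (!m (i + 1) && (h (i + 1)).getD (2 * d + 1) false)) := by
    intro d hd i
    have := hstep i
    simp only [tableauStep, List.all_eq_true, List.mem_range, Bool.and_eq_true,
      decide_eq_true_eq] at this
    exact this d hd
  have hbefore : ∀ d < c, ∀ i, (h i).getD (2 * d + 1) false = true ↔
      BeforeMark (fun i => (h i).getD (2 * d) false = true) (fun i => m i = true) i := by
    intro d hd
    refine beforeMark_unique (fun i => ?_) hm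
    rw [(hs d hd i).2]
    simp
  induction d using Nat.strong_induction_on generalizing i with
  | _ d ih =>
    have h1 := Nat.unpair_left_le (d / 8)
    have h2 := Nat.unpair_right_le (d / 8)
    have hv := fun i => (hs d hd i).1
    have hf := hfair d hd
    rw [CodeSat]
    have h8 : d % 8 < 8 := Nat.mod_lt _ (by norm_num)
    generalize hk : d % 8 = k at h8
    interval_cases k
    · rw [hv]; simp [tableauValue, hk]
    · rw [hv]; simp [tableauValue, hk]
    · have ha := ih _ (show (d / 8).unpair.1 < d by omega) (by omega) i
      have hb := ih _ (show (d / 8).unpair.2 < d by omega) (by omega) i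
      rw [hv, if_neg (by omega), if_neg (by omega), if_pos rfl]
      simp only [← ha, ← hb]
      simp [tableauValue, hk]
    · have ha := ih _ (show (d / 8).unpair.1 < d by omega) (by omega) i
      have hb := ih _ (show (d / 8).unpair.2 < d by omega) (by omega) i
      rw [hv, if_neg (by omega), if_neg (by omega), if_neg (by omega), if_pos rfl]
      simp only [← ha, ← hb]
      simp [tableauValue, hk]
    · have ha := ih _ (show d / 8 < d by omega) (by omega) (i + 1)
      rw [hv, if_neg (by omega), if_neg (by omega), if_neg (by omega), if_neg (by omega),
        if_pos rfl]
      simp only [← ha]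
      simp [tableauValue, hk]
    · have ha := fun i => ih _ (show (d / 8).unpair.1 < d by omega) (by omega) i
      have hb := fun i => ih _ (show (d / 8).unpair.2 < d by omega) (by omega) i
      rw [if_neg (by omega), if_neg (by omega), if_neg (by omega), if_neg (by omega),
        if_neg (by omega), if_pos rfl]
      simp only [← ha, ← hb]
      refine until_unique (u := fun i => (h i).getD (2 * d) false = true)
        (B := fun i => (h i).getD (2 * (d / 8).unpair.2) false = true)
        (A := fun i => (h i).getD (2 * (d / 8).unpair.1) false = true) (fun i => ?_) (fun t => ?_) i
      · rw [hv]; simp [tableauValue, hk]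
      · obtain ⟨u, hu, hu'⟩ := hf t
        refine ⟨u, hu, fun h3 => ?_⟩
        simpa [tableauFair, hk, -List.getD_eq_getElem?_getD, h3] using hu'
    · have ha := fun i => ih _ (show (d / 8).unpair.1 < d by omega) (by omega) i
      have hb := fun i => ih _ (show (d / 8).unpair.2 < d by omega) (by omega) i
      rw [if_neg (by omega), if_neg (by omega), if_neg (by omega), if_neg (by omega),
        if_neg (by omega), if_neg (by omega), if_pos rfl]
      simp only [← ha, ← hb]
      refine release_unique (u := fun i => (h i).getD (2 * d) false = true)
        (B := fun i => (h i).getD (2 * (d / 8).unpair.2) false = true)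
        (A := fun i => (h i).getD (2 * (d / 8).unpair.1) false = true) (fun i => ?_) (fun t => ?_) i
      · rw [hv]; simp [tableauValue, hk]
      · obtain ⟨u, hu, hu'⟩ := hf t
        refine ⟨u, hu, fun h3 => ?_⟩
        simpa [tableauFair, hk, -List.getD_eq_getElem?_getD, h3] using hu'
    · have ha := fun i => ih _ (show d / 8 < d by omega) (by omega) i
      rw [if_neg (by omega), if_neg (by omega), if_neg (by omega), if_neg (by omega),
        if_neg (by omega), if_neg (by omega), if_neg (by omega)]
      simp only [← ha]
      refine prompt_unique (u := fun i => (h i).getD (2 * d) false = true)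
        (B := fun i => (h i).getD (2 * (d / 8)) false = true) (fun i => ?_) hm i
      rw [hv, ← hbefore (d / 8) (by omega)]
      cases hmi : m (i + 1) <;> simp [tableauValue, hk]

open Classical in
/-- The table of a word with marks at position `i`. -/
noncomputable def wordTable (c : ℕ) (x : ℕ → ℕ → Prop) (m : ℕ → Prop) (i : ℕ) : List Bool :=
  (List.range (2 * c)).map fun e =>
    if e % 2 = 0 then decide (CodeSat x m (e / 2) i)
    else decide (BeforeMark (CodeSat x m (e / 2)) m i)

section WordTable

variable {c : ℕ} {x : ℕ → ℕ → Prop} {m : ℕ → Prop}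

theorem getD_wordTable {d : ℕ} (hd : d < c) (i : ℕ) :
    (wordTable c x m i).getD (2 * d) false = true ↔ CodeSat x m d i := by
  classical
  rw [wordTable, getD_map_range (by omega), if_pos (by omega), decide_eq_true_eq,
    Nat.mul_div_cancel_left _ two_pos]

theorem getD_wordTable_before {d : ℕ} (hd : d < c) (i : ℕ) :
    (wordTable c x m i).getD (2 * d + 1) false = true ↔ BeforeMark (CodeSat x m d) m i := by
  classical
  rw [wordTable, getD_map_range (by omega), if_neg (by omega), decide_eq_true_eq,
    show (2 * d + 1) / 2 = d by omega]

/-- A true until can wait for its right argument, and a false release for a failure of its right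
argument; otherwise the condition holds at once. -/
theorem tableauFair_wordTable {d : ℕ} (hd : d < c) (t : ℕ) :
    ∃ u, t ≤ u ∧ tableauFair (wordTable c x m u) d = true := by
  have h2 := Nat.unpair_right_le (d / 8)
  by_cases h5 : d % 8 = 5
  · by_cases h : CodeSat x m d t
    · have h' := h
      rw [CodeSat] at h'
      simp only [h5, Nat.reduceEqDiff, if_false, if_true, OfNat.ofNat_ne_zero,
        OfNat.ofNat_ne_one] at h'
      obtain ⟨j, hj, -⟩ := h'
      refine ⟨t + j, by omega, ?_⟩
      have := (getD_wordTable (c := c) (d := (d / 8).unpair.2) (by omega) _).2 hj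
      simp only [tableauFair, h5, decide_true, cond_true, this, Bool.or_true]
    · refine ⟨t, le_rfl, ?_⟩
      rw [← getD_wordTable hd, Bool.not_eq_true] at h
      simp only [tableauFair, h5, decide_true, cond_true, h, Bool.not_false, Bool.true_or]
  by_cases h6 : d % 8 = 6
  · by_cases h : CodeSat x m d t
    · refine ⟨t, le_rfl, ?_⟩
      rw [← getD_wordTable hd] at h
      simp [tableauFair, h6, h, -List.getD_eq_getElem?_getD]
    · have h' := h
      rw [CodeSat] at h'
      simp only [h6, Nat.reduceEqDiff, if_false, if_true, OfNat.ofNat_ne_zero,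
        OfNat.ofNat_ne_one, not_forall, not_or] at h'
      obtain ⟨j, hj, -⟩ := h'
      refine ⟨t + j, by omega, ?_⟩
      rw [← getD_wordTable (c := c) (by omega), Bool.not_eq_true] at hj
      simp [tableauFair, h6, hj, -List.getD_eq_getElem?_getD]
  · exact ⟨t, le_rfl, by simp [tableauFair, h5, h6]⟩

theorem tableauStep_wordTable {l : List Bool} {i : ℕ} {b : Bool}
    (hl : ∀ e, l.getD e false = true ↔ x i e) (hb : b = true ↔ m (i + 1)) :
    tableauStep c l (wordTable c x m i) (wordTable c x m (i + 1)) b = true := by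
  simp only [tableauStep, List.all_eq_true, List.mem_range, Bool.and_eq_true, decide_eq_true_eq]
  intro d hd
  have h1 := Nat.unpair_left_le (d / 8)
  have h2 := Nat.unpair_right_le (d / 8)
  constructor
  · rw [Bool.eq_iff_iff, getD_wordTable hd, CodeSat]
    have hval : ∀ {e}, e < c → ∀ i, _ := fun {e} he => getD_wordTable (x := x) (m := m) he
    have hbef := getD_wordTable_before (c := c) (x := x) (m := m) (d := d / 8) (by omega) (i + 1)
    have h8 : d % 8 < 8 := Nat.mod_lt _ (by norm_num)
    have ha := hval (e := (d / 8).unpair.1) (by omega) i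
    have hb' := hval (e := (d / 8).unpair.2) (by omega) i
    have hc := hval (e := d / 8) (by omega)
    have hd' := hval hd (i + 1)
    rw [CodeSat] at hd'
    generalize hk : d % 8 = k at h8 hd'
    interval_cases k
    · simp [tableauValue, hk, ← hl]
    · simp [tableauValue, hk, ← hl]
    · simp [tableauValue, hk, ha, hb', -List.getD_eq_getElem?_getD]
    · simp [tableauValue, hk, ha, hb', -List.getD_eq_getElem?_getD]
    · simp [tableauValue, hk, hc, -List.getD_eq_getElem?_getD]
    · simp only [Nat.reduceEqDiff, if_false, OfNat.ofNat_ne_zero, OfNat.ofNat_ne_one,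
        if_true] at hd' ⊢
      rw [until_iff]
      simp [tableauValue, hk, ha, hb', hd', -List.getD_eq_getElem?_getD]
    · simp only [Nat.reduceEqDiff, if_false, OfNat.ofNat_ne_zero, OfNat.ofNat_ne_one,
        if_true] at hd' ⊢
      rw [release_iff]
      simp [tableauValue, hk, ha, hb', hd', -List.getD_eq_getElem?_getD]
    · simp only [Nat.reduceEqDiff, if_false, OfNat.ofNat_ne_zero, OfNat.ofNat_ne_one] at hd' ⊢
      rw [prompt_iff]
      cases b <;>
      simp [tableauValue, hk, hc, hbef, hd', ← hb, -List.getD_eq_getElem?_getD]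
  · rw [Bool.eq_iff_iff, getD_wordTable_before hd, Bool.or_eq_true, Bool.and_eq_true,
      getD_wordTable hd, getD_wordTable_before hd, beforeMark_iff, ← hb]
    simp

end WordTable

end PromptSynthesis

namespace PromptSynthesis

/-! ### The constraint system of an instance -/

/-- The type of the data that describe an instance. -/
abbrev Data : Type := (ℕ × ℕ) × (List ℕ × List ℕ) × List (ℕ × List ℕ × List ℕ)

namespace Data

/-- The number of system processes. -/
def procs (D : Data) : ℕ := D.2.2.length

/-- The number of states of process `p`. -/
def bnd (D : Data) (p : ℕ) : ℕ := (D.2.2.getD p (0, [], [])).1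

/-- The inputs of process `p`. -/
def ins (D : Data) (p : ℕ) : List ℕ := (D.2.2.getD p (0, [], [])).2.1

/-- The outputs of process `p`. -/
def outs (D : Data) (p : ℕ) : List ℕ := (D.2.2.getD p (0, [], [])).2.2

/-- The codes of all variables of the asynchronous architecture. -/
def varCodes (D : Data) : List ℕ :=
  D.2.1.2.map (fun v => 2 * v) ++ ((List.range D.procs).map (fun p => 2 * p + 1) ++
    (List.range D.procs).flatMap fun p => (D.outs p).map fun v => 2 * v)

/-- A strict upper bound of the codes of the variables. -/
def width (D : Data) : ℕ := D.varCodes.foldr (fun v m => v + m + 1) 0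

/-- A strict upper bound of the codes of the formulas. -/
def codeBound (D : Data) : ℕ := D.1.1 + D.1.2 + 1

/-- A strict upper bound of the states of all processes. -/
def maxStates (D : Data) : ℕ := (List.range D.procs).foldr (fun p m => D.bnd p + m) 0

end Data

/-- A vertex of the tableau graph: the states of the processes, the letter, and, for both formulas,
the mark and the table of truth values. -/
abbrev BaseNode : Type := List ℕ × List Bool × (Bool × List Bool) × (Bool × List Bool)

namespace BaseNode

def state (q : BaseNode) (p : ℕ) : ℕ := q.1.getD p 0

def letter (q : BaseNode) (e : ℕ) : Bool := q.2.1.getD e false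

/-- The mark for the assumption. -/
def markA (q : BaseNode) : Bool := q.2.2.1.1

def tableA (q : BaseNode) : List Bool := q.2.2.1.2

/-- The mark for the guarantee. -/
def markG (q : BaseNode) : Bool := q.2.2.2.1

def tableG (q : BaseNode) : List Bool := q.2.2.2.2

/-- The valuation of the inputs of process `p`. -/
def key (D : Data) (q : BaseNode) (p : ℕ) : List Bool := (D.ins p).map fun v => q.letter (2 * v)

end BaseNode

/-- A vertex of the pumping graph. -/
abbrev PumpNode : Type := BaseNode × ℕ × BaseNode

namespace Data

/-- One common bound `maxStates` is used for all processes, so states may exceed the bound of their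
own process. Paths from valid initial states never do. -/
def baseNodes (D : Data) : List BaseNode :=
  (tuples (List.range D.maxStates) D.procs).flatMap fun t =>
    (tuples [false, true] D.width).flatMap fun x =>
      [false, true].flatMap fun r => (tuples [false, true] (2 * D.codeBound)).flatMap fun h =>
        [false, true].flatMap fun s => (tuples [false, true] (2 * D.codeBound)).map fun g =>
          (t, x, (r, h), (s, g))

def pumpNodes (D : Data) : List PumpNode :=
  D.baseNodes.flatMap fun q => (List.range 3).flatMap fun a => D.baseNodes.map fun z => (q, a, z)

/-- The conditions on an edge that do not depend on the implementations. -/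
def staticEdge (D : Data) (q q' : BaseNode) : Bool :=
  ((List.range D.width).all fun e => !q.letter e || D.varCodes.any fun v => decide (v = e)) &&
  (tableauStep D.codeBound q.2.1 q.tableA q'.tableA q'.markA &&
  (tableauStep D.codeBound q.2.1 q.tableG q'.tableG q'.markG &&
  (List.range D.procs).all fun p => q.letter (2 * p + 1) || decide (q'.state p = q.state p)))

def pumpStep (N N' : PumpNode) : Bool :=
  bif N'.1.markG then decide (N.2.1 = 2) && decide (N'.2.1 = 0)
  else decide (N'.2 = N.2) ||
    (decide (N.2.1 = 0) && decide (N'.2 = (1, N'.1)) && N'.1.markA ||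
      decide (N.2.1 = 1) && decide (N'.2 = (2, N.2.2)) && decide (N'.1 = N.2.2))

/-- The table entries encode a violation: the assumption is true and the guarantee false at the
first position. -/
def pumpInit (D : Data) (N : PumpNode) : Bool :=
  decide (N.2.1 = 0) && (N.1.tableA.getD (2 * D.1.1) false && !N.1.tableG.getD (2 * D.1.2) false)

/-- The fairness condition with index `j`. -/
def fairBit (q : BaseNode) (j : ℕ) : Bool :=
  bif decide (j % 4 = 0) then q.markA
  else bif decide (j % 4 = 1) then q.markG
  else bif decide (j % 4 = 2) then tableauFair q.tableA (j / 4)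
  else tableauFair q.tableG (j / 4)

/-- The number of fairness conditions. -/
def fairCount (D : Data) : ℕ := 4 * D.codeBound

/-- The literal that states that the Boolean constant with number `e` and kind `k` is true. -/
def boolLit (k e : ℕ) : Lit := (false, Nat.pair k e, Nat.pair 0 0)

/-- Process `p` moves from state `i` to state `j` on reading `x`. -/
def stepLit (p i : ℕ) (x : List Bool) (j : ℕ) : Lit := boolLit 1 (Encodable.encode (p, i, x, j))

/-- In state `i` process `p` sets the variable `v`. -/
def labLit (p i v : ℕ) : Lit := boolLit 2 (Encodable.encode (p, i, v))

/-- The initial state of process `p` is `i`. -/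
def initLit (p i : ℕ) : Lit := boolLit 3 (Encodable.encode (p, i))

/-- The vertex `N` is reachable. -/
def reachLit (N : PumpNode) : Lit := boolLit 4 (Encodable.encode N)

/-- The strongly connected component of `N` misses the fairness condition `j`. -/
def missLit (N : PumpNode) (j : ℕ) : Lit := boolLit 5 (Encodable.encode (N, j))

/-- The rank of `N` is at most the rank of `N'`. -/
def rankLit (N N' : PumpNode) : Lit :=
  (true, Nat.pair 6 (Encodable.encode N), Nat.pair 6 (Encodable.encode N'))

/-- The premises under which an edge from `q` to `q'` exists. -/
def edgeHyps (D : Data) (q q' : BaseNode) : List Lit :=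
  (List.range D.procs).flatMap fun p =>
    (bif q.letter (2 * p + 1) then [stepLit p (q.state p) (q.key D p) (q'.state p)] else []) ++
      ((D.outs p).filter fun v => q.letter (2 * v)).map fun v => labLit p (q.state p) v

/-- The alternatives to the existence of an edge from `q`. -/
def edgeAlts (D : Data) (q : BaseNode) : List Lit :=
  (List.range D.procs).flatMap fun p =>
    ((D.outs p).filter fun v => !q.letter (2 * v)).map fun v => labLit p (q.state p) v

/-- In order: reachability propagates, the rank does not increase, and a missed condition stays
missed unless the rank drops strictly. If the target satisfies condition `j`, the last conclusion
loses its `missLit`, so missing `j` forces a strict drop. -/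
def edgeSequents (D : Data) (N N' : PumpNode) : List Sequent :=
  (reachLit N :: D.edgeHyps N.1 N'.1, reachLit N' :: D.edgeAlts N.1) ::
  (reachLit N :: D.edgeHyps N.1 N'.1, rankLit N' N :: D.edgeAlts N.1) ::
  (List.range D.fairCount).map fun j =>
    (missLit N j :: rankLit N N' :: reachLit N :: D.edgeHyps N.1 N'.1,
      (bif fairBit N'.1 j then [] else [missLit N' j]) ++ D.edgeAlts N.1)

/-- Only the existence of a value is demanded, here and in `stepSequents`. Uniqueness is
unnecessary: further true literals only activate more clauses, and one value can be selected
afterwards. -/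
def initSequents (D : Data) : List Sequent :=
  (List.range D.procs).map fun p => ([], (List.range (D.bnd p)).map fun i => initLit p i)

def stepSequents (D : Data) : List Sequent :=
  (List.range D.procs).flatMap fun p => (List.range (D.bnd p)).flatMap fun i =>
    (tuples [false, true] (D.ins p).length).map fun x =>
      ([], (List.range (D.bnd p)).map fun j => stepLit p i x j)

def startSequents (D : Data) : List Sequent :=
  (D.pumpNodes.filter fun N => D.pumpInit N).map fun N =>
    ((List.range D.procs).map fun p => initLit p (N.1.state p), [reachLit N])

def missSequents (D : Data) : List Sequent :=
  D.pumpNodes.map fun N => ([reachLit N], (List.range D.fairCount).map fun j => missLit N j)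

def graphSequents (D : Data) : List Sequent :=
  D.pumpNodes.flatMap fun N =>
    (D.pumpNodes.filter fun N' => D.staticEdge N.1 N'.1 && pumpStep N N').flatMap fun N' =>
      D.edgeSequents N N'

/-- The sequents of the constraint system. -/
def sequents (D : Data) : List Sequent :=
  D.initSequents ++ (D.stepSequents ++ (D.startSequents ++ (D.missSequents ++ D.graphSequents)))

end Data

/-! ### Computability of the construction -/

namespace PR

variable {α : Type} [Primcodable α] {D : α → Data} {p i j c : α → ℕ} {q q' : α → BaseNode}
  {N N' : α → PumpNode} {x h h' : α → List Bool} {b : α → Bool}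

@[fun_prop] theorem procs (hD : Primrec D) : Primrec fun a => (D a).procs := by
  unfold Data.procs; fun_prop

@[fun_prop] theorem bnd (hD : Primrec D) (hp : Primrec p) : Primrec fun a => (D a).bnd (p a) := by
  unfold Data.bnd; fun_prop

@[fun_prop] theorem ins (hD : Primrec D) (hp : Primrec p) : Primrec fun a => (D a).ins (p a) := by
  unfold Data.ins; fun_prop

@[fun_prop] theorem outs (hD : Primrec D) (hp : Primrec p) :
    Primrec fun a => (D a).outs (p a) := by
  unfold Data.outs; fun_prop

@[fun_prop] theorem varCodes (hD : Primrec D) : Primrec fun a => (D a).varCodes := by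
  unfold Data.varCodes; fun_prop

@[fun_prop] theorem width (hD : Primrec D) : Primrec fun a => (D a).width := by
  unfold Data.width; fun_prop

@[fun_prop] theorem codeBound (hD : Primrec D) : Primrec fun a => (D a).codeBound := by
  unfold Data.codeBound; fun_prop

@[fun_prop] theorem maxStates (hD : Primrec D) : Primrec fun a => (D a).maxStates := by
  unfold Data.maxStates; fun_prop

@[fun_prop] theorem state (hq : Primrec q) (hp : Primrec p) :
    Primrec fun a => (q a).state (p a) := by
  unfold BaseNode.state; fun_prop

@[fun_prop] theorem letter (hq : Primrec q) (hp : Primrec p) :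
    Primrec fun a => (q a).letter (p a) := by
  unfold BaseNode.letter; fun_prop

@[fun_prop] theorem markA (hq : Primrec q) : Primrec fun a => (q a).markA := by
  unfold BaseNode.markA; fun_prop

@[fun_prop] theorem markG (hq : Primrec q) : Primrec fun a => (q a).markG := by
  unfold BaseNode.markG; fun_prop

@[fun_prop] theorem tableA (hq : Primrec q) : Primrec fun a => (q a).tableA := by
  unfold BaseNode.tableA; fun_prop

@[fun_prop] theorem tableG (hq : Primrec q) : Primrec fun a => (q a).tableG := by
  unfold BaseNode.tableG; fun_prop

@[fun_prop] theorem key (hD : Primrec D) (hq : Primrec q) (hp : Primrec p) :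
    Primrec fun a => (q a).key (D a) (p a) := by
  unfold BaseNode.key; fun_prop

@[fun_prop] theorem baseNodes (hD : Primrec D) : Primrec fun a => (D a).baseNodes := by
  unfold Data.baseNodes; fun_prop

@[fun_prop] theorem pumpNodes (hD : Primrec D) : Primrec fun a => (D a).pumpNodes := by
  unfold Data.pumpNodes; fun_prop

@[fun_prop] theorem tableauValue (hx : Primrec x) (hh : Primrec h) (hh' : Primrec h')
    (hb : Primrec b) (hi : Primrec i) :
    Primrec fun a => tableauValue (x a) (h a) (h' a) (b a) (i a) := by
  unfold PromptSynthesis.tableauValue; fun_prop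

@[fun_prop] theorem tableauStep (hc : Primrec c) (hx : Primrec x) (hh : Primrec h)
    (hh' : Primrec h') (hb : Primrec b) :
    Primrec fun a => tableauStep (c a) (x a) (h a) (h' a) (b a) := by
  unfold PromptSynthesis.tableauStep; fun_prop

@[fun_prop] theorem tableauFair (hh : Primrec h) (hi : Primrec i) :
    Primrec fun a => tableauFair (h a) (i a) := by
  unfold PromptSynthesis.tableauFair; fun_prop

@[fun_prop] theorem staticEdge (hD : Primrec D) (hq : Primrec q) (hq' : Primrec q') :
    Primrec fun a => (D a).staticEdge (q a) (q' a) := by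
  unfold Data.staticEdge; fun_prop

@[fun_prop] theorem pumpStep (hN : Primrec N) (hN' : Primrec N') :
    Primrec fun a => Data.pumpStep (N a) (N' a) := by
  unfold Data.pumpStep; fun_prop

@[fun_prop] theorem pumpInit (hD : Primrec D) (hN : Primrec N) :
    Primrec fun a => (D a).pumpInit (N a) := by
  unfold Data.pumpInit; fun_prop

@[fun_prop] theorem fairBit (hq : Primrec q) (hj : Primrec j) :
    Primrec fun a => Data.fairBit (q a) (j a) := by
  unfold Data.fairBit; fun_prop

@[fun_prop] theorem fairCount (hD : Primrec D) : Primrec fun a => (D a).fairCount := by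
  unfold Data.fairCount; fun_prop

@[fun_prop] theorem stepLit (hp : Primrec p) (hi : Primrec i) (hx : Primrec x) (hj : Primrec j) :
    Primrec fun a => Data.stepLit (p a) (i a) (x a) (j a) := by
  unfold Data.stepLit Data.boolLit; fun_prop

@[fun_prop] theorem labLit (hp : Primrec p) (hi : Primrec i) (hj : Primrec j) :
    Primrec fun a => Data.labLit (p a) (i a) (j a) := by
  unfold Data.labLit Data.boolLit; fun_prop

@[fun_prop] theorem initLit (hp : Primrec p) (hi : Primrec i) :
    Primrec fun a => Data.initLit (p a) (i a) := by
  unfold Data.initLit Data.boolLit; fun_prop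

@[fun_prop] theorem reachLit (hN : Primrec N) : Primrec fun a => Data.reachLit (N a) := by
  unfold Data.reachLit Data.boolLit; fun_prop

@[fun_prop] theorem missLit (hN : Primrec N) (hj : Primrec j) :
    Primrec fun a => Data.missLit (N a) (j a) := by
  unfold Data.missLit Data.boolLit; fun_prop

@[fun_prop] theorem rankLit (hN : Primrec N) (hN' : Primrec N') :
    Primrec fun a => Data.rankLit (N a) (N' a) := by
  unfold Data.rankLit; fun_prop

@[fun_prop] theorem edgeHyps (hD : Primrec D) (hq : Primrec q) (hq' : Primrec q') :
    Primrec fun a => (D a).edgeHyps (q a) (q' a) := by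
  unfold Data.edgeHyps; fun_prop

@[fun_prop] theorem edgeAlts (hD : Primrec D) (hq : Primrec q) :
    Primrec fun a => (D a).edgeAlts (q a) := by
  unfold Data.edgeAlts; fun_prop

@[fun_prop] theorem edgeSequents (hD : Primrec D) (hN : Primrec N) (hN' : Primrec N') :
    Primrec fun a => (D a).edgeSequents (N a) (N' a) := by
  unfold Data.edgeSequents; fun_prop

theorem sequents : Primrec Data.sequents := by
  unfold Data.sequents Data.initSequents Data.stepSequents Data.startSequents Data.missSequents
    Data.graphSequents
  fun_prop

end PR

end PromptSynthesis

/-! ### Constraint systems and the absence of fair paths -/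

namespace PromptSynthesis

open Relation

/-- The transition and labeling functions of all system processes. -/
structure Table where
  init : ℕ → ℕ
  step : ℕ → ℕ → List Bool → ℕ
  lab : ℕ → ℕ → ℕ → Prop

namespace Data

/-- The states of the processes respect the bounds. -/
def Valid (D : Data) (T : Table) : Prop :=
  ∀ p < D.procs, T.init p < D.bnd p ∧
    ∀ i < D.bnd p, ∀ x, x.length = (D.ins p).length → T.step p i x < D.bnd p

/-- The implementations admit an edge from `q` to `q'`. -/
def DynamicEdge (D : Data) (T : Table) (q q' : BaseNode) : Prop :=
  ∀ p < D.procs,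
    (q.letter (2 * p + 1) = true → q'.state p = T.step p (q.state p) (q.key D p)) ∧
    ∀ v ∈ D.outs p, (q.letter (2 * v) = true ↔ T.lab p (q.state p) v)

/-- The finite type of vertices of the tableau graph. -/
abbrev Node (D : Data) : Type := {q : BaseNode // q ∈ D.baseNodes}

instance (D : Data) : Finite D.Node := D.baseNodes.finite_toSet

/-- The edges of the tableau graph. -/
def Edge (D : Data) (T : Table) (q q' : D.Node) : Prop :=
  D.staticEdge q.1 q'.1 = true ∧ D.DynamicEdge T q.1 q'.1

def MarkA (D : Data) (q : D.Node) : Prop := q.1.markA = true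

def MarkG (D : Data) (q : D.Node) : Prop := q.1.markG = true

/-- The code of a vertex of the pumping graph. -/
def toPumpNode (D : Data) (x : D.Node × Fin 3 × D.Node) : PumpNode := (x.1.1, x.2.1.val, x.2.2.1)

/-- The initial vertices of the pumping graph. -/
def Start (D : Data) (T : Table) (x : D.Node × Fin 3 × D.Node) : Prop :=
  D.pumpInit (D.toPumpNode x) = true ∧ ∀ p < D.procs, x.1.1.state p = T.init p

/-- There is a fair path in the pumping graph. -/
def HasFairPath (D : Data) (T : Table) : Prop :=
  ∃ π : ℕ → D.Node × Fin 3 × D.Node, D.Start T (π 0) ∧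
    (∀ t, PumpEdge (D.Edge T) D.MarkA D.MarkG (π t) (π (t + 1))) ∧
    ∀ j < D.fairCount, ∀ t, ∃ u, t ≤ u ∧ fairBit (π u).1.1 j = true

variable {D : Data} {T : Table}

theorem toPumpNode_injective : Function.Injective D.toPumpNode := by
  rintro ⟨q, a, z⟩ ⟨q', a', z'⟩ h
  simp only [toPumpNode, Prod.mk.injEq] at h
  rw [Prod.mk.injEq, Prod.mk.injEq]
  exact ⟨Subtype.ext h.1, Fin.ext h.2.1, Subtype.ext h.2.2⟩

theorem mem_pumpNodes {N : PumpNode} : N ∈ D.pumpNodes ↔ ∃ x, D.toPumpNode x = N := by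
  simp only [pumpNodes, List.mem_flatMap, List.mem_map, List.mem_range]
  constructor
  · rintro ⟨q, hq, a, ha, z, hz, rfl⟩
    exact ⟨(⟨q, hq⟩, ⟨a, ha⟩, ⟨z, hz⟩), rfl⟩
  · rintro ⟨x, rfl⟩
    exact ⟨x.1.1, x.1.2, x.2.1, x.2.1.2, x.2.2.1, x.2.2.2, rfl⟩

theorem pumpStep_iff {N N' : PumpNode} : pumpStep N N' = true ↔
    (N'.1.markG = true ∧ N.2.1 = 2 ∧ N'.2.1 = 0) ∨ (¬ N'.1.markG = true ∧ (N'.2 = N.2 ∨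
      (N.2.1 = 0 ∧ N'.2 = (1, N'.1) ∧ N'.1.markA = true) ∨
      (N.2.1 = 1 ∧ N'.2 = (2, N.2.2) ∧ N'.1 = N.2.2))) := by
  unfold pumpStep
  cases N'.1.markG
  · simp only [cond_false, Bool.or_eq_true, Bool.and_eq_true, decide_eq_true_eq, and_assoc,
      Bool.false_eq_true, false_and, not_false_eq_true, true_and, false_or]
  · simp only [cond_true, Bool.and_eq_true, decide_eq_true_eq, not_true_eq_false, false_and,
      or_false, true_and]

theorem pumpEdge_iff {x y : D.Node × Fin 3 × D.Node} :
    PumpEdge (D.Edge T) D.MarkA D.MarkG x y ↔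
      (D.staticEdge x.1.1 y.1.1 = true ∧ D.DynamicEdge T x.1.1 y.1.1) ∧
        pumpStep (D.toPumpNode x) (D.toPumpNode y) = true := by
  obtain ⟨q, a, z⟩ := x
  obtain ⟨q', a', z'⟩ := y
  refine and_congr Iff.rfl ?_
  have h0 : ∀ i : Fin 3, i = 0 ↔ i.val = 0 := fun _ => Fin.ext_iff
  have h1 : ∀ i : Fin 3, i = 1 ↔ i.val = 1 := fun _ => Fin.ext_iff
  have h2 : ∀ i : Fin 3, i = 2 ↔ i.val = 2 := fun _ => Fin.ext_iff
  simp only [pumpStep_iff, toPumpNode, MarkG, MarkA, Prod.mk.injEq, h0, h1, h2,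
    Fin.ext_iff (a := a') (b := a), Subtype.ext_iff]

section Sound

variable {M : Type} [LinearOrder M] {c : ℕ → M}

/-- Transitions are selected from the true literals. Along a fair path of the resulting table all
edge premises hold, so the clauses yield exactly the hypotheses of `not_fair_of_ranking`. -/
theorem exists_table_of_sequents (h : ∀ s ∈ D.sequents, Sequent.Holds c s) :
    ∃ T, D.Valid T ∧ ¬ D.HasFairPath T := by
  classical
  simp only [sequents, List.mem_append] at h
  have hinit : ∀ p < D.procs, ∃ i < D.bnd p, Lit.Holds c (initLit p i) := by
    intro p hp
    obtain ⟨a, ha, hc⟩ := h _ (Or.inl (List.mem_map.2 ⟨p, List.mem_range.2 hp, rfl⟩)) (by simp)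
    obtain ⟨i, hi, rfl⟩ := List.mem_map.1 ha
    exact ⟨i, List.mem_range.1 hi, hc⟩
  have hstep : ∀ p < D.procs, ∀ i < D.bnd p, ∀ x, x.length = (D.ins p).length →
      ∃ j < D.bnd p, Lit.Holds c (stepLit p i x j) := by
    intro p hp i hi x hx
    obtain ⟨a, ha, hc⟩ := h ([], (List.range (D.bnd p)).map fun j => stepLit p i x j)
      (Or.inr (Or.inl (List.mem_flatMap.2 ⟨p, List.mem_range.2 hp, List.mem_flatMap.2
        ⟨i, List.mem_range.2 hi, List.mem_map.2 ⟨x, mem_tuples.2 ⟨hx, by simp⟩, rfl⟩⟩⟩)))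
      (by simp)
    obtain ⟨j, hj, rfl⟩ := List.mem_map.1 ha
    exact ⟨j, List.mem_range.1 hj, hc⟩
  have hinit' : ∀ p, ∃ i, p < D.procs → i < D.bnd p ∧ Lit.Holds c (initLit p i) := fun p => by
    by_cases hp : p < D.procs
    · obtain ⟨i, hi⟩ := hinit p hp
      exact ⟨i, fun _ => hi⟩
    · exact ⟨0, fun h => absurd h hp⟩
  have hstep' : ∀ p i x, ∃ j, p < D.procs → i < D.bnd p → x.length = (D.ins p).length →
      j < D.bnd p ∧ Lit.Holds c (stepLit p i x j) := fun p i x => by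
    by_cases hp : p < D.procs ∧ i < D.bnd p ∧ x.length = (D.ins p).length
    · obtain ⟨j, hj⟩ := hstep p hp.1 i hp.2.1 x hp.2.2
      exact ⟨j, fun _ _ _ => hj⟩
    · exact ⟨0, fun h1 h2 h3 => absurd ⟨h1, h2, h3⟩ hp⟩
  choose ini hini using hinit'
  choose stp hstp using hstep'
  let T : Table := ⟨ini, stp, fun p i v => Lit.Holds c (labLit p i v)⟩
  refine ⟨T, fun p hp => ⟨(hini p hp).1, fun i hi x hx => (hstp p i x hp hi hx).1⟩, ?_⟩
  rintro ⟨π, ⟨hs1, hs2⟩, hedge, hfair⟩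
  have hmem : ∀ t, D.toPumpNode (π t) ∈ D.pumpNodes := fun t => mem_pumpNodes.2 ⟨_, rfl⟩
  -- The alternatives are negated label premises moved to the right of the sequent; on an actual
  -- edge they are all false.
  have halts : ∀ t, ∀ a ∈ D.edgeAlts (π t).1.1, ¬ Lit.Holds c a := by
    intro t a ha hc
    obtain ⟨⟨-, hdyn⟩, -⟩ := pumpEdge_iff.1 (hedge t)
    simp only [edgeAlts, List.mem_flatMap, List.mem_range, List.mem_map, List.mem_filter] at ha
    obtain ⟨p, hp, v, ⟨hv, hx⟩, rfl⟩ := ha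
    have := ((hdyn p hp).2 v hv).2 hc
    rw [this] at hx
    exact absurd hx (by decide)
  -- The transition clauses cover only states below the bound of the process, so the path must be
  -- shown to stay there.
  have hstate : ∀ t, ∀ p < D.procs, (π t).1.1.state p < D.bnd p := by
    intro t
    induction t with
    | zero => exact fun p hp => by rw [hs2 p hp]; exact (hini p hp).1
    | succ t ih =>
      intro p hp
      obtain ⟨⟨hst, hdyn⟩, -⟩ := pumpEdge_iff.1 (hedge t)
      cases hx : (π t).1.1.letter (2 * p + 1) with
      | true =>
        rw [(hdyn p hp).1 hx]
        exact (hstp p _ _ hp (ih p hp) (by simp [BaseNode.key])).1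
      | false =>
        simp only [staticEdge, Bool.and_eq_true, List.all_eq_true, List.mem_range] at hst
        have := hst.2.2.2 p hp
        rw [hx, Bool.false_or, decide_eq_true_eq] at this
        rw [this]
        exact ih p hp
  have hhyps : ∀ t, ∀ a ∈ D.edgeHyps (π t).1.1 (π (t + 1)).1.1, Lit.Holds c a := by
    intro t a ha
    obtain ⟨⟨-, hdyn⟩, -⟩ := pumpEdge_iff.1 (hedge t)
    simp only [edgeHyps, List.mem_flatMap, List.mem_range, List.mem_append, List.mem_map,
      List.mem_filter] at ha
    obtain ⟨p, hp, ha | ⟨v, ⟨hv, hx⟩, rfl⟩⟩ := ha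
    · cases hx : (π t).1.1.letter (2 * p + 1) with
      | true =>
        rw [hx, cond_true, List.mem_singleton] at ha
        rw [ha, (hdyn p hp).1 hx]
        exact (hstp p _ _ hp (hstate t p hp) (by simp [BaseNode.key])).2
      | false => simp [hx] at ha
    · exact ((hdyn p hp).2 v hv).1 hx
  have hgraph : ∀ t, ∀ s ∈ D.edgeSequents (D.toPumpNode (π t)) (D.toPumpNode (π (t + 1))),
      Sequent.Holds c s := by
    intro t s hs
    obtain ⟨⟨hst, -⟩, hp⟩ := pumpEdge_iff.1 (hedge t)
    refine h s (Or.inr (Or.inr (Or.inr (Or.inr (List.mem_flatMap.2 ⟨_, hmem t, List.mem_flatMap.2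
      ⟨_, List.mem_filter.2 ⟨hmem (t + 1), ?_⟩, hs⟩⟩)))))
    exact Bool.and_eq_true_iff.2 ⟨hst, hp⟩
  have hreach : ∀ t, Lit.Holds c (reachLit (D.toPumpNode (π t))) := by
    intro t
    induction t with
    | zero =>
      obtain ⟨a, ha, hc⟩ := h _ (Or.inr (Or.inr (Or.inl (List.mem_map.2
        ⟨_, List.mem_filter.2 ⟨hmem 0, hs1⟩, rfl⟩)))) (by
          intro a ha
          obtain ⟨p, hp, rfl⟩ := List.mem_map.1 ha
          have hp := List.mem_range.1 hp
          have h2 := hs2 p hp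
          have h3 := (hini p hp).2
          rw [show ini p = T.init p from rfl, ← h2] at h3
          exact h3)
      rw [List.mem_singleton] at ha
      exact ha ▸ hc
    | succ t ih =>
      obtain ⟨a, ha, hc⟩ := hgraph t _ (List.mem_cons_self ..) (by
        intro a ha
        rcases List.mem_cons.1 ha with rfl | ha
        · exact ih
        · exact hhyps t a ha)
      rcases List.mem_cons.1 ha with rfl | ha
      · exact hc
      · exact absurd hc (halts t a ha)
  refine not_fair_of_ranking (J := D.fairCount) (F := fun j x => fairBit x.1.1 j = true)
    (rank := fun x => c (Nat.pair 6 (Encodable.encode (D.toPumpNode x))))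
    (missed := fun x j => Lit.Holds c (missLit (D.toPumpNode x) j)) (π := π) ?_ ?_ ?_ hfair
  · intro t
    obtain ⟨a, ha, hc⟩ := hgraph t _ (List.mem_cons_of_mem _ (List.mem_cons_self ..)) (by
      intro a ha
      rcases List.mem_cons.1 ha with rfl | ha
      · exact hreach t
      · exact hhyps t a ha)
    rcases List.mem_cons.1 ha with rfl | ha
    · simpa [Lit.Holds, rankLit] using hc
    · exact absurd hc (halts t a ha)
  · intro t j hj hrank hmiss
    obtain ⟨a, ha, hc⟩ := hgraph t _ (List.mem_cons_of_mem _ (List.mem_cons_of_mem _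
      (List.mem_map.2 ⟨j, List.mem_range.2 hj, rfl⟩))) (by
      intro a ha
      rcases List.mem_cons.1 ha with rfl | ha
      · exact hmiss
      rcases List.mem_cons.1 ha with rfl | ha
      · simpa [Lit.Holds, rankLit] using hrank
      rcases List.mem_cons.1 ha with rfl | ha
      · exact hreach t
      · exact hhyps t a ha)
    rcases List.mem_append.1 ha with ha | ha
    · cases hF : fairBit (D.toPumpNode (π (t + 1))).1 j with
      | true => rw [hF] at ha; simp at ha
      | false =>
        rw [hF, cond_false, List.mem_singleton] at ha
        subst ha
        refine ⟨hc, fun h => ?_⟩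
        rw [show (π (t + 1)).1.1 = (D.toPumpNode (π (t + 1))).1 from rfl, hF] at h
        exact absurd h (by decide)
    · exact absurd hc (halts t a ha)
  · intro t
    obtain ⟨a, ha, hc⟩ := h _ (Or.inr (Or.inr (Or.inr (Or.inl (List.mem_map.2
      ⟨_, hmem t, rfl⟩))))) (by
        intro a ha
        rw [List.mem_singleton] at ha
        exact ha ▸ hreach t)
    obtain ⟨j, hj, rfl⟩ := List.mem_map.1 ha
    exact ⟨j, List.mem_range.1 hj, hc⟩

end Sound

section Complete

open Classical in
/-- The interpretation of the constants in which the Boolean constant of kind `k` with number `e` is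
true if `B k e` holds, and `R` gives the ranks. -/
noncomputable def interp (B : ℕ → ℕ → Prop) (R : ℕ → ℕ) (a : ℕ) : ℕ :=
  if a.unpair.1 = 0 then 1
  else if a.unpair.1 = 6 then R a.unpair.2
  else if B a.unpair.1 a.unpair.2 then 1 else 0

open Classical in
-- Kind `0` is the constant for truth and kind `6` holds the ranks, hence the two exclusions.
theorem holds_boolLit {B : ℕ → ℕ → Prop} {R : ℕ → ℕ} {k e : ℕ} (h0 : k ≠ 0) (h6 : k ≠ 6) :
    Lit.Holds (interp B R) (boolLit k e) ↔ B k e := by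
  have h1 : interp B R (Nat.pair k e) = if B k e then 1 else 0 := by
    rw [interp, Nat.unpair_pair, if_neg h0, if_neg h6]
  have h2 : interp B R (Nat.pair 0 0) = 1 := by
    rw [interp, Nat.unpair_pair, if_pos rfl]
  simp only [Lit.Holds, boolLit, Bool.false_eq_true, if_false, h1, h2]
  split <;> simp_all

theorem holds_rankLit {B : ℕ → ℕ → Prop} {R : ℕ → ℕ} {N N' : PumpNode} :
    Lit.Holds (interp B R) (rankLit N N') ↔
      R (Encodable.encode N) ≤ R (Encodable.encode N') := by
  simp [Lit.Holds, rankLit, interp]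

/-- The intended truth values of the Boolean constants. -/
def intended (D : Data) (T : Table) : ℕ → ℕ → Prop
  | 1, e => ∃ p i x, e = Encodable.encode (p, i, x, T.step p i x)
  | 2, e => ∃ p i v, e = Encodable.encode (p, i, v) ∧ T.lab p i v
  | 3, e => ∃ p, e = Encodable.encode (p, T.init p)
  | 4, e => ∃ x a, e = Encodable.encode (D.toPumpNode x) ∧ D.Start T a ∧
      ReflTransGen (PumpEdge (D.Edge T) D.MarkA D.MarkG) a x
  | 5, e => ∃ x j, e = Encodable.encode (D.toPumpNode x, j) ∧
      Missed (PumpEdge (D.Edge T) D.MarkA D.MarkG) (fun j x => fairBit x.1.1 j = true) x j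
  | _, _ => False

open Classical in
/-- The intended ranks. -/
noncomputable def intendedRank (D : Data) (T : Table) (e : ℕ) : ℕ :=
  if h : ∃ x, Encodable.encode (D.toPumpNode x) = e then
    reachCard (PumpEdge (D.Edge T) D.MarkA D.MarkG) h.choose else 0

theorem intendedRank_encode (x : D.Node × Fin 3 × D.Node) :
    intendedRank D T (Encodable.encode (D.toPumpNode x)) =
      reachCard (PumpEdge (D.Edge T) D.MarkA D.MarkG) x := by
  have h : ∃ y, Encodable.encode (D.toPumpNode y) = Encodable.encode (D.toPumpNode x) := ⟨x, rfl⟩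
  rw [intendedRank, dif_pos h, toPumpNode_injective (Encodable.encode_injective h.choose_spec)]

/-- All constants receive their intended meaning: true reachability, component-wise missing, and
reachable-set size as rank. The absence of fair paths is used only for the clauses saying that
reachable vertices miss something. -/
theorem sequents_of_table (hT : D.Valid T) (hf : ¬ D.HasFairPath T) :
    ∀ s ∈ D.sequents, Sequent.Holds (interp (intended D T) (intendedRank D T)) s := by
  classical
  have hstep : ∀ p i x j, Lit.Holds (interp (intended D T) (intendedRank D T)) (stepLit p i x j) ↔
      j = T.step p i x := by
    intro p i x j
    rw [stepLit, holds_boolLit (by decide) (by decide)]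
    constructor
    · rintro ⟨p', i', x', h⟩
      have := Encodable.encode_injective h
      simp only [Prod.mk.injEq] at this
      obtain ⟨rfl, rfl, rfl, rfl⟩ := this
      rfl
    · rintro rfl
      exact ⟨p, i, x, rfl⟩
  have hlab : ∀ p i v, Lit.Holds (interp (intended D T) (intendedRank D T)) (labLit p i v) ↔
      T.lab p i v := by
    intro p i x
    rw [labLit, holds_boolLit (by decide) (by decide)]
    constructor
    · rintro ⟨p', i', x', h, h'⟩
      have := Encodable.encode_injective h
      simp only [Prod.mk.injEq] at this
      obtain ⟨rfl, rfl, rfl⟩ := this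
      exact h'
    · exact fun h => ⟨p, i, x, rfl, h⟩
  have hinit : ∀ p i, Lit.Holds (interp (intended D T) (intendedRank D T)) (initLit p i) ↔
      i = T.init p := by
    intro p i
    rw [initLit, holds_boolLit (by decide) (by decide)]
    constructor
    · rintro ⟨p', h⟩
      have := Encodable.encode_injective h
      simp only [Prod.mk.injEq] at this
      obtain ⟨rfl, rfl⟩ := this
      rfl
    · rintro rfl
      exact ⟨p, rfl⟩
  have hreach : ∀ x, Lit.Holds (interp (intended D T) (intendedRank D T))
      (reachLit (D.toPumpNode x)) ↔
      ∃ a, D.Start T a ∧ ReflTransGen (PumpEdge (D.Edge T) D.MarkA D.MarkG) a x := by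
    intro x
    rw [reachLit, holds_boolLit (by decide) (by decide)]
    constructor
    · rintro ⟨y, a, h, h'⟩
      rw [toPumpNode_injective (Encodable.encode_injective h)]
      exact ⟨a, h'⟩
    · rintro ⟨a, h⟩
      exact ⟨x, a, rfl, h⟩
  have hmiss : ∀ x j, Lit.Holds (interp (intended D T) (intendedRank D T))
      (missLit (D.toPumpNode x) j) ↔ Missed (PumpEdge (D.Edge T) D.MarkA D.MarkG)
        (fun j x => fairBit x.1.1 j = true) x j := by
    intro x j
    rw [missLit, holds_boolLit (by decide) (by decide)]
    constructor
    · rintro ⟨y, j', h, h'⟩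
      have := Encodable.encode_injective h
      simp only [Prod.mk.injEq] at this
      obtain ⟨h1, rfl⟩ := this
      rw [toPumpNode_injective h1]
      exact h'
    · exact fun h => ⟨x, j, rfl, h⟩
  intro s hs
  simp only [sequents, List.mem_append] at hs
  rcases hs with hs | hs | hs | hs | hs
  · obtain ⟨p, hp, rfl⟩ := List.mem_map.1 hs
    have hp := List.mem_range.1 hp
    exact fun _ => ⟨_, List.mem_map.2 ⟨T.init p, List.mem_range.2 (hT p hp).1, rfl⟩,
      (hinit _ _).2 rfl⟩
  · simp only [stepSequents, List.mem_flatMap, List.mem_map, List.mem_range] at hs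
    obtain ⟨p, hp, i, hi, x, hx, rfl⟩ := hs
    exact fun _ => ⟨_, List.mem_map.2 ⟨T.step p i x,
      List.mem_range.2 ((hT p hp).2 i hi x (mem_tuples.1 hx).1), rfl⟩, (hstep _ _ _ _).2 rfl⟩
  · obtain ⟨N, hN, rfl⟩ := List.mem_map.1 hs
    obtain ⟨hN, hN'⟩ := List.mem_filter.1 hN
    obtain ⟨x, rfl⟩ := mem_pumpNodes.1 hN
    intro hhyp
    refine ⟨_, List.mem_singleton.2 rfl, (hreach _).2 ⟨x, ⟨hN', fun p hp => ?_⟩, .refl⟩⟩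
    exact (hinit _ _).1 (hhyp _ (List.mem_map.2 ⟨p, List.mem_range.2 hp, rfl⟩))
  · obtain ⟨N, hN, rfl⟩ := List.mem_map.1 hs
    obtain ⟨x, rfl⟩ := mem_pumpNodes.1 hN
    intro hhyp
    obtain ⟨a, ha, hax⟩ := (hreach _).1 (hhyp _ (List.mem_singleton.2 rfl))
    -- A reachable vertex whose component misses nothing would start a fair path.
    by_contra hcon
    have hJ : 0 < D.fairCount := Nat.mul_pos (by norm_num) (Nat.succ_pos _)
    obtain ⟨π, B, h0, h1, h2⟩ := exists_fair_path hJ hax (F := fun j x => fairBit x.1.1 j = true)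
      (fun j hj hm => hcon ⟨_, List.mem_map.2 ⟨j, List.mem_range.2 hj, rfl⟩, (hmiss _ _).2 hm⟩)
    refine hf ⟨π, h0 ▸ ha, h1, fun j hj t => ?_⟩
    obtain ⟨u, hu, -, hF⟩ := h2 j hj t
    exact ⟨u, hu, hF⟩
  · simp only [graphSequents, List.mem_flatMap, List.mem_filter, Bool.and_eq_true] at hs
    obtain ⟨N, hN, N', ⟨hN', hst, hp⟩, hs⟩ := hs
    obtain ⟨x, rfl⟩ := mem_pumpNodes.1 hN
    obtain ⟨y, rfl⟩ := mem_pumpNodes.1 hN'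
    have hedge : (∀ a ∈ D.edgeHyps x.1.1 y.1.1,
        Lit.Holds (interp (intended D T) (intendedRank D T)) a) →
        (∀ a ∈ D.edgeAlts x.1.1, ¬ Lit.Holds (interp (intended D T) (intendedRank D T)) a) →
        PumpEdge (D.Edge T) D.MarkA D.MarkG x y := by
      intro h1 h2
      refine pumpEdge_iff.2 ⟨⟨hst, fun p hpp => ⟨fun hx => ?_, fun v hv => ?_⟩⟩, hp⟩
      · refine (hstep _ _ _ _).1 (h1 _ (List.mem_flatMap.2 ⟨p, List.mem_range.2 hpp, ?_⟩))
        rw [hx]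
        simp
      · constructor
        · intro hx
          refine (hlab _ _ _).1 (h1 _ (List.mem_flatMap.2 ⟨p, List.mem_range.2 hpp, ?_⟩))
          exact List.mem_append_right _ (List.mem_map.2 ⟨v, List.mem_filter.2 ⟨hv, hx⟩, rfl⟩)
        · intro hl
          by_contra hx
          refine h2 _ (List.mem_flatMap.2 ⟨p, List.mem_range.2 hpp, ?_⟩) ((hlab _ _ _).2 hl)
          exact List.mem_map.2 ⟨v, List.mem_filter.2 ⟨hv, by simpa using hx⟩, rfl⟩
    have hmono : ∀ {a l}, Lit.Holds (interp (intended D T) (intendedRank D T)) a →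
        ∃ b ∈ a :: l, Lit.Holds (interp (intended D T) (intendedRank D T)) b :=
      fun h => ⟨_, List.mem_cons_self .., h⟩
    intro hhyp
    by_cases halts : ∃ a ∈ D.edgeAlts x.1.1,
      Lit.Holds (interp (intended D T) (intendedRank D T)) a
    · obtain ⟨a, ha, hl⟩ := halts
      refine ⟨a, ?_, hl⟩
      rcases List.mem_cons.1 hs with rfl | hs
      · exact List.mem_cons_of_mem _ ha
      rcases List.mem_cons.1 hs with rfl | hs
      · exact List.mem_cons_of_mem _ ha
      obtain ⟨j, -, rfl⟩ := List.mem_map.1 hs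
      exact List.mem_append_right _ ha
    push Not at halts
    rcases List.mem_cons.1 hs with rfl | hs
    · have hE := hedge (fun a ha => hhyp a (List.mem_cons_of_mem _ ha)) halts
      obtain ⟨a, ha, hax⟩ := (hreach _).1 (hhyp _ (List.mem_cons_self ..))
      exact hmono ((hreach _).2 ⟨a, ha, hax.tail hE⟩)
    rcases List.mem_cons.1 hs with rfl | hs
    · have hE := hedge (fun a ha => hhyp a (List.mem_cons_of_mem _ ha)) halts
      refine hmono (holds_rankLit.2 ?_)
      rw [intendedRank_encode, intendedRank_encode]
      exact reachCard_le hE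
    obtain ⟨j, -, rfl⟩ := List.mem_map.1 hs
    have hE := hedge (fun a ha => hhyp a (List.mem_cons_of_mem _ (List.mem_cons_of_mem _
      (List.mem_cons_of_mem _ ha)))) halts
    have h1 := (hmiss _ _).1 (hhyp _ (List.mem_cons_self ..))
    have h2 := holds_rankLit.1 (hhyp _ (List.mem_cons_of_mem _ (List.mem_cons_self ..)))
    rw [intendedRank_encode, intendedRank_encode] at h2
    obtain ⟨h3, h4⟩ := missed_step hE h2 h1
    have h5 : fairBit (D.toPumpNode y).1 j = false := Bool.eq_false_iff.2 h4
    simp only [h5]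
    exact hmono ((hmiss _ _).2 h3)

end Complete

theorem satisfiable_sequents_iff :
    (ConstraintSystem.ofSequents D.sequents).Satisfiable ↔
      ∃ T, D.Valid T ∧ ¬ D.HasFairPath T := by
  rw [ConstraintSystem.satisfiable_ofSequents]
  constructor
  · rintro ⟨M, O, c, h⟩
    exact exists_table_of_sequents h
  · rintro ⟨T, hT, hf⟩
    exact ⟨ℕ, inferInstance, _, sequents_of_table hT hf⟩

end Data

end PromptSynthesis

namespace PromptSynthesis

namespace Instance

variable (J : Instance)

/-- The data of an instance. -/
abbrev inputData : Data := J.data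

/-! ### The data of an instance -/

theorem data_procs : J.inputData.procs = J.n := by
  simp [Data.procs, inputData, data]

theorem data_getD (p : Fin J.n) : J.inputData.2.2.getD p.val (0, [], []) =
    (J.bound p, (J.arch.inp (some p)).sort, (J.arch.out (some p)).sort) := by
  rw [List.getD_eq_getElem _ _ (by simp [data])]
  simp [data]

theorem data_bnd (p : Fin J.n) : J.inputData.bnd p.val = J.bound p := by
  rw [Data.bnd, data_getD]

theorem data_ins (p : Fin J.n) : J.inputData.ins p.val = (J.arch.inp (some p)).sort := by
  rw [Data.ins, data_getD]

theorem data_outs (p : Fin J.n) : J.inputData.outs p.val = (J.arch.out (some p)).sort := by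
  rw [Data.outs, data_getD]

theorem inl_mem_vars {v : ℕ} : Sum.inl v ∈ J.arch.async.vars ↔
    v ∈ J.arch.out none ∨ ∃ p, v ∈ J.arch.out (some p) := by
  simp only [Architecture.vars, Architecture.async, Finset.mem_biUnion, Finset.mem_univ, true_and]
  constructor
  · rintro ⟨_ | p, h⟩
    · exact Or.inl (by simpa [Architecture.asyncOut] using h)
    · exact Or.inr ⟨p, by simpa [Architecture.asyncOut] using h⟩
  · rintro (h | ⟨p, h⟩)
    · exact ⟨none, by simpa [Architecture.asyncOut] using h⟩
    · exact ⟨some p, by simpa [Architecture.asyncOut] using h⟩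

theorem inr_mem_vars (p : Fin J.n) : Sum.inr p ∈ J.arch.async.vars := by
  simp only [Architecture.vars, Architecture.async, Finset.mem_biUnion, Finset.mem_univ, true_and]
  exact ⟨none, by simp [Architecture.asyncOut]⟩

theorem encode_inl (v : ℕ) : Encodable.encode (Sum.inl v : ℕ ⊕ Fin J.n) = 2 * v := by
  simp

theorem encode_inr (p : Fin J.n) : Encodable.encode (Sum.inr p : ℕ ⊕ Fin J.n) = 2 * p.val + 1 := by
  simp only [Encodable.encode_inr]
  rfl

theorem mem_varCodes {e : ℕ} :
    e ∈ J.inputData.varCodes ↔ ∃ a ∈ J.arch.async.vars, Encodable.encode a = e := by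
  simp only [Data.varCodes, List.mem_append, List.mem_map, List.mem_flatMap, List.mem_range,
    data_procs]
  constructor
  · rintro (⟨v, hv, rfl⟩ | ⟨p, hp, rfl⟩ | ⟨p, hp, v, hv, rfl⟩)
    · exact ⟨.inl v, J.inl_mem_vars.2 (Or.inl (by simpa [data] using hv)), J.encode_inl v⟩
    · exact ⟨.inr ⟨p, hp⟩, J.inr_mem_vars _, J.encode_inr _⟩
    · rw [J.data_outs ⟨p, hp⟩] at hv
      exact ⟨.inl v, J.inl_mem_vars.2 (Or.inr ⟨⟨p, hp⟩, by simpa using hv⟩), J.encode_inl v⟩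
  · rintro ⟨v | p, ha, rfl⟩
    · rcases J.inl_mem_vars.1 ha with h | ⟨p, h⟩
      · exact Or.inl ⟨v, by simpa [data] using h, (J.encode_inl v).symm⟩
      · exact Or.inr (Or.inr ⟨p, p.2, v, by simpa [data_outs] using h, (J.encode_inl v).symm⟩)
    · exact Or.inr (Or.inl ⟨p, p.2, (J.encode_inr p).symm⟩)

/-! ### Words of tables -/

/-- The valuation of the inputs of `p` as a list. -/
def inputKey (p : Fin J.n) (a : Finset (ℕ ⊕ Fin J.n)) : List Bool :=
  ((J.arch.inp (some p)).sort).map fun v => decide (Sum.inl v ∈ a)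

variable {J} in
/-- The state of process `p` at position `i` of the word `w`. -/
def stateAt (T : Table) (w : ℕ → Finset (ℕ ⊕ Fin J.n)) (p : Fin J.n) : ℕ → ℕ
  | 0 => T.init p
  | i + 1 =>
    if Sum.inr p ∈ w i then T.step p (stateAt T w p i) (J.inputKey p (w i)) else stateAt T w p i

/-- The words that are generated by a table. -/
def tableWords (T : Table) : Set (ℕ → Finset (ℕ ⊕ Fin J.n)) :=
  {w | ∀ i, w i ⊆ J.arch.async.vars ∧
    ∀ p, ∀ v ∈ J.arch.out (some p), (Sum.inl v ∈ w i ↔ T.lab p (stateAt T w p i) v)}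

/-- The words of a table satisfy the specification. -/
def TableSatisfies (T : Table) : Prop :=
  ∀ k : ℕ, ∃ l : ℕ, ∀ w ∈ J.tableWords T, J.assumption.Sat w k → J.guarantee.Sat w l

/-- The history of the inputs of process `p`. -/
def history (p : Fin J.n) (w : ℕ → Finset (ℕ ⊕ Fin J.n)) (i : ℕ) :
    List (Letter (J.arch.async.inp (some p))) :=
  (List.range i).map fun j => restrict (J.arch.async.inp (some p)) (w j)

variable {J}

theorem history_succ (p : Fin J.n) (w : ℕ → Finset (ℕ ⊕ Fin J.n)) (i : ℕ) :
    J.history p w (i + 1) = J.history p w i ++ [restrict (J.arch.async.inp (some p)) (w i)] := by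
  simp [history, List.range_succ]

theorem length_inputKey (p : Fin J.n) (a : Finset (ℕ ⊕ Fin J.n)) :
    (J.inputKey p a).length = (J.inputData.ins p).length := by
  simp [inputKey, data_ins]

theorem init_lt {T : Table} (hT : J.inputData.Valid T) (p : Fin J.n) : T.init p < J.bound p := by
  rw [← data_bnd]
  exact (hT p (by rw [data_procs]; exact p.2)).1

theorem step_lt {T : Table} (hT : J.inputData.Valid T) (p : Fin J.n) {i : ℕ} (hi : i < J.bound p)
    (a : Finset (ℕ ⊕ Fin J.n)) : T.step p i (J.inputKey p a) < J.bound p := by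
  rw [← data_bnd] at hi ⊢
  exact (hT p (by rw [data_procs]; exact p.2)).2 _ hi _ (length_inputKey p _)

theorem stateAt_lt {T : Table} (hT : J.inputData.Valid T) (w : ℕ → Finset (ℕ ⊕ Fin J.n)) (p : Fin J.n)
    (i : ℕ) : stateAt T w p i < J.bound p := by
  induction i with
  | zero => exact init_lt hT p
  | succ i ih =>
    rw [stateAt]
    split
    · exact step_lt hT p ih _
    · exact ih

theorem inl_mem_inp {p : Fin J.n} {v : ℕ} :
    Sum.inl v ∈ J.arch.async.inp (some p) ↔ v ∈ J.arch.inp (some p) := by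
  simp [Architecture.async, Architecture.asyncInp]

theorem inr_mem_inp {p q : Fin J.n} : Sum.inr q ∈ J.arch.async.inp (some p) ↔ q = p := by
  simp [Architecture.async, Architecture.asyncInp]

theorem inl_mem_out {p : Fin J.n} {v : ℕ} :
    Sum.inl v ∈ J.arch.async.out (some p) ↔ v ∈ J.arch.out (some p) := by
  simp [Architecture.async, Architecture.asyncOut]

theorem inr_mem_out {p q : Fin J.n} : Sum.inr q ∉ J.arch.async.out (some p) := by
  simp [Architecture.async, Architecture.asyncOut]

theorem mem_restrict {X x : Finset (ℕ ⊕ Fin J.n)} {a : ℕ ⊕ Fin J.n} :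
    a ∈ (restrict X x).1 ↔ a ∈ x ∧ a ∈ X := Finset.mem_inter

theorem inputKey_restrict (p : Fin J.n) (a : Finset (ℕ ⊕ Fin J.n)) :
    J.inputKey p (restrict (J.arch.async.inp (some p)) a).1 = J.inputKey p a := by
  refine List.map_congr_left fun v hv => ?_
  have hv : v ∈ J.arch.inp (some p) := by simpa using hv
  simp only [mem_restrict, inl_mem_inp, hv, and_true]

theorem inr_mem_restrict (p : Fin J.n) (a : Finset (ℕ ⊕ Fin J.n)) :
    Sum.inr p ∈ (restrict (J.arch.async.inp (some p)) a).1 ↔ Sum.inr p ∈ a := by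
  simp only [mem_restrict, inr_mem_inp, and_true]

/-- The key omits only the scheduling variable, which belongs to both letters. -/
theorem inputKey_injective {p : Fin J.n} {a b : Letter (J.arch.async.inp (some p))}
    (ha : Sum.inr p ∈ a.1) (hb : Sum.inr p ∈ b.1) (h : J.inputKey p a.1 = J.inputKey p b.1) :
    a = b := by
  refine Subtype.ext (Finset.ext ?_)
  have h1 := List.map_inj_left.1 h
  simp only [Finset.mem_sort, decide_eq_decide] at h1
  rintro (v | q)
  · by_cases hv : v ∈ J.arch.inp (some p)
    · exact h1 v hv
    · exact ⟨fun h => absurd (inl_mem_inp.1 (a.2 h)) hv, fun h => absurd (inl_mem_inp.1 (b.2 h)) hv⟩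
  · constructor
    · intro h
      rwa [inr_mem_inp.1 (a.2 h)]
    · intro h
      rwa [inr_mem_inp.1 (b.2 h)]

/-- Environment outputs are unconstrained on both sides, so it suffices to compare process outputs
on the histories that words produce. -/
theorem composition_eq {T : Table} {f : ∀ p, J.arch.async.Implementation p}
    (h : ∀ w p i, ∀ v ∈ J.arch.out (some p),
      (Sum.inl v ∈ (f p (J.history p w i)).1 ↔ T.lab p (stateAt T w p i) v)) :
    J.arch.async.composition f = J.tableWords T := by
  ext w
  refine forall_congr' fun i => and_congr Iff.rfl (forall_congr' fun p => ?_)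
  change restrict _ _ = f p (J.history p w i) ↔ _
  constructor
  · intro he v hv
    rw [← h w p i v hv, ← he, mem_restrict, inl_mem_out]
    exact ⟨fun h => ⟨h, hv⟩, fun h => h.1⟩
  · intro he
    refine Subtype.ext (Finset.ext ?_)
    rintro (v | q)
    · by_cases hv : v ∈ J.arch.out (some p)
      · rw [h w p i v hv, ← he v hv, mem_restrict, inl_mem_out]
        exact ⟨fun h => h.1, fun h => ⟨h, hv⟩⟩
      · exact ⟨fun h => absurd (inl_mem_out.1 (mem_restrict.1 h).2) hv,
          fun h => absurd (inl_mem_out.1 ((f p _).2 h)) hv⟩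
    · exact ⟨fun h => absurd (mem_restrict.1 h).2 inr_mem_out,
        fun h => absurd ((f p _).2 h) inr_mem_out⟩

theorem run_append {Dir Lab : Type} (T : TransitionSystem Dir Lab) (u : List Dir) (x : Dir) :
    T.run (u ++ [x]) = T.step (T.run u) x := by
  simp [TransitionSystem.run]

open Classical in
/-- The table of given transition systems with numbered states. -/
noncomputable def tableOf
    (S : ∀ p : Fin J.n, TransitionSystem (Letter (J.arch.async.inp (some p)))
      (Letter (J.arch.async.out (some p))))
    (e : ∀ p, (S p).State ≃ Fin (J.bound p)) : Table where
  init p := if hp : p < J.n then e ⟨p, hp⟩ (S ⟨p, hp⟩).init else 0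
  step p i x := if hp : p < J.n then
      if hi : i < J.bound ⟨p, hp⟩ then
        if ha : ∃ a : Letter (J.arch.async.inp (some ⟨p, hp⟩)),
          Sum.inr ⟨p, hp⟩ ∈ a.1 ∧ J.inputKey ⟨p, hp⟩ a.1 = x then
        e ⟨p, hp⟩ ((S ⟨p, hp⟩).step ((e ⟨p, hp⟩).symm ⟨i, hi⟩) ha.choose) else i else i else i
  lab p i v := ∃ (hp : p < J.n) (hi : i < J.bound ⟨p, hp⟩),
    Sum.inl v ∈ ((S ⟨p, hp⟩).label ((e ⟨p, hp⟩).symm ⟨i, hi⟩)).1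

theorem exists_table_of_realizable (h : J.Realizable) :
    ∃ T, J.inputData.Valid T ∧ J.TableSatisfies T := by
  classical
  obtain ⟨f, hf, hsat⟩ := h
  choose S hsize hsched hgen using hf
  have : ∀ p, Nonempty ((S p).State ≃ Fin (J.bound p)) := fun p => by
    have := (S p).finite
    exact ⟨Finite.equivFinOfCardEq (hsize p)⟩
  let e := fun p => (this p).some
  let T := tableOf S e
  have hstate : ∀ w (p : Fin J.n) i, stateAt T w p i = e p ((S p).run (J.history p w i)) := by
    intro w p i
    induction i with
    | zero => exact dif_pos p.2
    | succ i ih =>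
      rw [stateAt, ih, history_succ]
      split
      · rename_i hp
        have hp' := (inr_mem_restrict p (w i)).2 hp
        have ha : ∃ a : Letter (J.arch.async.inp (some p)),
          Sum.inr p ∈ a.1 ∧ J.inputKey p a.1 = J.inputKey p (w i) :=
            ⟨restrict _ (w i), hp', inputKey_restrict p _⟩
        have hc : ha.choose = restrict _ (w i) := inputKey_injective ha.choose_spec.1 hp'
          (ha.choose_spec.2.trans (inputKey_restrict p _).symm)
        simp only [T, tableOf]
        rw [dif_pos p.2, dif_pos (e p _).2, dif_pos ha, hc, run_append]
        simp
      · rename_i hp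
        rw [hsched p _ _ (fun h => hp ((inr_mem_restrict p (w i)).1 h))]
  refine ⟨T, fun p hp => ?_, ?_⟩
  · rw [data_procs] at hp
    have hb : J.inputData.bnd p = J.bound ⟨p, hp⟩ := J.data_bnd ⟨p, hp⟩
    rw [hb]
    constructor
    · simp only [T, tableOf]
      rw [dif_pos hp]
      exact (e _ _).2
    · intro i hi x _
      simp only [T, tableOf]
      rw [dif_pos hp, dif_pos hi]
      -- Where no scheduled letter has key `x`, the table keeps the state; so the bound holds
      -- without showing that every list of the right length is a key.
      split
      · exact (e _ _).2
      · exact hi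
  · have hcomp : J.arch.async.composition f = J.tableWords T := by
      refine composition_eq fun w p i v hv => ?_
      rw [hgen p, hstate]
      constructor
      · intro h
        refine ⟨p.2, (e p _).2, ?_⟩
        simpa using h
      · rintro ⟨_, _, h⟩
        simpa using h
    intro k
    obtain ⟨l, hl⟩ := hsat k
    exact ⟨l, fun w hw => hl w (hcomp ▸ hw)⟩

open Classical in
/-- The transition system of process `p` in a table. -/
noncomputable def systemOf {T : Table} (hT : J.inputData.Valid T) (p : Fin J.n) :
    TransitionSystem (Letter (J.arch.async.inp (some p)))
      (Letter (J.arch.async.out (some p))) where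
  State := Fin (J.bound p)
  finite := inferInstance
  init := ⟨T.init p, init_lt hT p⟩
  step s a := if Sum.inr p ∈ a.1 then ⟨T.step p s (J.inputKey p a.1), step_lt hT p s.2 _⟩ else s
  label s := ⟨((J.arch.out (some p)).filter fun v => T.lab p s v).disjSum ∅, by
    rintro (v | q) h
    · exact inl_mem_out.2 (Finset.mem_filter.1 (Finset.inl_mem_disjSum.1 h)).1
    · simp at h⟩

theorem realizable_of_table {T : Table} (hT : J.inputData.Valid T) (hsat : J.TableSatisfies T) :
    J.Realizable := by
  classical
  refine ⟨fun p u => (systemOf hT p).label ((systemOf hT p).run u), fun p => ⟨systemOf hT p, ?_,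
    fun u x hx => ?_, fun u => rfl⟩, ?_⟩
  · exact (Nat.card_eq_fintype_card (α := Fin (J.bound p))).trans (Fintype.card_fin _)
  · rw [run_append]
    exact if_neg hx
  · have hstate : ∀ w (p : Fin J.n) i,
        ((systemOf hT p).run (J.history p w i) : Fin (J.bound p)).val = stateAt T w p i := by
      intro w p i
      induction i with
      | zero => rfl
      | succ i ih =>
        rw [history_succ, run_append, stateAt, ← ih]
        simp only [systemOf, inr_mem_restrict, inputKey_restrict]
        split <;> rfl
    have hcomp := composition_eq (T := T) (J := J)
      (f := fun p u => (systemOf hT p).label ((systemOf hT p).run u)) (by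
        intro w p i v hv
        rw [← hstate]
        refine Finset.inl_mem_disjSum.trans ?_
        rw [Finset.mem_filter]
        exact and_iff_right hv)
    intro k
    obtain ⟨l, hl⟩ := hsat k
    exact ⟨l, fun w hw => hl w (hcomp ▸ hw)⟩

theorem realizable_iff : J.Realizable ↔ ∃ T, J.inputData.Valid T ∧ J.TableSatisfies T :=
  ⟨exists_table_of_realizable, fun ⟨_, hT, h⟩ => realizable_of_table hT h⟩

end Instance

end PromptSynthesis

/-! ### Violations as fair paths, and the final equivalence -/

namespace PromptSynthesis

open Relation

/-- In a finite graph a path that visits every `F j` infinitely often can be replaced by one that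
visits every `F j` in every window of a fixed length. -/
theorem exists_bounded_fair_path {X : Type} [Finite X] {E : X → X → Prop} {F : ℕ → X → Prop} {J : ℕ}
    (hJ : 0 < J) {π : ℕ → X} (hE : ∀ t, E (π t) (π (t + 1)))
    (hF : ∀ j < J, ∀ t, ∃ u, t ≤ u ∧ F j (π u)) :
    ∃ (π' : ℕ → X) (B : ℕ), π' 0 = π 0 ∧ (∀ t, E (π' t) (π' (t + 1))) ∧
      ∀ j < J, ∀ t, ∃ u, t ≤ u ∧ u ≤ t + B ∧ F j (π' u) := by
  have hwalk : ∀ t d, ReflTransGen E (π t) (π (t + d)) := by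
    intro t d
    induction d with
    | zero => exact .refl
    | succ d ih => exact ih.tail (hE _)
  have hwalk' : ∀ {t u}, t ≤ u → ReflTransGen E (π t) (π u) := fun {t u} h => by
    have := hwalk t (u - t)
    rwa [Nat.add_sub_cancel' h] at this
  -- A vertex visited infinitely often has all later vertices of the path in its component, which
  -- therefore misses no condition.
  obtain ⟨x, hx⟩ := Finite.exists_infinite_fiber π
  have hx' : ∀ t, ∃ u, t ≤ u ∧ π u = x := by
    intro t
    obtain ⟨u, hu, htu⟩ := (Set.infinite_coe_iff.1 hx).exists_gt t
    exact ⟨u, htu.le, hu⟩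
  obtain ⟨t0, -, ht0⟩ := hx' 0
  refine exists_fair_path hJ (x := x) (ht0 ▸ hwalk' (Nat.zero_le t0)) fun j hj hm => ?_
  obtain ⟨u, hu, hFu⟩ := hF j hj (t0 + 1)
  obtain ⟨v, hv, hvx⟩ := hx' u
  refine hm (π u) ?_ ?_ hFu
  · exact ht0 ▸ TransGen.head' (hE t0) (hwalk' hu)
  · exact hvx ▸ hwalk' hv

namespace Data

variable {D : Data}

theorem mem_baseNodes {q : BaseNode} : q ∈ D.baseNodes ↔
    (q.1.length = D.procs ∧ ∀ a ∈ q.1, a < D.maxStates) ∧ q.2.1.length = D.width ∧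
      q.tableA.length = 2 * D.codeBound ∧ q.tableG.length = 2 * D.codeBound := by
  obtain ⟨t, x, ⟨r, h⟩, ⟨s, g⟩⟩ := q
  have hb : ∀ {b : Bool}, b ∈ [false, true] := fun {b} => by cases b <;> simp
  simp only [baseNodes, List.mem_flatMap, List.mem_map, mem_tuples, hb, List.mem_range, true_and,
    Prod.mk.injEq, implies_true, and_true, BaseNode.tableA, BaseNode.tableG]
  constructor
  · rintro ⟨t, ht, x, hx, r, h, hh, s, g, hg, rfl, rfl, ⟨rfl, rfl⟩, rfl, rfl⟩
    exact ⟨ht, hx, hh, hg⟩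
  · rintro ⟨ht, hx, hh, hg⟩
    exact ⟨t, ht, x, hx, r, h, hh, s, g, hg, rfl, rfl, ⟨rfl, rfl⟩, rfl, rfl⟩

theorem lt_width {e : ℕ} (h : e ∈ D.varCodes) : e < D.width := by
  unfold width
  generalize D.varCodes = l at h
  induction l with
  | nil => simp at h
  | cons v l ih =>
    rw [List.foldr_cons]
    rcases List.mem_cons.1 h with rfl | h
    · omega
    · have := ih h
      omega

theorem bnd_le_maxStates {p : ℕ} (h : p < D.procs) : D.bnd p ≤ D.maxStates := by
  unfold maxStates
  have h := List.mem_range.2 h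
  generalize List.range D.procs = l at h
  induction l with
  | nil => simp at h
  | cons v l ih =>
    rw [List.foldr_cons]
    rcases List.mem_cons.1 h with rfl | h
    · omega
    · have := ih h
      omega

end Data

namespace Instance

variable {J : Instance} {T : Table}

/-! ### Fair paths and violations of the specification -/

/-- The letter of a vertex. -/
def wordOf (J : Instance) (q : BaseNode) : Finset (ℕ ⊕ Fin J.n) :=
  J.arch.async.vars.filter fun a => q.letter (Encodable.encode a) = true

/-- The static edge condition forbids true letter entries that code no variable, and entries beyond
`width` read as false, so filtering by variables loses nothing. -/
theorem mem_wordOf {q q' : BaseNode} (hq : q ∈ J.inputData.baseNodes)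
    (h : J.inputData.staticEdge q q' = true) (a : ℕ ⊕ Fin J.n) :
    a ∈ J.wordOf q ↔ q.letter (Encodable.encode a) = true := by
  refine Finset.mem_filter.trans (and_iff_right_of_imp fun ha => ?_)
  simp only [Data.staticEdge, Bool.and_eq_true, List.all_eq_true, List.mem_range] at h
  have hlt : Encodable.encode a < J.inputData.width := by
    rw [← (Data.mem_baseNodes.1 hq).2.1]
    by_contra! hle
    rw [BaseNode.letter, List.getD_eq_default _ _ hle] at ha
    exact absurd ha (by decide)
  have h1 := h.1 _ hlt
  rw [ha, Bool.not_true, Bool.false_or, List.any_eq_true] at h1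
  obtain ⟨v, hv, hva⟩ := h1
  rw [decide_eq_true_eq] at hva
  subst hva
  obtain ⟨b, hb, he⟩ := J.mem_varCodes.1 hv
  exact Encodable.encode_injective he ▸ hb

section Violation

variable {q : ℕ → J.inputData.Node}

theorem stateAt_path (hE : ∀ t, J.inputData.Edge T (q t) (q (t + 1)))
    (h0 : ∀ p < J.inputData.procs, (q 0).1.state p = T.init p) (p : Fin J.n) (i : ℕ) :
    stateAt T (fun t => J.wordOf (q t).1) p i = (q i).1.state p := by
  have hp : p.val < J.inputData.procs := by rw [data_procs]; exact p.2
  induction i with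
  | zero => exact (h0 p hp).symm
  | succ i ih =>
    obtain ⟨hst, hdyn⟩ := hE i
    have hmem := mem_wordOf (q i).2 hst
    have hkey : J.inputKey p (J.wordOf (q i).1) = (q i).1.key J.inputData p := by
      unfold inputKey BaseNode.key
      rw [data_ins]
      refine List.map_congr_left fun v _ => ?_
      rw [Bool.eq_iff_iff, decide_eq_true_eq, hmem, J.encode_inl]
    rw [stateAt, ih, hkey]
    split
    · rename_i h
      rw [hmem, J.encode_inr] at h
      exact ((hdyn p hp).1 h).symm
    · rename_i h
      rw [hmem, J.encode_inr] at h
      simp only [Data.staticEdge, Bool.and_eq_true, List.all_eq_true, List.mem_range] at hst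
      have := hst.2.2.2 p hp
      rw [Bool.eq_false_iff.2 h, Bool.false_or, decide_eq_true_eq] at this
      exact this.symm

theorem path_mem_tableWords (hE : ∀ t, J.inputData.Edge T (q t) (q (t + 1)))
    (h0 : ∀ p < J.inputData.procs, (q 0).1.state p = T.init p) :
    (fun t => J.wordOf (q t).1) ∈ J.tableWords T := by
  refine fun i => ⟨Finset.filter_subset _ _, fun p v hv => ?_⟩
  have hp : p.val < J.inputData.procs := by rw [data_procs]; exact p.2
  obtain ⟨hst, hdyn⟩ := hE i
  rw [stateAt_path hE h0, ← (hdyn p hp).2 v (by rw [data_outs]; simpa using hv),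
    mem_wordOf (q i).2 hst, J.encode_inl]

theorem satMarked_path {φ : PromptLTL (ℕ ⊕ Fin J.n)} {h : ℕ → List Bool} {m : ℕ → Bool}
    (hφ : φ.code < J.inputData.codeBound) (hE : ∀ t, J.inputData.Edge T (q t) (q (t + 1)))
    (hstep : ∀ t, tableauStep J.inputData.codeBound (q t).1.2.1 (h t) (h (t + 1)) (m (t + 1)) = true)
    (hm : ∀ t, ∃ u, t ≤ u ∧ m u = true)
    (hfair : ∀ d < J.inputData.codeBound, ∀ t, ∃ u, t ≤ u ∧ tableauFair (h u) d = true) :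
    (h 0).getD (2 * φ.code) false = true ↔
      φ.SatMarked (fun t => J.wordOf (q t).1) (fun t => m t = true) 0 := by
  rw [codeSat_of_tableau hstep hm hfair hφ 0]
  exact codeSat_code (fun i a => (mem_wordOf (q i).2 (hE i).1 a).symm) φ 0

end Violation

theorem assumption_lt : J.assumption.code < J.inputData.codeBound := by
  simp only [Data.codeBound, inputData, data]
  omega

theorem guarantee_lt : J.guarantee.code < J.inputData.codeBound := by
  simp only [Data.codeBound, inputData, data]
  omega

/-- The order of choices matters: the gap bound `B` fixes `k` first, then the alleged `l` is
obtained, and only then is the path pumped until guarantee marks are `l` apart. The assumption holds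
with bound `k`, whereas the guarantee with bound `l` would contradict its false table entry. -/
theorem not_tableSatisfies_of_hasFairPath (h : J.inputData.HasFairPath T) :
    ¬ J.TableSatisfies T := by
  obtain ⟨π₀, hs₀, hE₀, hF₀⟩ := h
  have hc : 0 < J.inputData.codeBound := Nat.succ_pos _
  have hJ : 0 < J.inputData.fairCount := Nat.mul_pos (by norm_num) hc
  obtain ⟨π, B, h0, hE, hF⟩ := exists_bounded_fair_path
    (F := fun j x => Data.fairBit x.1.1 j = true) hJ hE₀ hF₀
  rw [← h0] at hs₀
  obtain ⟨hs1, hs2⟩ := hs₀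
  simp only [Data.pumpInit, Bool.and_eq_true, decide_eq_true_eq, Bool.not_eq_true'] at hs1
  obtain ⟨htag, hA0, hG0⟩ := hs1
  intro hsat
  -- Pumping bounds the assumption windows by `B + 2` for every `l`; `satAt_of_satMarked` turns this
  -- into `2 * (B + 2) + 1`.
  obtain ⟨l, hl⟩ := hsat (2 * (B + 2) + 1)
  obtain ⟨y, f, hy, hf0, hf, hyf⟩ := exists_count_path (r := J.inputData.MarkA)
    (s := J.inputData.MarkG) l (Fin.ext htag) hE (fun t => by
      obtain ⟨u, h1, h2, h3⟩ := hF 0 hJ t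
      exact ⟨u, h1, h2, by simpa [Data.fairBit, Data.MarkA] using h3⟩)
  have hy0 : (y 0).1 = (π 0).1 := by rw [← hyf, hf0]
  have hEq : ∀ t, J.inputData.Edge T (y t).1 (y (t + 1)).1 := fun t => (hy t).1
  -- The pumped path still passes through all vertices of the original one in order, so it inherits
  -- recurrence of every condition.
  have hfair : ∀ j < J.inputData.fairCount, ∀ t, ∃ u, t ≤ u ∧
      Data.fairBit (y u).1.1 j = true := by
    intro j hj t
    obtain ⟨u, h1, -, h2⟩ := hF j hj t
    exact ⟨f u, h1.trans (hf.id_le u), by rw [hyf]; exact h2⟩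
  have hstat : ∀ t, _ ∧ _ ∧ _ ∧ _ := fun t => by
    have := (hEq t).1
    simp only [Data.staticEdge, Bool.and_eq_true] at this
    exact this
  have hlt : ∀ {d k}, d < J.inputData.codeBound → k < 4 →
      4 * d + k < J.inputData.fairCount := fun hd hk => by
    simp only [Data.fairCount]; omega
  have e2 : ∀ d, (4 * d + 2) % 4 = 2 ∧ (4 * d + 2) / 4 = d := fun d => by omega
  have e3 : ∀ d, (4 * d + 3) % 4 = 3 ∧ (4 * d + 3) / 4 = d := fun d => by omega
  have hA := satMarked_path (q := fun t => (y t).1) (h := fun t => (y t).1.1.tableA)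
    (m := fun t => (y t).1.1.markA) assumption_lt hEq (fun t => (hstat t).2.1)
    (fun t => by
      obtain ⟨u, h1, h2⟩ := hfair 0 hJ t
      exact ⟨u, h1, by simpa [Data.fairBit] using h2⟩)
    (fun d hd t => by
      obtain ⟨u, h1, h2⟩ := hfair (4 * d + 2) (hlt hd (by norm_num)) t
      exact ⟨u, h1, by simpa [Data.fairBit, e2] using h2⟩)
  have hG := satMarked_path (q := fun t => (y t).1) (h := fun t => (y t).1.1.tableG)
    (m := fun t => (y t).1.1.markG) guarantee_lt hEq (fun t => (hstat t).2.2.1)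
    (fun t => by
      obtain ⟨u, h1, h2⟩ := hfair 1 (hlt (d := 0) (k := 1) hc (by norm_num)) t
      exact ⟨u, h1, by simpa [Data.fairBit] using h2⟩)
    (fun d hd t => by
      obtain ⟨u, h1, h2⟩ := hfair (4 * d + 3) (hlt hd (by norm_num)) t
      exact ⟨u, h1, by simpa [Data.fairBit, e3] using h2⟩)
  have hword := path_mem_tableWords (q := fun t => (y t).1) hEq
    (fun p hp => by rw [hy0]; exact hs2 p hp)
  have h1 := PromptLTL.satAt_of_satMarked (count_path_bounded hy)
    (hA.1 (by rw [hy0]; exact hA0))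
  have h2 := hl _ hword h1
  have h3 := hG.2 (PromptLTL.satMarked_of_satAt
    (fun t u ht htu hmt hmu => count_path_spaced hy htu ht hmt hmu) h2)
  rw [hy0] at h3
  exact absurd (h3.symm.trans hG0) (by decide)

section Completeness

variable {w : ℕ → Finset (ℕ ⊕ Fin J.n)}

/-- The set of the codes of the variables that hold at a position. -/
def codesAt (w : ℕ → Finset (ℕ ⊕ Fin J.n)) (i e : ℕ) : Prop := ∃ a ∈ w i, Encodable.encode a = e

theorem codesAt_encode (i : ℕ) (a : ℕ ⊕ Fin J.n) : codesAt w i (Encodable.encode a) ↔ a ∈ w i :=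
  ⟨fun ⟨_, hb, he⟩ => Encodable.encode_injective he ▸ hb, fun h => ⟨a, h, rfl⟩⟩

open Classical in
/-- The vertex of the tableau graph at a position of a word with marks. -/
noncomputable def nodeAt (T : Table) (w : ℕ → Finset (ℕ ⊕ Fin J.n)) (m m' : ℕ → Prop) (t : ℕ) :
    BaseNode :=
  (List.ofFn fun p : Fin J.n => stateAt T w p t,
    (List.range J.inputData.width).map fun e => decide (codesAt w t e),
    (decide (m t), wordTable J.inputData.codeBound (codesAt w) m t),
    (decide (m' t), wordTable J.inputData.codeBound (codesAt w) m' t))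

variable {m m' : ℕ → Prop}

theorem state_nodeAt (p : Fin J.n) (t : ℕ) : (nodeAt T w m m' t).state p = stateAt T w p t := by
  simp [nodeAt, BaseNode.state]

theorem markA_nodeAt (t : ℕ) : (nodeAt T w m m' t).markA = true ↔ m t := by
  simp [nodeAt, BaseNode.markA]

theorem markG_nodeAt (t : ℕ) : (nodeAt T w m m' t).markG = true ↔ m' t := by
  simp [nodeAt, BaseNode.markG]

theorem letter_nodeAt (hw : w ∈ J.tableWords T) (t e : ℕ) :
    (nodeAt T w m m' t).letter e = true ↔ codesAt w t e := by
  classical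
  constructor
  · intro h
    rcases lt_or_ge e J.inputData.width with he | he
    · simpa only [nodeAt, BaseNode.letter, getD_map_range he, decide_eq_true_eq] using h
    · rw [BaseNode.letter, List.getD_eq_default _ _ (by simpa [nodeAt] using he)] at h
      exact absurd h (by decide)
  · rintro ⟨a, ha, rfl⟩
    have he := Data.lt_width (J.mem_varCodes.2 ⟨a, (hw t).1 ha, rfl⟩)
    simp only [nodeAt, BaseNode.letter, getD_map_range he, decide_eq_true_eq]
    exact ⟨a, ha, rfl⟩

theorem nodeAt_mem (hT : J.inputData.Valid T) (t : ℕ) :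
    nodeAt T w m m' t ∈ J.inputData.baseNodes := by
  refine Data.mem_baseNodes.2 ⟨⟨?_, fun a ha => ?_⟩, ?_, ?_, ?_⟩
  · simp [nodeAt, data_procs]
  · simp only [nodeAt, List.mem_ofFn] at ha
    obtain ⟨p, rfl⟩ := ha
    have := stateAt_lt hT w p t
    rw [← data_bnd] at this
    exact this.trans_le (Data.bnd_le_maxStates (by rw [data_procs]; exact p.2))
  · simp [nodeAt]
  · simp [nodeAt, BaseNode.tableA, wordTable]
  · simp [nodeAt, BaseNode.tableG, wordTable]

theorem edge_nodeAt (hT : J.inputData.Valid T) (hw : w ∈ J.tableWords T) (t : ℕ) :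
    J.inputData.Edge T ⟨nodeAt T w m m' t, nodeAt_mem hT t⟩
      ⟨nodeAt T w m m' (t + 1), nodeAt_mem hT (t + 1)⟩ := by
  classical
  have hlet := letter_nodeAt (m := m) (m' := m') hw t
  constructor
  · simp only [Data.staticEdge, Bool.and_eq_true, List.all_eq_true, List.mem_range]
    refine ⟨fun e _ => ?_, ?_, ?_, fun p hp => ?_⟩
    · cases he : (nodeAt T w m m' t).letter e with
      | false => rfl
      | true =>
        obtain ⟨a, ha, rfl⟩ := (hlet e).1 he
        rw [Bool.not_true, Bool.false_or, List.any_eq_true]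
        exact ⟨_, J.mem_varCodes.2 ⟨a, (hw t).1 ha, rfl⟩, decide_eq_true rfl⟩
    · exact tableauStep_wordTable hlet (decide_eq_true_iff (p := m (t + 1)))
    · exact tableauStep_wordTable hlet (decide_eq_true_iff (p := m' (t + 1)))
    · rw [data_procs] at hp
      cases he : (nodeAt T w m m' t).letter (2 * p + 1) with
      | true => rfl
      | false =>
        rw [Bool.false_or, decide_eq_true_eq, state_nodeAt ⟨p, hp⟩, state_nodeAt ⟨p, hp⟩, stateAt,
          if_neg]
        intro h
        have := (hlet (2 * p + 1)).2 ⟨_, h, J.encode_inr ⟨p, hp⟩⟩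
        rw [he] at this
        exact absurd this (by decide)
  · intro p hp
    rw [data_procs] at hp
    have hst := fun t => state_nodeAt (T := T) (w := w) (m := m) (m' := m') ⟨p, hp⟩ t
    simp only at hst
    refine ⟨fun he => ?_, fun v hv => ?_⟩
    · have hin : Sum.inr ⟨p, hp⟩ ∈ w t := by
        rw [hlet, ← J.encode_inr ⟨p, hp⟩] at he
        exact (codesAt_encode t _).1 he
      have hkey : J.inputKey ⟨p, hp⟩ (w t) = (nodeAt T w m m' t).key J.inputData p := by
        unfold inputKey BaseNode.key
        rw [J.data_ins ⟨p, hp⟩]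
        refine List.map_congr_left fun v _ => ?_
        rw [Bool.eq_iff_iff, decide_eq_true_eq, hlet, ← J.encode_inl, codesAt_encode]
      rw [hst, hst, stateAt, if_pos hin, hkey]
    · rw [J.data_outs ⟨p, hp⟩] at hv
      rw [hst, hlet, ← J.encode_inl, codesAt_encode]
      exact (hw t).2 ⟨p, hp⟩ v (by simpa using hv)

end Completeness

/-- The failing `k` determines `l` by pigeonhole before any word is chosen. A counterexample for `2
* l + 1` is then marked periodically, with periods `k + 1` for the assumption and `l` for the
guarantee. -/
theorem hasFairPath_of_not_tableSatisfies (hT : J.inputData.Valid T) (h : ¬ J.TableSatisfies T) :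
    J.inputData.HasFairPath T := by
  classical
  simp only [TableSatisfies, not_forall, not_exists] at h
  obtain ⟨k, hk⟩ := h
  obtain ⟨l, hl0, hl⟩ := exists_pump_path (E := J.inputData.Edge T) (r := J.inputData.MarkA)
    (s := J.inputData.MarkG) k
  -- With marks at the multiples of `l`, marked truth of the guarantee would imply truth with bound
  -- `2 * l + 1`; so the marked guarantee fails too.
  obtain ⟨w, hw, hφ, hψ⟩ := hk (2 * l + 1)
  let m : ℕ → Prop := fun t => k + 1 ∣ t
  let m' : ℕ → Prop := fun t => l ∣ t
  obtain ⟨π, hπ, h0, hE⟩ := hl (fun t => ⟨nodeAt T w m m' t, nodeAt_mem hT t⟩) (edge_nodeAt hT hw)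
    (fun t => (markA_nodeAt _).2 (Dvd.intro_left t rfl))
    markG_nodeAt
  have hπ' : ∀ t, (π t).1.1 = nodeAt T w m m' t := fun t => by rw [hπ]
  have hmark : ∀ {b}, 0 < b → ∀ t, ∃ u, t ≤ u ∧ u ≤ t + b ∧ b ∣ u := by
    intro b hb t
    refine ⟨(t / b + 1) * b, ?_, ?_, Dvd.intro_left _ rfl⟩
    · have := Nat.lt_div_mul_add hb (a := t)
      rw [Nat.succ_mul]
      omega
    · have := Nat.div_mul_le_self t b
      rw [Nat.succ_mul]
      omega
  refine ⟨π, ⟨?_, fun p hp => ?_⟩, hE, fun j hj t => ?_⟩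
  · have hA : J.assumption.SatMarked w m 0 := by
      refine PromptLTL.satMarked_of_satAt (fun t u _ htu hmt hmu => ?_) hφ
      have := Nat.le_of_dvd (by omega) (Nat.dvd_sub hmu hmt)
      omega
    have hG : ¬ J.guarantee.SatMarked w m' 0 := fun hG =>
      hψ (PromptLTL.satAt_of_satMarked (hmark hl0) hG)
    rw [← codeSat_code codesAt_encode, ← getD_wordTable assumption_lt] at hA
    rw [← codeSat_code codesAt_encode, ← getD_wordTable guarantee_lt, Bool.not_eq_true] at hG
    simp only [Data.pumpInit, Bool.and_eq_true, decide_eq_true_eq, Bool.not_eq_true',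
      Data.toPumpNode, hπ', h0]
    exact ⟨rfl, hA, hG⟩
  · rw [data_procs] at hp
    rw [hπ', state_nodeAt ⟨p, hp⟩, stateAt]
  · have hd : j / 4 < J.inputData.codeBound := by
      simp only [Data.fairCount] at hj
      omega
    have h4 : j % 4 < 4 := Nat.mod_lt _ (by norm_num)
    simp only [hπ']
    generalize hr : j % 4 = r at h4
    simp only [Data.fairBit, hr]
    interval_cases r
    · obtain ⟨u, h1, -, h2⟩ := hmark k.succ_pos t
      exact ⟨u, h1, (markA_nodeAt u).2 h2⟩
    · obtain ⟨u, h1, -, h2⟩ := hmark hl0 t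
      exact ⟨u, h1, (markG_nodeAt u).2 h2⟩
    · exact tableauFair_wordTable hd t
    · exact tableauFair_wordTable hd t

/-- The constraint system of an instance. -/
def constraintSystem (J : Instance) : ConstraintSystem :=
  ConstraintSystem.ofSequents J.inputData.sequents

theorem satisfiable_constraintSystem (J : Instance) :
    J.constraintSystem.Satisfiable ↔ J.Realizable := by
  rw [constraintSystem, Data.satisfiable_sequents_iff, realizable_iff]
  refine exists_congr fun T => and_congr_right fun hT => ?_
  exact ⟨fun h => by_contra fun hn => h (hasFairPath_of_not_tableSatisfies hT hn),
    fun h hf => not_tableSatisfies_of_hasFairPath hf h⟩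

theorem primrec_code_constraintSystem : Primrec fun D : Data => conjunctionCode D.sequents :=
  primrec_conjunctionCode.comp PR.sequents

end Instance

end PromptSynthesis

theorem mainTheorem1 :
    -- satisfiability of constraint systems is decidable
    (∃ D : ℕ → Prop, ComputablePred D ∧
      ∀ C : PromptSynthesis.ConstraintSystem, D C.code ↔ C.Satisfiable) ∧
    -- the constraint system is constructed effectively
    (∃ build : PromptSynthesis.Instance → PromptSynthesis.ConstraintSystem,
      (∃ g : (ℕ × ℕ) × (List ℕ × List ℕ) × List (ℕ × List ℕ × List ℕ) → ℕ,
        Computable g ∧ ∀ J : PromptSynthesis.Instance, g J.data = (build J).code) ∧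
      ∀ J : PromptSynthesis.Instance, (build J).Satisfiable ↔ J.Realizable) :=
  ⟨PromptSynthesis.decidable_satisfiable, PromptSynthesis.Instance.constraintSystem,
    ⟨_, PromptSynthesis.Instance.primrec_code_constraintSystem.to_comp, fun _ =>
      (PromptSynthesis.ConstraintSystem.code_ofSequents _).symm⟩,
    PromptSynthesis.Instance.satisfiable_constraintSystem⟩
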